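/- Let $\mathcal F$ be a germ of codimension one holomorphic foliation on $(\mathbb C^n,0)$, given by an integrable holomorphic $1$-form whose coefficients have no common factor. Assume that $\mathcal F$ is a complex hyperbolic foliation (CH-foliation): for every holomorphic germ $\phi:(\mathbb C^2,0)\to(\mathbb C^n,0)$ generically transversal to $\mathcal F$, the reduction of singularities of $\phi^*\mathcal F$ has no saddle-nodes. Let $E\subset(\mathbb C^n,0)$ be a normal crossings divisor and write $E_{\mathrm{inv}}$ for the union of the irreducible components of $E$ invariant by $\mathcal F$. Let $Y\subset(\mathbb C^n,0)$ be a nonsingular subspace of codimension at least $2$, having normal crossings with $E$ and invariant by $\mathcal F$. Let $\pi:M\to(\mathbb C^n,0)$ be the blow-up with center $Y$, let $E'=\pi^{-1}(E\cup Y)$, and let $\mathcal F'=\pi^*\mathcal F$ be the transform of $\mathcal F$. The dimensional type of a foliation germ is the least $\tau$ such that, in suitable local coordinates $x_1,\dots,x_n$, it is given by a form $\sum_{i=1}^{\tau}a_i(x_1,\dots,x_\tau)\,dx_i$. The origin is a pre-simple CH-corner for $\mathcal F,E$ if, $\tau$ being the dimensional type of $\mathcal F$, there are local coordinates such that $E_{\mathrm{inv}}=(\prod_{i=1}^{\tau}x_i=0)$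 and $\mathcal F$ is given by $\omega=0$ with $$\omega=\sum_{i=1}^{\tau}\bigl(\lambda_i+b_i(x_1,\dots,x_\tau)\bigr)\frac{dx_i}{x_i},\qquad b_i\in\mathbb C\{x_1,\dots,x_\tau\},\quad b_i(0)=0,\quad \prod_{i=1}^{\tau}\lambda_i\neq0;$$ the same definition applies to $\mathcal F',E'$ at a point $p\in M$. The adapted singular locus $\mathrm{Sing}(\mathcal F',E')$ is the set of points $p$ at which it is not true that $\mathcal F'$ is nonsingular and $H\cup E'$ is locally a normal crossings divisor, where $H$ is the invariant hypersurface of $\mathcal F'$ through $p$. If the origin is a pre-simple CH-corner for $\mathcal F,E$, then every point $p\in\pi^{-1}(0)\cap\mathrm{Sing}(\mathcal F',E')$ is a pre-simple CH-corner for $\mathcal F',E'$. -/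

import Mathlib

open Filter Topology

noncomputable section

namespace CHFol

/-- The affine space `ℂⁿ`. Germs at the origin are represented by actual functions and sets,
and are compared on neighbourhoods of `0`. -/
abbrev V (n : ℕ) : Type := Fin n → ℂ

/-- Differential `1`-forms on `ℂⁿ`. -/
abbrev OneForm (n : ℕ) : Type := V n → (V n →L[ℂ] ℂ)

/-- Pull-back of a `1`-form. -/
def pullback {m n : ℕ} (φ : V m → V n) (ω : OneForm n) : OneForm m :=
  fun x => (ω (φ x)).comp (fderiv ℂ φ x)

/-- The exterior derivative `dω` at `x`, evaluated at `u, v`. -/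
def dForm {n : ℕ} (ω : OneForm n) (x u v : V n) : ℂ :=
  fderiv ℂ ω x u v - fderiv ℂ ω x v u

/-- Frobenius integrability `ω ∧ dω = 0` near the origin. -/
def Integrable {n : ℕ} (ω : OneForm n) : Prop :=
  ∀ᶠ x in 𝓝 (0 : V n), ∀ u v w : V n,
    ω x u * dForm ω x v w + ω x v * dForm ω x w u + ω x w * dForm ω x u v = 0

/-- The coefficients of `ω` have no common factor in the ring of convergent power series
(equivalently, `ω ≠ 0` and its zero locus has codimension at least two). -/
def Saturated {n : ℕ} (ω : OneForm n) : Prop :=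
  ∀ (h : V n → ℂ) (α : OneForm n), AnalyticAt ℂ h 0 → AnalyticAt ℂ α 0 →
    (∀ᶠ x in 𝓝 (0 : V n), ω x = h x • α x) → h 0 ≠ 0

/-- A germ of (possibly singular) codimension one holomorphic foliation on `(ℂⁿ, 0)`, given by an
integrable holomorphic `1`-form without common factors in its coefficients. -/
structure FoliationGerm (n : ℕ) where
  form : OneForm n
  analytic : AnalyticAt ℂ form 0
  integrable : Integrable form
  saturated : Saturated form

/-- A system of local coordinates at `0 ∈ ℂⁿ` (a germ of biholomorphism of `(ℂⁿ, 0)`). The `i`-th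
coordinate of `x` is `Φ.toFun x i`. -/
structure LocalCoords (n : ℕ) where
  toFun : V n → V n
  invFun : V n → V n
  map_zero : toFun 0 = 0
  inv_zero : invFun 0 = 0
  analytic : AnalyticAt ℂ toFun 0
  inv_analytic : AnalyticAt ℂ invFun 0
  left_inv : ∀ᶠ x in 𝓝 (0 : V n), invFun (toFun x) = x
  right_inv : ∀ᶠ x in 𝓝 (0 : V n), toFun (invFun x) = x

namespace LocalCoords

variable {n : ℕ}

/-- The differential of the `i`-th coordinate function. -/
def dcoord (Φ : LocalCoords n) (i : Fin n) : OneForm n :=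
  fun x => (ContinuousLinearMap.proj (R := ℂ) (φ := fun _ : Fin n => ℂ) i).comp
    (fderiv ℂ Φ.toFun x)

/-- The first `k` coordinates. -/
def first (Φ : LocalCoords n) {k : ℕ} (hk : k ≤ n) (x : V n) : V k :=
  fun i => Φ.toFun x (Fin.castLE hk i)

/-- `D = (∏_{i ∈ A} x_i = 0)` as germs at the origin. -/
def IsDivisor (Φ : LocalCoords n) (A : Finset (Fin n)) (D : Set (V n)) : Prop :=
  ∀ᶠ x in 𝓝 (0 : V n), x ∈ D ↔ ∃ i ∈ A, Φ.toFun x i = 0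

/-- `Y = (x_i = 0, i ∈ B)` as germs at the origin. -/
def IsSubspace (Φ : LocalCoords n) (B : Finset (Fin n)) (Y : Set (V n)) : Prop :=
  ∀ᶠ x in 𝓝 (0 : V n), x ∈ Y ↔ ∀ i ∈ B, Φ.toFun x i = 0

end LocalCoords

/-- `D` is (the support of) a normal crossings divisor of `(ℂⁿ, 0)`. -/
def IsNCDivisor {n : ℕ} (D : Set (V n)) : Prop :=
  ∃ (Φ : LocalCoords n) (A : Finset (Fin n)), Φ.IsDivisor A D

namespace FoliationGerm

variable {n : ℕ}

/-- The foliation is given by `α = 0`, where `α` is a holomorphic `1`-form which is not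
identically zero, possibly with common factors in its coefficients: `α ∧ F.form = 0`. -/
def DefinedBy (F : FoliationGerm n) (α : OneForm n) : Prop :=
  (¬ ∀ᶠ x in 𝓝 (0 : V n), α x = 0) ∧
  ∀ᶠ x in 𝓝 (0 : V n), ∀ u v : V n, α x u * F.form x v = α x v * F.form x u

/-- `φ : (ℂᵐ, 0) → (ℂⁿ, 0)` is generically transversal to `F` (that is, `φ^* F.form` is not
identically zero) and `G = φ^* F`. -/
def IsPullback {m : ℕ} (φ : V m → V n) (F : FoliationGerm n) (G : FoliationGerm m) : Prop :=
  G.DefinedBy (pullback φ F.form)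

/-- The nonsingular subspace `(x_i = 0, i ∈ B)` is invariant by `F`: the form vanishes
on its tangent vectors. -/
def InvariantAlong (F : FoliationGerm n) (Φ : LocalCoords n) (B : Finset (Fin n)) : Prop :=
  ∀ᶠ x in 𝓝 (0 : V n), (∀ i ∈ B, Φ.toFun x i = 0) →
    ∀ v : V n, (∀ i ∈ B, Φ.dcoord i x v = 0) → F.form x v = 0

/-- `D = E_inv`: the union of the irreducible components of the normal crossings divisor `E`
that are invariant by `F`. -/
def IsInvPart (F : FoliationGerm n) (E D : Set (V n)) : Prop :=
  ∃ (Φ : LocalCoords n) (A : Finset (Fin n)), Φ.IsDivisor A E ∧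
    ∀ᶠ x in 𝓝 (0 : V n), x ∈ D ↔ ∃ i ∈ A, F.InvariantAlong Φ {i} ∧ Φ.toFun x i = 0

/-- `F` and `E` have normal crossings at the origin: `F` is nonsingular and `H ∪ E` is a normal
crossings divisor, where `H` is the invariant hypersurface of `F` through the origin. -/
def NormalCrossings (F : FoliationGerm n) (E : Set (V n)) : Prop :=
  F.form 0 ≠ 0 ∧ ∃ (Φ : LocalCoords n) (i : Fin n),
    F.InvariantAlong Φ {i} ∧ IsNCDivisor ({x | Φ.toFun x i = 0} ∪ E)

/-- The origin belongs to the adapted singular locus `Sing(F, E)`. -/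
def AdaptedSingular (F : FoliationGerm n) (E : Set (V n)) : Prop :=
  ¬ F.NormalCrossings E

/-- In some local coordinates `F` is given by `∑_{i ≤ k} a_i(x_1, …, x_k) dx_i = 0`. -/
def DependsOn (F : FoliationGerm n) (k : ℕ) : Prop :=
  ∃ (hk : k ≤ n) (Φ : LocalCoords n) (a : Fin k → V k → ℂ),
    (∀ i, AnalyticAt ℂ (a i) 0) ∧
    F.DefinedBy (fun x => ∑ i : Fin k, a i (Φ.first hk x) • Φ.dcoord (Fin.castLE hk i) x)

/-- `F` has dimensional type `τ`. -/
def HasDimType (F : FoliationGerm n) (τ : ℕ) : Prop :=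
  IsLeast {k | F.DependsOn k} τ

end FoliationGerm

/-- The logarithmic form `∑_{i ≤ τ} (c_i + b_i(x_1, …, x_τ)) dx_i / x_i`, multiplied by
`x_1 ⋯ x_τ` in order to clear the denominators. -/
def logForm {n : ℕ} (Φ : LocalCoords n) {τ : ℕ} (hτ : τ ≤ n) (c : Fin τ → ℂ)
    (b : Fin τ → V τ → ℂ) : OneForm n :=
  fun x => ∑ i : Fin τ,
    ((c i + b i (Φ.first hτ x)) * ∏ j ∈ Finset.univ.erase i, Φ.first hτ x j) •
      Φ.dcoord (Fin.castLE hτ i) x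

/-- The origin is a pre-simple complex hyperbolic corner for the pair `F, E`. -/
def FoliationGerm.IsPreSimpleCHCorner {n : ℕ} (F : FoliationGerm n) (E : Set (V n)) : Prop :=
  ∃ (τ : ℕ) (hτ : τ ≤ n) (Φ : LocalCoords n) (c : Fin τ → ℂ) (b : Fin τ → V τ → ℂ),
    F.HasDimType τ ∧
    F.IsInvPart E {x | ∃ i : Fin τ, Φ.first hτ x i = 0} ∧
    (∀ i, AnalyticAt ℂ (b i) 0 ∧ b i 0 = 0) ∧
    (∀ i, c i ≠ 0) ∧
    F.DefinedBy (logForm Φ hτ c b)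

/-- The blow-up of `ℂⁿ` with center the coordinate subspace `(z_i = 0, i ∈ B)`: the pairs
`(z, ℓ)`, with `ℓ` a line of `ℂ^B`, such that `(z_i)_{i ∈ B} ∈ ℓ`. -/
def BlowUp {n : ℕ} (B : Finset (Fin n)) : Type :=
  {q : V n × Projectivization ℂ (B → ℂ) // (fun i : B => q.1 i) ∈ q.2.submodule}

namespace BlowUp

variable {n : ℕ} {B : Finset (Fin n)}

/-- The blow-down morphism, in the coordinates `z`. -/
def proj (q : BlowUp B) : V n := q.1.1

/-- The points `(0, ℓ)` of the fiber over the origin. -/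
def fiberPoint (ℓ : Projectivization ℂ (B → ℂ)) : BlowUp B :=
  ⟨(0, ℓ), ℓ.submodule.zero_mem⟩

/-- Affine coordinates of the line in the chart of `chart` below. -/
def direction (ℓ : Projectivization ℂ (B → ℂ)) (i₀ : B) (y : V n) : B → ℂ :=
  fun i => if i = i₀ then 1 else y i + ℓ.rep i / ℓ.rep i₀

theorem direction_ne_zero (ℓ : Projectivization ℂ (B → ℂ)) (i₀ : B) (y : V n) :
    direction ℓ i₀ y ≠ 0 := by
  intro h
  have := congrFun h i₀
  simp [direction] at this

/-- The standard affine chart of the blow-up, in the coordinates `y` centered at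
the point `(0, ℓ)`, where `ℓ_{i₀} ≠ 0`: with `μ_i = ℓ_i / ℓ_{i₀}`, it is given by
`z_{i₀} = y_{i₀}`, `z_i = (y_i + μ_i) y_{i₀}` for `i ∈ B \ {i₀}` and `z_i = y_i` for `i ∉ B`. -/
def chart (ℓ : Projectivization ℂ (B → ℂ)) (i₀ : B) (y : V n) : BlowUp B :=
  ⟨(fun i => if h : i ∈ B then y i₀ * direction ℓ i₀ y ⟨i, h⟩ else y i,
    Projectivization.mk ℂ (direction ℓ i₀ y) (direction_ne_zero ℓ i₀ y)), by
    rw [Projectivization.submodule_mk, Submodule.mem_span_singleton]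
    refine ⟨y i₀, ?_⟩
    funext i
    simp⟩

/-- The chart is centered at `(0, ℓ)`. -/
theorem chart_zero (ℓ : Projectivization ℂ (B → ℂ)) (i₀ : B) (h : ℓ.rep i₀ ≠ 0) :
    chart (n := n) ℓ i₀ 0 = fiberPoint ℓ := by
  apply Subtype.ext
  apply Prod.ext
  · funext i
    simp [chart, fiberPoint]
  · simp only [chart, fiberPoint]
    conv_rhs => rw [← ℓ.mk_rep]
    rw [Projectivization.mk_eq_mk_iff']
    refine ⟨(ℓ.rep i₀)⁻¹, ?_⟩
    funext i
    by_cases hi : i = i₀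
    · subst hi
      simp [direction, h]
    · simp only [Pi.smul_apply, smul_eq_mul, direction, hi, if_false, Pi.zero_apply]
      field_simp
      simp

end BlowUp

/-- The linear part at the origin of the vector field `a₁ ∂/∂x₀ - a₀ ∂/∂x₁`, which generates the
foliation of `(ℂ², 0)` given by `a₀ dx₀ + a₁ dx₁ = 0`. -/
def linearPart (G : FoliationGerm 2) : Matrix (Fin 2) (Fin 2) ℂ :=
  let d : Fin 2 → Fin 2 → ℂ :=
    fun j k => fderiv ℂ G.form 0 (Pi.single j 1) (Pi.single k 1)
  !![d 0 1, d 1 1; - d 0 0, - d 1 0]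

/-- The origin is a saddle-node of `G`: a singular point with exactly one zero eigenvalue. -/
def IsSaddleNode (G : FoliationGerm 2) : Prop :=
  G.form 0 = 0 ∧ (linearPart G).det = 0 ∧ (linearPart G).trace ≠ 0

/-- A singular point which is simple (reduced) in the sense of Seidenberg: the eigenvalues
`r, s` satisfy `s ≠ 0` and `r / s` is not a positive rational number. -/
def IsReducedSing (G : FoliationGerm 2) : Prop :=
  G.form 0 = 0 ∧ ∃ r s : ℂ, (linearPart G).trace = r + s ∧ (linearPart G).det = r * s ∧
    s ≠ 0 ∧ ∀ q : ℚ, 0 < q → r ≠ q * s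

/-- Both coordinates of `ℂ²`: the center given by them is the origin. -/
abbrev bothAxes : Finset (Fin 2) := Finset.univ

/-- There is a saddle-node in the reduction of singularities of `G`, which is obtained by
repeatedly blowing up the singular points that are not simple. -/
inductive HasSaddleNodeInReduction : FoliationGerm 2 → Prop
  | here (G : FoliationGerm 2) : IsSaddleNode G → HasSaddleNodeInReduction G
  | blowUp (G G' : FoliationGerm 2)
      (ℓ : Projectivization ℂ (bothAxes → ℂ)) (i₀ : bothAxes) :
      G.form 0 = 0 → ¬ IsReducedSing G → ℓ.rep i₀ ≠ 0 →
      FoliationGerm.IsPullback (fun y => (BlowUp.chart ℓ i₀ y).proj) G G' →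
      HasSaddleNodeInReduction G' → HasSaddleNodeInReduction G

/-- `F` is a complex hyperbolic foliation (CH-foliation). -/
def FoliationGerm.IsCH {n : ℕ} (F : FoliationGerm n) : Prop :=
  ∀ φ : V 2 → V n, AnalyticAt ℂ φ 0 → φ 0 = 0 →
    ∀ G : FoliationGerm 2, FoliationGerm.IsPullback φ F G → ¬ HasSaddleNodeInReduction G

/-- The blow-up morphism `π` of `(ℂⁿ, 0)` with center `(Φ_i = 0, i ∈ B)`, read in the
standard chart `BlowUp.chart ℓ i₀` centered at the point `(0, ℓ)` of `π⁻¹(0)`. -/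
def blowDownAt {n : ℕ} (Φ : LocalCoords n) {B : Finset (Fin n)}
    (ℓ : Projectivization ℂ (B → ℂ)) (i₀ : B) : V n → V n :=
  fun y => Φ.invFun (BlowUp.chart ℓ i₀ y).proj

end CHFol

end

/-! The property that survives a blow-up is weaker than the normal form of a pre-simple corner: in
coordinates adapted to the divisor, the foliation is given by a logarithmic form `∑ a i dx i /
weight S x i` whose poles `S` are some components of the divisor, with nonzero residues `a i 0`. The
remaining coordinates may occur, both in the coefficients and through regular terms. The proof
passes from a corner to such a form, blows it up, and recovers the normal form.

Passing to a logarithmic form (`IsPreSimpleCHCorner.exists_isLogEquation`): the coordinates of the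
corner that define `E_inv` are units times coordinates adapted to both `E` and `Y`, and `d(uz)/(uz)
= dz/z + du/u` changes only regular terms. Invariance of `Y` forces it into some pole
(`exists_mem_of_invariantAlong`).

Blowing up (`exists_isLogEquation_blowChart`): poles go to their strict transforms with a residue
still nonzero, and the exceptional divisor receives the sum of the residues of the poles containing
the center. Once one of these residues is normalized to `1`, integrability makes each other one
constant on the intersection of the two poles (`eventually_eq_const_on_inter_poles`), so the sum is
constant on the exceptional divisor. Either it is nonzero, and the exceptional divisor is a new
pole, or it is divisible by the exceptional equation, and the pole disappears. If no pole is left at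
the point, some coordinate `e` that is not a component of the total transform has a nonzero
coefficient; the leaf is then transversal to the strata of the divisor, and the point is not in the
adapted singular locus.

Recovering the normal form (`exists_straightening`): a coefficient that is nonzero at the origin is
normalized to `1`, and one moves along the flow of `x e ∂/∂x e` (or of `∂/∂x e` off the poles) for a
time `φ x`. This adds `dφ` to the logarithmic form, and `φ` can be chosen so that the radial field
of the superfluous coordinates annihilates the result. Integrability then eliminates those
coordinates altogether. The function `φ` solves an ordinary differential equation along rays, whose
analytic dependence on the point comes from the implicit function theorem in a space of continuous
paths. The number of poles is the dimensional type, because a vector field tangent to the foliation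
is tangent to every pole (`card_le_of_dependsOn`). -/

namespace CHFol

/-! ### Superposition operators and fixed points in Banach spaces -/

section Superposition

variable {K : Type*} [TopologicalSpace K] [CompactSpace K]
  {E F : Type*} [NormedAddCommGroup E] [NormedSpace ℂ E] [NormedAddCommGroup F] [NormedSpace ℂ F]

/-- The pointwise action of a continuous multilinear map on continuous functions. -/
noncomputable def superpositionMultilinear {m : ℕ}
    (p : ContinuousMultilinearMap ℂ (fun _ : Fin m => E) F) :
    ContinuousMultilinearMap ℂ (fun _ : Fin m => C(K, E)) C(K, F) :=
  MultilinearMap.mkContinuous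
    { toFun := fun h => ⟨fun s => p (fun j => h j s), by fun_prop⟩
      map_update_add' := by
        intro _ h i x y
        ext s
        have key : ∀ z : C(K, E), (fun j => Function.update h i z j s)
            = Function.update (fun j => h j s) i (z s) := by
          intro z; funext j
          by_cases hj : j = i
          · subst hj; simp
          · simp [hj]
        simp [key]
      map_update_smul' := by
        intro _ h i c x
        ext s
        have key : ∀ z : C(K, E), (fun j => Function.update h i z j s)
            = Function.update (fun j => h j s) i (z s) := by
          intro z; funext j
          by_cases hj : j = i
          · subst hj; simp
          · simp [hj]
        simp [key] } ‖p‖ (by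
    intro h
    rw [ContinuousMap.norm_le _ (by positivity)]
    intro s
    refine (p.le_opNorm _).trans ?_
    gcongr with j
    exact (h j).norm_coe_le_norm s)

theorem norm_superpositionMultilinear_le {m : ℕ}
    (p : ContinuousMultilinearMap ℂ (fun _ : Fin m => E) F) :
    ‖superpositionMultilinear (K := K) p‖ ≤ ‖p‖ :=
  MultilinearMap.mkContinuous_norm_le _ (norm_nonneg _) _

/-- The superposition operator `h ↦ f ∘ h` of an analytic germ is analytic. -/
theorem exists_analyticAt_superposition [CompleteSpace F] {f : E → F} (hf : AnalyticAt ℂ f 0) :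
    ∃ N : C(K, E) → C(K, F), AnalyticAt ℂ N 0 ∧ ∀ᶠ h in 𝓝 (0 : C(K, E)), ∀ s, N h s = f (h s) := by
  obtain ⟨p, r, hp⟩ := hf
  let P : FormalMultilinearSeries ℂ C(K, E) C(K, F) := fun m => superpositionMultilinear (p m)
  -- Applying the `m`-th term of the series pointwise does not increase its norm, so the series
  -- converges at least on the same ball; evaluation at `s` then gives back the series of `f` at `h
  -- s`.
  have hPr : p.radius ≤ P.radius :=
    FormalMultilinearSeries.radius_le_of_le fun m => norm_superpositionMultilinear_le (p m)
  have hpos : 0 < P.radius := (hp.r_pos.trans_le hp.r_le).trans_le hPr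
  have hP := P.hasFPowerSeriesOnBall hpos
  refine ⟨P.sum, hP.analyticAt, ?_⟩
  filter_upwards [Metric.eball_mem_nhds (0 : C(K, E)) hp.r_pos] with h hh s
  have hh' : h ∈ Metric.eball (0 : C(K, E)) P.radius :=
    Metric.eball_subset_eball (hp.r_le.trans hPr) hh
  have h1 := (hP.hasSum hh').mapL (ContinuousMap.evalCLM ℂ s)
  have hs : h s ∈ Metric.eball (0 : E) r := by
    have h2 : ‖h s‖ₑ ≤ ‖h‖ₑ := by
      simpa [enorm_le_iff_norm_le] using h.norm_coe_le_norm s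
    simp only [Metric.mem_eball, edist_zero_right] at hh ⊢
    exact h2.trans_lt hh
  have h3 := hp.hasSum hs
  simp only [zero_add] at h1 h3
  exact h1.unique h3

end Superposition

section Inverse

variable {X Y : Type*} [NormedAddCommGroup X] [NormedSpace ℂ X]
  [NormedAddCommGroup Y] [NormedSpace ℂ Y]

theorem exists_analyticAt_inverse [CompleteSpace X] {f : X → Y} (hf : AnalyticAt ℂ f 0) (h0 : f 0 = 0)
    (e : X ≃L[ℂ] Y) (he : fderiv ℂ f 0 = e) :
    ∃ R : Y → X, AnalyticAt ℂ R 0 ∧ R 0 = 0 ∧ (∀ᶠ x in 𝓝 (0 : X), R (f x) = x) ∧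
      ∀ᶠ y in 𝓝 (0 : Y), f (R y) = y := by
  have hd : HasStrictFDerivAt f (e : X →L[ℂ] Y) 0 := he ▸ hf.hasStrictFDerivAt
  refine ⟨hd.localInverse f e 0, ?_, ?_, hd.eventually_left_inverse, ?_⟩
  · have := (hd.toOpenPartialHomeomorph f).analyticAt_symm' (a := 0) (i := e)
      hd.mem_toOpenPartialHomeomorph_source hf he
    rw [hd.toOpenPartialHomeomorph_coe, h0] at this
    exact this
  · have := hd.localInverse_apply_image
    rwa [h0] at this
  · have := hd.eventually_right_inverse
    rwa [h0] at this

/-- Analytic solutions `h = H y` of `h = N (h, y)`, when `N (h, 0) = 0`. -/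
theorem exists_analyticAt_fixedPoint [CompleteSpace X] [CompleteSpace Y] {N : X × Y → X} (hN : AnalyticAt ℂ N 0)
    (hN0 : ∀ᶠ h in 𝓝 (0 : X), N (h, 0) = 0) :
    ∃ H : Y → X, AnalyticAt ℂ H 0 ∧ H 0 = 0 ∧ (∀ᶠ y in 𝓝 (0 : Y), H y = N (H y, y)) ∧
      ∀ᶠ p in 𝓝 (0 : X × Y), p.1 = N p → p.1 = H p.2 := by
  let D := fderiv ℂ N 0
  -- Since `N` vanishes on `X × 0`, so does its derivative. This replaces a contraction estimate.
  have hD : ∀ h : X, D (h, 0) = 0 := by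
    intro h
    have h1 : HasFDerivAt (fun h : X => N (h, 0)) (D.comp (ContinuousLinearMap.inl ℂ X Y)) 0 := by
      have h2 : HasFDerivAt N D ((ContinuousLinearMap.inl ℂ X Y) 0) := by
        rw [map_zero]
        exact hN.differentiableAt.hasFDerivAt
      exact h2.comp 0 (ContinuousLinearMap.inl ℂ X Y).hasFDerivAt
    have h3 : HasFDerivAt (fun h : X => N (h, 0)) (0 : X →L[ℂ] X) 0 :=
      (hasFDerivAt_const (0 : X) (0 : X)).congr_of_eventuallyEq hN0
    exact congrArg (fun L : X →L[ℂ] X => L h) (h1.unique h3)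
  have hDz : ∀ p : X × Y, D p = D (0, p.2) := by
    intro p
    have : p = (p.1, 0) + (0, p.2) := by simp
    conv_lhs => rw [this]
    rw [map_add, hD, zero_add]
  -- The derivative of `(h, y) ↦ (h - N (h, y), y)`. As `D` kills `X × 0`, the perturbation `inl ∘
  -- D` has square zero, and changing its sign gives the inverse.
  let e1 : X × Y →L[ℂ] X × Y := ContinuousLinearMap.id ℂ _ - (ContinuousLinearMap.inl ℂ X Y).comp D
  let e2 : X × Y →L[ℂ] X × Y := ContinuousLinearMap.id ℂ _ + (ContinuousLinearMap.inl ℂ X Y).comp D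
  let e : (X × Y) ≃L[ℂ] X × Y := ContinuousLinearEquiv.equivOfInverse e1 e2
    (by intro p; simp [e1, e2, map_sub, hD]) (by intro p; simp [e1, e2, map_add, hD])
  have hM : AnalyticAt ℂ (fun p : X × Y => (p.1 - N p, p.2)) 0 :=
    (analyticAt_fst.sub hN).prod analyticAt_snd
  have hN00 : N 0 = 0 := hN0.self_of_nhds
  have hMd : HasFDerivAt (fun p : X × Y => (p.1 - N p, p.2)) (e : X × Y →L[ℂ] X × Y) 0 := by
    have := (hasFDerivAt_fst.sub hN.differentiableAt.hasFDerivAt).prodMk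
      (hasFDerivAt_snd (𝕜 := ℂ) (E := X) (F := Y) (p := 0))
    convert! this using 1
    ext p <;> simp [e, e1, D]
  obtain ⟨R, hR, hR0, hl, hr⟩ := exists_analyticAt_inverse hM (by simp [hN00]) e hMd.fderiv
  have hRc : AnalyticAt ℂ (fun y : Y => (R (0, y)).1) 0 := by
    have h1 : AnalyticAt ℂ R ((fun y : Y => ((0 : X), y)) 0) := hR
    exact analyticAt_fst.comp (h1.comp (analyticAt_const.prod analyticAt_id))
  refine ⟨fun y => (R (0, y)).1, hRc, congrArg Prod.fst hR0, ?_, ?_⟩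
  · have ht : Tendsto (fun y : Y => ((0 : X), y)) (𝓝 0) (𝓝 0) := by
      have : Continuous (fun y : Y => ((0 : X), y)) := by fun_prop
      exact this.tendsto 0
    filter_upwards [ht.eventually hr] with y hy
    have h1 := congrArg Prod.fst hy
    have h2 := congrArg Prod.snd hy
    simp only at h1 h2
    have h3 : R (0, y) = ((R (0, y)).1, y) := Prod.ext rfl h2
    rw [← h3]
    exact sub_eq_zero.1 h1
  · filter_upwards [hl] with p hp h
    rw [← h, sub_self] at hp
    exact (congrArg Prod.fst hp).symm

end Inverse

end CHFol

/-! ### Paths along coordinate rays and division by a coordinate -/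

namespace CHFol

open unitInterval in
/-- The primitive of a continuous function on the unit interval that vanishes at `0`. -/
noncomputable def primitive : C(I, ℂ) →L[ℂ] C(I, ℂ) :=
  LinearMap.mkContinuous
    { toFun := fun f => ⟨fun s => ∫ t in (0 : ℝ)..s, f (Set.projIcc 0 1 zero_le_one t), by
        have : Continuous fun b : ℝ => ∫ t in (0 : ℝ)..b, f (Set.projIcc 0 1 zero_le_one t) :=
          intervalIntegral.continuous_primitive
            (fun a b => (f.continuous.comp continuous_projIcc).intervalIntegrable a b) 0
        exact this.comp continuous_subtype_val⟩
      map_add' := by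
        intro f g
        ext s
        exact intervalIntegral.integral_add
          ((f.continuous.comp continuous_projIcc).intervalIntegrable _ _)
          ((g.continuous.comp continuous_projIcc).intervalIntegrable _ _)
      map_smul' := by
        intro c f
        ext s
        exact intervalIntegral.integral_const_mul c _ } 1 (by
    intro f
    rw [one_mul, ContinuousMap.norm_le _ (norm_nonneg _)]
    intro s
    refine (intervalIntegral.norm_integral_le_of_norm_le_const
      (fun t _ => f.norm_coe_le_norm _)).trans ?_
    have h1 : |(s : ℝ) - 0| ≤ 1 := by
      rw [sub_zero, abs_of_nonneg s.2.1]; exact s.2.2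
    exact (mul_le_mul_of_nonneg_left h1 (norm_nonneg _)).trans (mul_one _).le)

open unitInterval in
theorem primitive_apply (f : C(I, ℂ)) (s : I) :
    primitive f s = ∫ t in (0 : ℝ)..s, f (Set.projIcc 0 1 zero_le_one t) := rfl

variable {n : ℕ}

/-- The projection onto the coordinates in `K`. -/
noncomputable def restrict (K : Finset (Fin n)) : V n →L[ℂ] V n :=
  ContinuousLinearMap.pi fun i => if i ∈ K then ContinuousLinearMap.proj i else 0

theorem restrict_apply (K : Finset (Fin n)) (x : V n) (i : Fin n) :
    restrict K x i = if i ∈ K then x i else 0 := by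
  by_cases h : i ∈ K <;> simp [restrict, h]

/-- Multiplication of the coordinates in `K` by `s`. -/
noncomputable def shrink (K : Finset (Fin n)) (s : ℝ) (x : V n) : V n := fun i => if i ∈ K then s * x i else x i

theorem shrink_one (K : Finset (Fin n)) (x : V n) : shrink K 1 x = x := by
  funext i; simp [shrink]

theorem shrink_shrink (K : Finset (Fin n)) (s t : ℝ) (x : V n) :
    shrink K s (shrink K t x) = shrink K (t * s) x := by
  funext i; by_cases h : i ∈ K <;> simp [shrink, h]; ring

theorem shrink_zero (K : Finset (Fin n)) (x : V n) : shrink K 0 x = x - restrict K x := by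
  funext i; by_cases h : i ∈ K <;> simp [shrink, restrict_apply, h]

theorem shrink_zero_apply (K : Finset (Fin n)) (x : V n) (i : Fin n) :
    shrink K 0 x i = if i ∈ K then 0 else x i := by
  simp [shrink]

theorem norm_shrink_le (K : Finset (Fin n)) {s : ℝ} (hs : s ∈ unitInterval) (x : V n) :
    ‖shrink K s x‖ ≤ ‖x‖ := by
  rw [pi_norm_le_iff_of_nonneg (norm_nonneg _)]
  intro i
  by_cases h : i ∈ K
  · simp only [shrink, h, if_true, norm_mul, Complex.norm_real, Real.norm_eq_abs]
    calc |s| * ‖x i‖ ≤ 1 * ‖x i‖ := by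
          gcongr; rw [abs_of_nonneg hs.1]; exact hs.2
      _ ≤ ‖x‖ := by rw [one_mul]; exact norm_le_pi_norm x i
  · simpa [shrink, h] using norm_le_pi_norm x i

theorem hasDerivAt_shrink (K : Finset (Fin n)) (s : ℝ) (x : V n) :
    HasDerivAt (fun s : ℝ => shrink K s x) (restrict K x) s := by
  rw [hasDerivAt_pi]
  intro i
  by_cases h : i ∈ K
  · have h1 : HasDerivAt (fun s : ℝ => (s : ℂ) * x i) (1 * x i) s :=
      (Complex.ofRealCLM.hasDerivAt (x := s)).mul_const (x i)
    simpa [shrink, restrict_apply, h] using h1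
  · simpa [shrink, restrict_apply, h] using hasDerivAt_const s (x i)

theorem continuous_shrink (K : Finset (Fin n)) (x : V n) :
    Continuous fun s : ℝ => shrink K s x :=
  continuous_iff_continuousAt.2 fun s => (hasDerivAt_shrink K s x).continuousAt

open unitInterval in
/-- The path `s ↦ shrink K s x`. -/
noncomputable def shrinkPath (K : Finset (Fin n)) : V n →L[ℂ] C(I, V n) :=
  LinearMap.toContinuousLinearMap
    { toFun := fun x => ⟨fun s => shrink K s x, (continuous_shrink K x).comp continuous_subtype_val⟩
      map_add' := by
        intro x y; ext s i
        by_cases h : i ∈ K <;> simp [shrink, h]; ring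
      map_smul' := by
        intro c x; ext s i
        by_cases h : i ∈ K <;> simp [shrink, h]; ring }

open unitInterval in
theorem shrinkPath_apply (K : Finset (Fin n)) (x : V n) (s : I) :
    shrinkPath K x s = shrink K s x := rfl

theorem analyticAt_clm_apply {W E F : Type*} [NormedAddCommGroup W] [NormedSpace ℂ W]
    [NormedAddCommGroup E] [NormedSpace ℂ E] [NormedAddCommGroup F] [NormedSpace ℂ F]
    {L : W → E →L[ℂ] F} {v : W → E} {x : W} (hL : AnalyticAt ℂ L x) (hv : AnalyticAt ℂ v x) :
    AnalyticAt ℂ (fun y => L y (v y)) x :=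
  AnalyticAt.comp (g := fun p : (E →L[ℂ] F) × E => p.1 p.2) (f := fun y => (L y, v y))
    ((ContinuousLinearMap.id ℂ (E →L[ℂ] F)).analyticAt_bilinear (L x, v x)) (hL.prod hv)

/-- Hadamard's lemma for analytic germs: a germ that vanishes on `x i = 0` is divisible by `x i`. -/
theorem exists_eq_coord_mul {f : V n → ℂ} (hf : AnalyticAt ℂ f 0) (i : Fin n)
    (h0 : ∀ᶠ x in 𝓝 (0 : V n), x i = 0 → f x = 0) :
    ∃ g : V n → ℂ, AnalyticAt ℂ g 0 ∧ ∀ᶠ x in 𝓝 (0 : V n), f x = x i * g x := by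
  have hd : AnalyticAt ℂ (fun x => fderiv ℂ f x (Pi.single i 1)) 0 :=
    analyticAt_clm_apply hf.fderiv analyticAt_const
  obtain ⟨N, hN, hNe⟩ := exists_analyticAt_superposition (K := unitInterval) hd
  let P := shrinkPath ({i} : Finset (Fin n))
  -- The quotient is Hadamard's integral of `∂f/∂x i` over the segment from the point with `x i = 0`
  -- to `x`; written with a superposition operator, it is visibly analytic in `x`.
  have hg : AnalyticAt ℂ (fun x => primitive (N (P x)) 1) 0 := by
    have h1 : AnalyticAt ℂ N (P 0) := by rwa [map_zero]
    exact ((ContinuousMap.evalCLM ℂ (1 : unitInterval)).comp primitive).analyticAt _ |>.comp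
      (h1.comp (P.analyticAt 0))
  refine ⟨_, hg, ?_⟩
  have hPN : ∀ᶠ x in 𝓝 (0 : V n), ∀ s, N (P x) s = fderiv ℂ f (P x s) (Pi.single i 1) := by
    have : Tendsto P (𝓝 0) (𝓝 0) := by simpa using P.continuous.tendsto 0
    exact this.eventually hNe
  obtain ⟨ε, hε, hball⟩ := Metric.eventually_nhds_iff_ball.1
    (hf.eventually_analyticAt.and h0)
  filter_upwards [hPN, Metric.ball_mem_nhds 0 hε] with x hx hxε
  have hmem : ∀ s ∈ unitInterval, shrink {i} s x ∈ Metric.ball (0 : V n) ε := by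
    intro s hs
    rw [mem_ball_zero_iff] at hxε ⊢
    exact (norm_shrink_le _ hs x).trans_lt hxε
  have hres : restrict {i} x = x i • Pi.single i (1 : ℂ) := by
    funext j
    by_cases h : j = i
    · subst h; simp [restrict_apply]
    · simp [restrict_apply, h]
  have hder : ∀ s ∈ Set.uIcc (0 : ℝ) 1, HasDerivAt (fun s : ℝ => f (shrink {i} s x))
      (x i * N (P x) (Set.projIcc 0 1 zero_le_one s)) s := by
    intro s hs
    rw [Set.uIcc_of_le zero_le_one] at hs
    have h1 := ((hball _ (hmem s hs)).1.differentiableAt.hasFDerivAt.restrictScalars ℝ).comp_hasDerivAt s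
      (hasDerivAt_shrink {i} s x)
    have h2 : N (P x) (Set.projIcc 0 1 zero_le_one s)
        = fderiv ℂ f (shrink {i} s x) (Pi.single i 1) := by
      rw [hx, Set.projIcc_of_mem zero_le_one hs]; rfl
    rw [h2]
    convert! h1 using 1
    simp [hres]
  have hint := intervalIntegral.integral_eq_sub_of_hasDerivAt hder
    ((((N (P x)).continuous.comp continuous_projIcc).const_mul (x i)).intervalIntegrable _ _)
  rw [intervalIntegral.integral_const_mul, shrink_one,
    (hball _ (hmem 0 ⟨le_rfl, zero_le_one⟩)).2 (by simp [shrink]), sub_zero] at hint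
  exact hint.symm

end CHFol

/-! ### Differential equations along rays -/

namespace CHFol

variable {n : ℕ}

theorem analyticAt_apply (i : Fin n) (x : V n) : AnalyticAt ℂ (fun x : V n => x i) x :=
  (ContinuousLinearMap.proj (R := ℂ) (φ := fun _ : Fin n => ℂ) i).analyticAt x

open unitInterval in
set_option maxHeartbeats 400000 in
/-- The analytic solution, vanishing where `x k = 0` for all `k ∈ K`, of a differential equation
along the rays of the coordinates in `K`. -/
theorem exists_radial_solution (K : Finset (Fin n)) (g : Fin n → ℂ × V n → ℂ)
    (hg : ∀ k, AnalyticAt ℂ (g k) 0) :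
    ∃ φ : V n → ℂ, AnalyticAt ℂ φ 0 ∧ (∀ᶠ x in 𝓝 (0 : V n), (∀ k ∈ K, x k = 0) → φ x = 0) ∧
      ∀ᶠ x in 𝓝 (0 : V n), fderiv ℂ φ x (restrict K x) = ∑ k ∈ K, x k * g k (φ x, x) := by
  -- The unknown is the path `s ↦ φ (shrink K s x)`, whose derivative is `∑ x k * g k` evaluated at
  -- the shrunk point. The factor `x k` is not shrunk, so the arguments contain both the point and
  -- its image; `shrinkPath ∅` below is the constant path.
  let G : ℂ × (V n × V n) → ℂ := fun p => ∑ k ∈ K, p.2.1 k * g k (p.1, p.2.2)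
  have hG : AnalyticAt ℂ G 0 := by
    refine Finset.analyticAt_fun_sum _ fun k _ => ?_
    have h1 : AnalyticAt ℂ (fun p : ℂ × (V n × V n) => p.2.1 k) 0 :=
      ((ContinuousLinearMap.proj (R := ℂ) (φ := fun _ : Fin n => ℂ) k).comp
        ((ContinuousLinearMap.fst ℂ (V n) (V n)).comp
          (ContinuousLinearMap.snd ℂ ℂ (V n × V n)))).analyticAt 0
    have h2 : AnalyticAt ℂ (fun p : ℂ × (V n × V n) => (p.1, p.2.2)) 0 :=
      ((ContinuousLinearMap.fst ℂ ℂ (V n × V n)).prod ((ContinuousLinearMap.snd ℂ (V n) (V n)).comp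
          (ContinuousLinearMap.snd ℂ ℂ (V n × V n)))).analyticAt 0
    exact h1.mul (AnalyticAt.comp (g := g k) (hg k) h2)
  obtain ⟨N₀, hN₀, hN₀e⟩ := exists_analyticAt_superposition (K := I) hG
  obtain ⟨P, hP⟩ : ∃ P : C(I, ℂ) × V n →L[ℂ] C(I, ℂ × (V n × V n)),
      ∀ (p : C(I, ℂ) × V n) (s : I), P p s = (p.1 s, (p.2, shrink K s p.2)) := by
    refine ⟨((ContinuousLinearMap.inl ℂ ℂ (V n × V n)).compLeftContinuous ℂ I).comp
        (ContinuousLinearMap.fst ℂ _ _) +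
      ((((ContinuousLinearMap.inr ℂ ℂ (V n × V n)).comp
          (ContinuousLinearMap.inl ℂ (V n) (V n))).compLeftContinuous ℂ I).comp (shrinkPath ∅) +
        (((ContinuousLinearMap.inr ℂ ℂ (V n × V n)).comp
          (ContinuousLinearMap.inr ℂ (V n) (V n))).compLeftContinuous ℂ I).comp (shrinkPath K)).comp
        (ContinuousLinearMap.snd ℂ _ _), fun p s => ?_⟩
    simp [shrinkPath_apply]
    funext i; simp [shrink]
  have hN : AnalyticAt ℂ (fun p => primitive (N₀ (P p))) 0 := by
    have h1 : AnalyticAt ℂ N₀ (P 0) := by rwa [map_zero]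
    exact (primitive.analyticAt _).comp (h1.comp (P.analyticAt 0))
  have hPe : ∀ᶠ p in 𝓝 (0 : C(I, ℂ) × V n), ∀ s, N₀ (P p) s = G (P p s) := by
    have : Tendsto P (𝓝 0) (𝓝 0) := by simpa using P.continuous.tendsto 0
    exact this.eventually hN₀e
  have hzero : ∀ p : C(I, ℂ) × V n, (∀ s, N₀ (P p) s = G (P p s)) → (∀ k ∈ K, p.2 k = 0) →
      primitive (N₀ (P p)) = 0 := by
    intro p hp h0
    have : N₀ (P p) = 0 := by
      ext s
      rw [hp, hP]
      exact Finset.sum_eq_zero fun k hk => by simp [h0 k hk]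
    rw [this, map_zero]
  have hN0 : ∀ᶠ h in 𝓝 (0 : C(I, ℂ)), primitive (N₀ (P (h, 0))) = 0 := by
    have : Tendsto (fun h : C(I, ℂ) => (h, (0 : V n))) (𝓝 0) (𝓝 0) := by
      have : Continuous (fun h : C(I, ℂ) => (h, (0 : V n))) := by fun_prop
      exact this.tendsto 0
    filter_upwards [this.eventually hPe] with h hh
    exact hzero _ hh (by simp)
  obtain ⟨H, hH, hH0, hfix, huniq⟩ := exists_analyticAt_fixedPoint hN hN0
  obtain ⟨ε, hε, hball⟩ := Metric.eventually_nhds_iff_ball.1 (huniq.and hPe)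
  have hHc : Tendsto H (𝓝 0) (𝓝 0) := by simpa [hH0] using hH.continuousAt.tendsto
  have hHs : ∀ᶠ x in 𝓝 (0 : V n), ‖H x‖ < ε := by
    filter_upwards [hHc (Metric.ball_mem_nhds 0 hε)] with x hx
    simpa using hx
  have hφ : AnalyticAt ℂ (fun x => H x 1) 0 :=
    (((ContinuousMap.evalCLM ℂ (1 : I)).comp (ContinuousLinearMap.id ℂ C(I, ℂ))).analyticAt
      _).comp hH
  have hmem : ∀ x, ‖H x‖ < ε → ‖x‖ < ε → (H x, x) ∈ Metric.ball (0 : C(I, ℂ) × V n) ε := by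
    intro x h1 h2
    rw [mem_ball_zero_iff, Prod.norm_def]
    exact max_lt h1 h2
  refine ⟨fun x => H x 1, hφ, ?_, ?_⟩
  · filter_upwards [hfix, hHs, Metric.ball_mem_nhds 0 hε] with x hx h1 h2 h0
    rw [mem_ball_zero_iff] at h2
    have := hzero (H x, x) (hball _ (hmem x h1 h2)).2 h0
    rw [hx, this]; rfl
  · obtain ⟨δ, hδ, hballδ⟩ := Metric.eventually_nhds_iff_ball.1 (hfix.and hHs)
    filter_upwards [Metric.ball_mem_nhds 0 hε, Metric.ball_mem_nhds 0 hδ,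
      hφ.eventually_analyticAt] with x hxε hxδ hxa
    rw [mem_ball_zero_iff] at hxε
    have hx := (hballδ x hxδ).1
    have hxs := (hballδ x hxδ).2
    have hG' := (hball _ (hmem x hxs hxε)).2
    -- the integrand, extended to the real line
    let q : ℝ → ℂ := fun t => G (P (H x, x) (Set.projIcc 0 1 zero_le_one t))
    have hq : Continuous q := by
      have : q = fun t => N₀ (P (H x, x)) (Set.projIcc 0 1 zero_le_one t) := by
        funext t; exact (hG' _).symm
      rw [this]
      exact (N₀ (P (H x, x))).continuous.comp continuous_projIcc
    have hHx : ∀ s : I, H x s = ∫ t in (0 : ℝ)..s, q t := by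
      intro s
      conv_lhs => rw [hx]
      rw [primitive_apply]
      simp only [q, hG']
    -- the solution at `shrink K s x` is the restriction of the solution at `x`
    have hscale : ∀ s : I, H (shrink K s x) 1 = H x s := by
      intro s
      -- The rescaled path solves the fixed point equation at `shrink K s x`, by the substitution `r
      -- ↦ s r` in the integral. Uniqueness of small solutions identifies it with `H (shrink K s
      -- x)`.
      let h' : C(I, ℂ) := ⟨fun t => H x (s * t), by fun_prop⟩
      have hh' : ‖h'‖ < ε := by
        refine lt_of_le_of_lt ?_ hxs
        rw [ContinuousMap.norm_le _ (norm_nonneg _)]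
        intro t
        exact (H x).norm_coe_le_norm (s * t)
      have hsx : ‖shrink K s x‖ < ε := (norm_shrink_le K s.2 x).trans_lt hxε
      have hm : (h', shrink K s x) ∈ Metric.ball (0 : C(I, ℂ) × V n) ε := by
        rw [mem_ball_zero_iff, Prod.norm_def]; exact max_lt hh' hsx
      have heq : h' = primitive (N₀ (P (h', shrink K s x))) := by
        ext t
        rw [primitive_apply]
        have h1 : h' t = ∫ r in (0 : ℝ)..((s : ℝ) * t), q r := hHx (s * t)
        have h2 : (∫ r in (0 : ℝ)..((s : ℝ) * t), q r)
            = (s : ℝ) • ∫ r in (0 : ℝ)..t, q ((s : ℝ) * r) := by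
          rw [intervalIntegral.smul_integral_comp_mul_left, mul_zero]
        rw [h1, h2, ← intervalIntegral.integral_smul]
        refine intervalIntegral.integral_congr fun r hr => ?_
        rw [Set.uIcc_of_le t.2.1] at hr
        have hr' : r ∈ I := ⟨hr.1, hr.2.trans t.2.2⟩
        simp only [q]
        rw [(hball _ hm).2, hP, hP, Set.projIcc_of_mem zero_le_one hr',
          Set.projIcc_of_mem zero_le_one (unitInterval.mul_mem s.2 hr')]
        have h3 : h' ⟨r, hr'⟩ = H x ⟨s * r, unitInterval.mul_mem s.2 hr'⟩ := rfl
        simp only [G, h3, shrink_shrink, Complex.real_smul, Finset.mul_sum]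
        refine Finset.sum_congr rfl fun k hk => ?_
        simp [shrink, hk]; ring
      have := (hball _ hm).1 heq
      rw [← this]
      change H x (s * 1) = H x s
      rw [mul_one]
    have hd1 : HasDerivAt (fun s : ℝ => H (shrink K s x) 1)
        (fderiv ℂ (fun x => H x 1) x (restrict K x)) 1 := by
      have h1 : HasFDerivAt (fun x => H x 1) (fderiv ℂ (fun x => H x 1) x) (shrink K 1 x) := by
        rw [shrink_one]; exact hxa.differentiableAt.hasFDerivAt
      exact (h1.restrictScalars ℝ).comp_hasDerivAt (1 : ℝ) (hasDerivAt_shrink K 1 x)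
    have hd2 : HasDerivAt (fun s : ℝ => ∫ t in (0 : ℝ)..s, q t) (q 1) 1 :=
      intervalIntegral.integral_hasDerivAt_right (hq.intervalIntegrable _ _)
        (hq.stronglyMeasurableAtFilter _ _) hq.continuousAt
    -- The integral formula is known only for `s` in the unit interval, so the two derivatives at
    -- the endpoint `1` are compared within it.
    have hd3 : HasDerivWithinAt (fun s : ℝ => H (shrink K s x) 1) (q 1) (Set.Icc 0 1) 1 := by
      have h : ∀ s ∈ Set.Icc (0 : ℝ) 1, H (shrink K s x) 1 = ∫ t in (0 : ℝ)..s, q t :=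
        fun s hs => (hscale ⟨s, hs⟩).trans (hHx ⟨s, hs⟩)
      exact hd2.hasDerivWithinAt.congr h (h 1 (by simp))
    have hu : UniqueDiffWithinAt ℝ (Set.Icc (0 : ℝ) 1) 1 :=
      uniqueDiffOn_Icc zero_lt_one 1 (by simp)
    have := hu.eq_deriv _ hd1.hasDerivWithinAt hd3
    rw [this]
    simp only [q]
    rw [Set.projIcc_right, hP]
    simp only [G]
    have : shrink K ((⟨1, Set.right_mem_Icc.2 zero_le_one⟩ : I) : ℝ) x = x := shrink_one K x
    rw [this]
    rfl

end CHFol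

/-! ### Analytic continuation of germs, divisibility and pull-back of forms -/

namespace CHFol

section Germs

variable {n : ℕ} {F : Type*} [NormedAddCommGroup F] [NormedSpace ℂ F] {F' : Type*}
  [NormedAddCommGroup F'] [NormedSpace ℂ F']

/-- This is the identity theorem on a ball, which is connected: vanishing near one point of the ball
would propagate to the origin. -/
theorem eventually_frequently_ne_zero [CompleteSpace F] {f : V n → F} (hf : AnalyticAt ℂ f 0)
    (h0 : ¬ ∀ᶠ x in 𝓝 (0 : V n), f x = 0) :
    ∀ᶠ x in 𝓝 (0 : V n), ∃ᶠ y in 𝓝 x, f y ≠ 0 := by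
  obtain ⟨ε, hε, hball⟩ := Metric.eventually_nhds_iff_ball.1 hf.eventually_analyticAt
  filter_upwards [Metric.ball_mem_nhds 0 hε] with x hx hcon
  simp only [not_not] at hcon
  have := AnalyticOnNhd.eqOn_zero_of_preconnected_of_eventuallyEq_zero (𝕜 := ℂ)
    (U := Metric.ball (0 : V n) ε) hball (convex_ball _ _).isPreconnected hx hcon
  exact h0 (mem_of_superset (Metric.ball_mem_nhds 0 hε) fun y hy => this hy)

/-- An analytic germ that vanishes where a nonzero analytic germ does not vanish is zero. -/
theorem eventually_eq_zero_of_ne_zero [CompleteSpace F] {f : V n → F} {g : V n → F'}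
    (hf : AnalyticAt ℂ f 0) (h0 : ¬ ∀ᶠ x in 𝓝 (0 : V n), f x = 0) (hg : AnalyticAt ℂ g 0)
    (h : ∀ᶠ x in 𝓝 (0 : V n), f x ≠ 0 → g x = 0) : ∀ᶠ x in 𝓝 (0 : V n), g x = 0 := by
  filter_upwards [eventually_frequently_ne_zero hf h0, h.eventually_nhds,
    hg.eventually_continuousAt] with x hx1 hx2 hx3
  by_contra hne
  obtain ⟨y, hy1, hy2, hy3⟩ := (hx1.and_eventually (hx2.and (hx3.eventually_ne hne))).exists
  exact hy3 (hy2 hy1)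

theorem eventually_eq_zero_or [CompleteSpace F] {f : V n → ℂ} {g : V n → F}
    (hf : AnalyticAt ℂ f 0) (hg : AnalyticAt ℂ g 0)
    (h : ∀ᶠ x in 𝓝 (0 : V n), f x • g x = 0) :
    (∀ᶠ x in 𝓝 (0 : V n), f x = 0) ∨ ∀ᶠ x in 𝓝 (0 : V n), g x = 0 := by
  by_cases h0 : ∀ᶠ x in 𝓝 (0 : V n), f x = 0
  · exact Or.inl h0
  · refine Or.inr (eventually_eq_zero_of_ne_zero hf h0 hg ?_)
    filter_upwards [h] with x hx hne
    exact (smul_eq_zero.1 hx).resolve_left hne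

/-- The ring of analytic germs is a domain. Applied on a coordinate hyperplane, this expresses its
irreducibility. -/
theorem exists_eventually_eq_zero_of_prod {ι : Type*} (S : Finset ι) (f : ι → V n → ℂ)
    (hf : ∀ i ∈ S, AnalyticAt ℂ (f i) 0) (h : ∀ᶠ x in 𝓝 (0 : V n), ∏ i ∈ S, f i x = 0) :
    ∃ i ∈ S, ∀ᶠ x in 𝓝 (0 : V n), f i x = 0 := by
  classical
  induction S using Finset.induction_on with
  | empty => simpa using h.self_of_nhds
  | insert i S hi ih =>
    simp only [Finset.prod_insert hi] at h
    have h1 : AnalyticAt ℂ (fun x => ∏ j ∈ S, f j x) 0 :=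
      Finset.analyticAt_fun_prod _ fun j hj => hf j (Finset.mem_insert_of_mem hj)
    rcases eventually_eq_zero_or (hf i (Finset.mem_insert_self i S)) h1 (by simpa using h)
      with h2 | h2
    · exact ⟨i, Finset.mem_insert_self i S, h2⟩
    · obtain ⟨j, hj, hj2⟩ := ih (fun j hj => hf j (Finset.mem_insert_of_mem hj)) h2
      exact ⟨j, Finset.mem_insert_of_mem hj, hj2⟩

theorem analyticAt_prod_coord (S : Finset (Fin n)) (x : V n) :
    AnalyticAt ℂ (fun x : V n => ∏ i ∈ S, x i) x :=
  Finset.analyticAt_fun_prod _ fun i _ => analyticAt_apply i x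

theorem not_eventually_coord_eq_zero (i : Fin n) : ¬ ∀ᶠ x in 𝓝 (0 : V n), x i = 0 := by
  intro h
  have h1 : Tendsto (fun t : ℂ => (fun _ => t : V n)) (𝓝 0) (𝓝 0) := by
    have : Continuous (fun t : ℂ => (fun _ => t : V n)) := by fun_prop
    exact this.tendsto 0
  have h2 : ∀ᶠ t in 𝓝[≠] (0 : ℂ), t = 0 := (h1.eventually h).filter_mono nhdsWithin_le_nhds
  have h3 : ∀ᶠ t in 𝓝[≠] (0 : ℂ), t ≠ 0 := eventually_mem_nhdsWithin
  obtain ⟨t, ht, ht'⟩ := (h2.and h3).exists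
  exact ht' ht

theorem not_eventually_prod_coord_eq_zero (S : Finset (Fin n)) :
    ¬ ∀ᶠ x in 𝓝 (0 : V n), ∏ i ∈ S, x i = 0 := by
  intro h
  obtain ⟨i, _, hi⟩ := exists_eventually_eq_zero_of_prod S (fun i x => x i)
    (fun i _ => analyticAt_apply i 0) h
  exact not_eventually_coord_eq_zero i hi

theorem eventually_eq_zero_of_coord_ne_zero {g : V n → F} (S : Finset (Fin n))
    (hg : AnalyticAt ℂ g 0)
    (h : ∀ᶠ x in 𝓝 (0 : V n), (∀ i ∈ S, x i ≠ 0) → g x = 0) : ∀ᶠ x in 𝓝 (0 : V n), g x = 0 := by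
  refine eventually_eq_zero_of_ne_zero (analyticAt_prod_coord S 0)
    (not_eventually_prod_coord_eq_zero S) hg ?_
  filter_upwards [h] with x hx hne
  exact hx fun i hi => Finset.prod_ne_zero_iff.1 hne i hi

theorem shrink_zero_of_eq_zero {K : Finset (Fin n)} {x : V n} (h : ∀ i ∈ K, x i = 0) :
    shrink K 0 x = x := by
  funext i
  by_cases hi : i ∈ K
  · simp [shrink, hi, h i hi]
  · simp [shrink, hi]

theorem analyticAt_shrink_zero (K : Finset (Fin n)) (x : V n) :
    AnalyticAt ℂ (shrink K 0 : V n → V n) x := by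
  have : (shrink K 0 : V n → V n) = fun x => (ContinuousLinearMap.id ℂ (V n) - restrict K) x := by
    funext x; rw [shrink_zero]; rfl
  rw [this]
  exact ContinuousLinearMap.analyticAt _ x

theorem shrink_map_zero (K : Finset (Fin n)) (s : ℝ) : shrink K s (0 : V n) = 0 := by
  funext i; simp [shrink]

theorem tendsto_shrink_zero (K : Finset (Fin n)) :
    Tendsto (shrink K 0 : V n → V n) (𝓝 0) (𝓝 0) := by
  simpa [shrink_map_zero] using (analyticAt_shrink_zero K (0 : V n)).continuousAt.tendsto

/-- Analytic continuation along the coordinate subspace `x_Z = 0`. -/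
theorem eventually_eq_zero_on_subspace {g : V n → F} {S Z : Finset (Fin n)} (hSZ : Disjoint S Z)
    (hg : AnalyticAt ℂ g 0)
    (h : ∀ᶠ x in 𝓝 (0 : V n), (∀ i ∈ Z, x i = 0) → (∀ i ∈ S, x i ≠ 0) → g x = 0) :
    ∀ᶠ x in 𝓝 (0 : V n), (∀ i ∈ Z, x i = 0) → g x = 0 := by
  have h1 : AnalyticAt ℂ (fun x => g (shrink Z 0 x)) 0 := by
    refine AnalyticAt.comp (g := g) ?_ (analyticAt_shrink_zero Z 0)
    rwa [shrink_map_zero]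
  have h2 := eventually_eq_zero_of_coord_ne_zero S h1 (by
    filter_upwards [(tendsto_shrink_zero Z).eventually h] with x hx hS
    refine hx (fun i hi => by simp [shrink, hi]) fun i hi => ?_
    have : i ∉ Z := Finset.disjoint_left.1 hSZ hi
    simpa [shrink, this] using hS i hi)
  filter_upwards [h2] with x hx hZ
  rwa [shrink_zero_of_eq_zero hZ] at hx

/-- Distinct coordinates are coprime: after division by some of them, the quotient still vanishes on
each remaining hyperplane, by continuation from the points of it where the divided coordinates are
nonzero. -/
theorem exists_eq_prod_coord_mul {f : V n → ℂ} (hf : AnalyticAt ℂ f 0) (S : Finset (Fin n))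
    (h0 : ∀ i ∈ S, ∀ᶠ x in 𝓝 (0 : V n), x i = 0 → f x = 0) :
    ∃ g : V n → ℂ, AnalyticAt ℂ g 0 ∧ ∀ᶠ x in 𝓝 (0 : V n), f x = (∏ i ∈ S, x i) * g x := by
  classical
  induction S using Finset.induction_on with
  | empty => exact ⟨f, hf, by simp⟩
  | insert i S hi ih =>
    obtain ⟨g, hg, hfg⟩ := ih fun j hj => h0 j (Finset.mem_insert_of_mem hj)
    have h1 : ∀ᶠ x in 𝓝 (0 : V n), (∀ j ∈ ({i} : Finset (Fin n)), x j = 0) → g x = 0 := by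
      refine eventually_eq_zero_on_subspace (S := S) (by simpa using hi) hg ?_
      filter_upwards [hfg, h0 i (Finset.mem_insert_self i S)] with x hx hx0 hxi hxS
      rw [hx0 (hxi i (by simp))] at hx
      exact (mul_eq_zero.1 hx.symm).resolve_left (Finset.prod_ne_zero_iff.2 hxS)
    obtain ⟨g', hg', hgg'⟩ := exists_eq_coord_mul hg i (by simpa using h1)
    refine ⟨g', hg', ?_⟩
    filter_upwards [hfg, hgg'] with x hx hx'
    rw [hx, hx', Finset.prod_insert hi]; ring

end Germs

theorem exists_localCoords {n : ℕ} {f : V n → V n} (hf : AnalyticAt ℂ f 0) (h0 : f 0 = 0)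
    (hinj : ∀ v, fderiv ℂ f 0 v = 0 → v = 0) : ∃ Φ : LocalCoords n, Φ.toFun = f := by
  have hi : Function.Injective (fderiv ℂ f 0 : V n →ₗ[ℂ] V n) :=
    (injective_iff_map_eq_zero (fderiv ℂ f 0 : V n →ₗ[ℂ] V n)).2 hinj
  let e : V n ≃L[ℂ] V n :=
    (LinearMap.linearEquivOfInjective (fderiv ℂ f 0 : V n →ₗ[ℂ] V n) hi rfl).toContinuousLinearEquiv
  obtain ⟨R, hR, hR0, hl, hr⟩ := exists_analyticAt_inverse hf h0 e (by ext v; rfl)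
  exact ⟨⟨f, R, h0, hR0, hf, hR, hl, hr⟩, rfl⟩

section Pullback

variable {m n : ℕ} {φ : V m → V n} {ω : OneForm n}

theorem analyticAt_clm_comp {W E F G : Type*} [NormedAddCommGroup W] [NormedSpace ℂ W]
    [NormedAddCommGroup E] [NormedSpace ℂ E] [NormedAddCommGroup F] [NormedSpace ℂ F]
    [NormedAddCommGroup G] [NormedSpace ℂ G]
    {L : W → F →L[ℂ] G} {M : W → E →L[ℂ] F} {x : W} (hL : AnalyticAt ℂ L x)
    (hM : AnalyticAt ℂ M x) : AnalyticAt ℂ (fun y => (L y).comp (M y)) x :=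
  AnalyticAt.comp (g := fun p : (F →L[ℂ] G) × (E →L[ℂ] F) => p.1.comp p.2)
    (f := fun y => (L y, M y))
    ((ContinuousLinearMap.compL ℂ E F G).analyticAt_bilinear (L x, M x)) (hL.prod hM)

theorem analyticAt_pullback (hφ : AnalyticAt ℂ φ 0) (h0 : φ 0 = 0) (hω : AnalyticAt ℂ ω 0) :
    AnalyticAt ℂ (pullback φ ω) 0 := by
  refine analyticAt_clm_comp (AnalyticAt.comp (g := ω) ?_ hφ) hφ.fderiv
  rwa [h0]

/-- The second derivatives of `φ` cancel by their symmetry. -/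
theorem dForm_pullback {x : V m} (hφ : AnalyticAt ℂ φ x) (hω : AnalyticAt ℂ ω (φ x)) (u v : V m) :
    dForm (pullback φ ω) x u v = dForm ω (φ x) (fderiv ℂ φ x u) (fderiv ℂ φ x v) := by
  have h1 : HasFDerivAt (fun y => ω (φ y)) ((fderiv ℂ ω (φ x)).comp (fderiv ℂ φ x)) x :=
    hω.differentiableAt.hasFDerivAt.comp x hφ.differentiableAt.hasFDerivAt
  have h2 := h1.clm_comp hφ.fderiv.differentiableAt.hasFDerivAt
  have h3 : fderiv ℂ (pullback φ ω) x = _ := h2.fderiv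
  have hs := (hφ.contDiffAt (n := ⊤)).isSymmSndFDerivAt_of_omega
  have h4 := hs.eq u v
  simp only [dForm, h3]
  simp [h4]

theorem integrable_pullback (hφ : AnalyticAt ℂ φ 0) (h0 : φ 0 = 0) (hω : AnalyticAt ℂ ω 0)
    (hi : Integrable ω) : Integrable (pullback φ ω) := by
  have ht : Tendsto φ (𝓝 0) (𝓝 0) := by simpa [h0] using hφ.continuousAt.tendsto
  filter_upwards [hφ.eventually_analyticAt, ht.eventually hω.eventually_analyticAt,
    ht.eventually hi] with x hx1 hx2 hx3 u v w
  simp only [dForm_pullback hx1 hx2]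
  exact hx3 _ _ _

end Pullback

end CHFol

/-! ### Logarithmic forms and their integrability -/

namespace CHFol

variable {n : ℕ}

/-- The denominators of a logarithmic form with poles along `x i = 0`, `i ∈ S`. -/
noncomputable def weight (S : Finset (Fin n)) (x : V n) (i : Fin n) : ℂ := if i ∈ S then x i else 1

/-- The value of the logarithmic form `∑ a i dx i / weight S x i` at `x` on the vector `v`. -/
noncomputable def logEval (S : Finset (Fin n)) (a : Fin n → V n → ℂ) (x v : V n) : ℂ :=
  ∑ i, a i x * v i / weight S x i

/-- The foliation `ω = 0` is given by the logarithmic form `∑ a i dx i / weight S x i`. -/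
def IsLogEquation (S : Finset (Fin n)) (a : Fin n → V n → ℂ) (ω : OneForm n) : Prop :=
  ∀ᶠ x in 𝓝 (0 : V n), (∀ i ∈ S, x i ≠ 0) → ∀ u v : V n,
    logEval S a x u * ω x v = logEval S a x v * ω x u

/-- The logarithmic form `∑ a i dx i / weight S x i`, multiplied by `∏ i ∈ S, x i`. -/
noncomputable def clearedForm (S : Finset (Fin n)) (a : Fin n → V n → ℂ) : OneForm n :=
  fun x => ∑ i, (a i x * ∏ j ∈ S.erase i, x j) •
    ContinuousLinearMap.proj (R := ℂ) (φ := fun _ : Fin n => ℂ) i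

theorem clearedForm_apply (S : Finset (Fin n)) (a : Fin n → V n → ℂ) (x v : V n) :
    clearedForm S a x v = ∑ i, a i x * (∏ j ∈ S.erase i, x j) * v i := by
  simp [clearedForm]

theorem weight_ne_zero {S : Finset (Fin n)} {x : V n} (h : ∀ i ∈ S, x i ≠ 0) (i : Fin n) :
    weight S x i ≠ 0 := by
  by_cases hi : i ∈ S <;> simp [weight, hi]
  exact h i hi

theorem clearedForm_eq_mul_logEval {S : Finset (Fin n)} (a : Fin n → V n → ℂ) {x : V n}
    (h : ∀ i ∈ S, x i ≠ 0) (v : V n) :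
    clearedForm S a x v = (∏ j ∈ S, x j) * logEval S a x v := by
  rw [clearedForm_apply, logEval, Finset.mul_sum]
  refine Finset.sum_congr rfl fun i _ => ?_
  by_cases hi : i ∈ S
  · rw [← Finset.mul_prod_erase S _ hi]
    simp only [weight, hi, if_true]
    field_simp [h i hi]
  · rw [Finset.erase_eq_of_notMem hi]
    simp only [weight, hi, if_false]; ring

theorem logEval_single (S : Finset (Fin n)) (a : Fin n → V n → ℂ) (x : V n) (i : Fin n) (c : ℂ) :
    logEval S a x (Pi.single i c) = a i x * c / weight S x i := by
  rw [logEval, Finset.sum_eq_single i]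
  · simp
  · intro j _ hj; simp [hj]
  · simp

theorem analyticAt_clearedForm (S : Finset (Fin n)) {a : Fin n → V n → ℂ} {x : V n}
    (ha : ∀ i, AnalyticAt ℂ (a i) x) : AnalyticAt ℂ (clearedForm S a) x :=
  Finset.analyticAt_fun_sum _ fun i _ =>
    ((ha i).mul (analyticAt_prod_coord _ x)).smul analyticAt_const

theorem oneForm_apply_eq_sum (L : V n →L[ℂ] ℂ) (v : V n) : L v = ∑ i, v i * L (Pi.single i 1) := by
  conv_lhs => rw [← Finset.univ_sum_single v]
  rw [map_sum]
  refine Finset.sum_congr rfl fun i _ => ?_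
  have : Pi.single i (v i) = v i • (Pi.single i 1 : V n) := by
    rw [← Pi.single_smul]; simp
  rw [this, map_smul, smul_eq_mul]

theorem FoliationGerm.not_eventually_form_eq_zero (F : FoliationGerm n) :
    ¬ ∀ᶠ x in 𝓝 (0 : V n), F.form x = 0 := by
  intro h
  refine F.saturated (fun _ => 0) (fun _ => 0) analyticAt_const analyticAt_const ?_ rfl
  filter_upwards [h] with x hx
  rw [hx]
  ext v
  exact (zero_mul _).symm

/-- A saturated form which defines the same foliation as a logarithmic form is equal to it, up to
clearing the denominators and multiplying by a unit. -/
theorem FoliationGerm.form_eq_smul_clearedForm (F : FoliationGerm n) {S : Finset (Fin n)}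
    (hS : S.Nonempty) {a : Fin n → V n → ℂ} (ha : ∀ i, AnalyticAt ℂ (a i) 0)
    (ha0 : ∀ i ∈ S, a i 0 ≠ 0) (hF : IsLogEquation S a F.form) :
    ∃ h : V n → ℂ, AnalyticAt ℂ h 0 ∧ h 0 ≠ 0 ∧
      ∀ᶠ x in 𝓝 (0 : V n), F.form x = h x • clearedForm S a x := by
  obtain ⟨s, hs⟩ := hS
  have hω : ∀ i, AnalyticAt ℂ (fun x => F.form x (Pi.single i 1)) 0 := fun i =>
    analyticAt_clm_apply F.analytic analyticAt_const
  have hne : ∀ i ∈ S, ∀ᶠ x in 𝓝 (0 : V n), a i x ≠ 0 := fun i hi =>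
    (ha i).continuousAt.eventually_ne (ha0 i hi)
  -- Proportionality in the directions `s` and `j` reads `a s * x j * ω_j = a j * x s * ω_s`. At
  -- generic points of `x j = 0` both `a j` and `x s` are nonzero, hence `ω_s = 0` there.
  have hvan : ∀ j ∈ S.erase s, ∀ᶠ x in 𝓝 (0 : V n), x j = 0 → F.form x (Pi.single s 1) = 0 := by
    intro j hj
    obtain ⟨hjs, hjS⟩ := Finset.mem_erase.1 hj
    have h1 : ∀ᶠ x in 𝓝 (0 : V n), a s x * x j * F.form x (Pi.single j 1)
        - a j x * x s * F.form x (Pi.single s 1) = 0 := by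
      refine eventually_eq_zero_of_coord_ne_zero S
        ((((ha s).mul (analyticAt_apply j 0)).mul (hω j)).sub
        (((ha j).mul (analyticAt_apply s 0)).mul (hω s))) ?_
      filter_upwards [hF] with x hx hxS
      have := hx hxS (Pi.single s 1) (Pi.single j 1)
      simp only [logEval_single, weight, hs, hjS, if_true, mul_one] at this
      have h1 := hxS s hs
      have h2 := hxS j hjS
      field_simp at this
      linear_combination this
    have h2 := eventually_eq_zero_on_subspace (S := {s}) (Z := {j})
      (by simpa using hjs.symm) (hω s) (by
        filter_upwards [h1, hne j hjS] with x hx hxj hZ hxs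
        have hj0 : x j = 0 := hZ j (by simp)
        have hs0 : x s ≠ 0 := hxs s (by simp)
        rw [hj0, mul_zero, zero_mul, zero_sub, neg_eq_zero] at hx
        exact (mul_eq_zero.1 hx).resolve_left (mul_ne_zero hxj hs0))
    simpa using h2
  obtain ⟨g, hg, hgs⟩ := exists_eq_prod_coord_mul (hω s) (S.erase s) hvan
  have hh : AnalyticAt ℂ (fun x => g x / a s x) 0 := hg.div (ha s) (ha0 s hs)
  have heq : ∀ᶠ x in 𝓝 (0 : V n), F.form x = (g x / a s x) • clearedForm S a x := by
    have h1 := eventually_eq_zero_of_coord_ne_zero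
      (g := fun x => F.form x - (g x / a s x) • clearedForm S a x) S
      (F.analytic.sub (hh.smul (analyticAt_clearedForm S ha))) (by
        filter_upwards [hF, hgs, hne s hs] with x hx hxg hxs hxS
        rw [sub_eq_zero]
        ext v
        have h1 := hx hxS (Pi.single s 1) v
        have hxs0 := hxS s hs
        simp only [logEval_single, weight, hs, if_true, mul_one] at h1
        rw [smul_apply, smul_eq_mul, clearedForm_eq_mul_logEval a hxS,
          ← Finset.mul_prod_erase S _ hs]
        rw [hxg] at h1
        field_simp at h1 ⊢
        linear_combination h1)
    filter_upwards [h1] with x hx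
    exact sub_eq_zero.1 hx
  -- The factor is a common factor of the coefficients of `F.form`, hence a unit.
  exact ⟨_, hh, F.saturated _ _ hh (analyticAt_clearedForm S ha) heq, heq⟩

/-- For `j ≠ k` the denominator is constant in the direction `j`, so no derivative of a pole
appears. Only such derivatives enter `dForm` on distinct basis vectors. -/
theorem fderiv_div_weight {S : Finset (Fin n)} {f : V n → ℂ} {x : V n} (hf : AnalyticAt ℂ f x)
    (hx : ∀ i ∈ S, x i ≠ 0) {j k : Fin n} (hjk : j ≠ k) :
    DifferentiableAt ℂ (fun y => f y / weight S y k) x ∧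
    fderiv ℂ (fun y => f y / weight S y k) x (Pi.single j 1)
      = fderiv ℂ f x (Pi.single j 1) / weight S x k := by
  by_cases hk : k ∈ S
  · simp only [weight, hk, if_true]
    have h1 : HasFDerivAt (fun y : V n => y k)
      (ContinuousLinearMap.proj (R := ℂ) (φ := fun _ : Fin n => ℂ) k) x :=
      (ContinuousLinearMap.proj (R := ℂ) (φ := fun _ : Fin n => ℂ) k).hasFDerivAt
    have h2 := hf.differentiableAt.hasFDerivAt.mul
      ((hasDerivAt_inv (hx k hk)).comp_hasFDerivAt x h1)
    have h3 : (fun y : V n => f y / y k) = f * ((fun z : ℂ => z⁻¹) ∘ fun y : V n => y k) := by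
      funext y; simp [div_eq_mul_inv]
    rw [h3]
    refine ⟨h2.differentiableAt, ?_⟩
    rw [h2.fderiv]
    simp [hjk.symm, div_eq_mul_inv, mul_comm]
  · simp only [weight, hk, if_false, div_one]
    exact ⟨hf.differentiableAt, trivial⟩

/-- The integrability condition, in terms of the coefficients of a logarithmic form one of whose
coefficients is constant. -/
theorem eventually_integrability_log {ω : OneForm n} (hω : AnalyticAt ℂ ω 0)
    (hω0 : ¬ ∀ᶠ x in 𝓝 (0 : V n), ω x = 0) (hint : Integrable ω) {S : Finset (Fin n)}
    {a : Fin n → V n → ℂ} (ha : ∀ i, AnalyticAt ℂ (a i) 0) {e : Fin n}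
    (he : ∀ᶠ x in 𝓝 (0 : V n), a e x = 1) (hlog : IsLogEquation S a ω) (j k : Fin n) :
    ∀ᶠ x in 𝓝 (0 : V n),
      weight S x j * fderiv ℂ (a k) x (Pi.single j 1)
        - weight S x k * fderiv ℂ (a j) x (Pi.single k 1)
        - a j x * (weight S x e * fderiv ℂ (a k) x (Pi.single e 1))
        + a k x * (weight S x e * fderiv ℂ (a j) x (Pi.single e 1)) = 0 := by
  have hea : ∀ᶠ x in 𝓝 (0 : V n), fderiv ℂ (a e) x = 0 := by
    filter_upwards [he.eventually_nhds] with x hx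
    have : a e =ᶠ[𝓝 x] fun _ => (1 : ℂ) := hx
    rw [this.fderiv_eq, fderiv_fun_const]; rfl
  by_cases hjk : j = k
  · subst hjk
    exact Eventually.of_forall fun x => by ring
  by_cases hje : j = e
  · subst hje
    filter_upwards [he, hea] with x h1 h2
    rw [h1, h2]; simp
  by_cases hke : k = e
  · subst hke
    filter_upwards [he, hea] with x h1 h2
    rw [h1, h2]; simp
  have hw : ∀ i, AnalyticAt ℂ (fun x : V n => weight S x i) 0 := by
    intro i
    by_cases hi : i ∈ S
    · simpa only [weight, hi, if_true] using analyticAt_apply i 0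
    · simpa only [weight, hi, if_false] using analyticAt_const
  have hd : ∀ i j, AnalyticAt ℂ (fun x => fderiv ℂ (a i) x (Pi.single j 1)) 0 := fun i j =>
    analyticAt_clm_apply (ha i).fderiv analyticAt_const
  refine eventually_eq_zero_of_coord_ne_zero S (((((hw j).mul (hd k j)).sub
    ((hw k).mul (hd j k))).sub ((ha j).mul ((hw e).mul (hd k e)))).add
    ((ha k).mul ((hw e).mul (hd j e)))) ?_
  -- The factor `∏ x i` makes the claim trivial on the poles, so that only points off the poles with
  -- `ω x ≠ 0` remain.
  have hgood := eventually_eq_zero_of_ne_zero hω hω0 (g := fun x => (∏ i ∈ S, x i) *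
      (weight S x j * fderiv ℂ (a k) x (Pi.single j 1)
        - weight S x k * fderiv ℂ (a j) x (Pi.single k 1)
        - a j x * (weight S x e * fderiv ℂ (a k) x (Pi.single e 1))
        + a k x * (weight S x e * fderiv ℂ (a j) x (Pi.single e 1))))
    ((analyticAt_prod_coord S 0).mul (((((hw j).mul (hd k j)).sub
    ((hw k).mul (hd j k))).sub ((ha j).mul ((hw e).mul (hd k e)))).add
    ((ha k).mul ((hw e).mul (hd j e))))) ?_
  · filter_upwards [hgood] with x hx hxS
    exact (mul_eq_zero.1 hx).resolve_left (Finset.prod_ne_zero_iff.2 hxS)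
  filter_upwards [hlog.eventually_nhds, he.eventually_nhds, hint, hω.eventually_analyticAt,
    hea, (Filter.eventually_all.2 fun i => (ha i).eventually_analyticAt)] with
    x hlogx hex hintx hωx heax hax hne
  by_cases hxS : ∀ i ∈ S, x i ≠ 0
  swap
  · push Not at hxS
    obtain ⟨i, hi, hi0⟩ := hxS
    rw [Finset.prod_eq_zero hi hi0, zero_mul]
  refine mul_eq_zero_of_right _ ?_
  -- near `x` the form `ω` is a multiple of the logarithmic form
  have hxS' : ∀ᶠ y in 𝓝 x, ∀ i ∈ S, y i ≠ 0 := by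
    rw [Filter.eventually_all_finset]
    intro i hi
    exact (continuous_apply i).continuousAt.eventually_ne (hxS i hi)
  -- Because `a e = 1`, the proportionality factor can be read from the direction `e`. Its
  -- derivatives cancel in `ω ∧ dω`, which leaves `h ^ 2` times the desired expression.
  let h : V n → ℂ := fun y => weight S y e * ω y (Pi.single e 1)
  have hwe : DifferentiableAt ℂ (fun y : V n => weight S y e) x := by
    by_cases hi : e ∈ S
    · simpa only [weight, hi, if_true] using (analyticAt_apply e x).differentiableAt
    · simp only [weight, hi, if_false]; exact differentiableAt_const _
  have hhd : DifferentiableAt ℂ h x :=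
    hwe.mul (analyticAt_clm_apply hωx analyticAt_const).differentiableAt
  have hωh : ∀ i, ∀ᶠ y in 𝓝 x, ω y (Pi.single i 1) = h y * (a i y / weight S y i) := by
    intro i
    filter_upwards [hlogx, hex, hxS'] with y h1 h2 h3
    have := h1 h3 (Pi.single e 1) (Pi.single i 1)
    rw [logEval_single, logEval_single, h2, mul_one, mul_one] at this
    have hw1 := weight_ne_zero h3 e
    simp only [h]
    field_simp at this ⊢
    linear_combination this
  have hder : ∀ i j, j ≠ i → fderiv ℂ ω x (Pi.single j 1) (Pi.single i 1)
      = h x * (fderiv ℂ (a i) x (Pi.single j 1) / weight S x i)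
        + (a i x / weight S x i) * fderiv ℂ h x (Pi.single j 1) := by
    intro i j hji
    obtain ⟨hd1, hd2⟩ := fderiv_div_weight (hax i) hxS hji
    have h1 : HasFDerivAt (fun y => ω y (Pi.single i 1)) _ x :=
      ((hhd.hasFDerivAt.mul hd1.hasFDerivAt).congr_of_eventuallyEq (hωh i))
    have h2 : HasFDerivAt (fun y => ω y (Pi.single i 1)) _ x :=
      hωx.differentiableAt.hasFDerivAt.clm_apply (hasFDerivAt_const (Pi.single i 1) x)
    have h3 := congrArg (fun L : V n →L[ℂ] ℂ => L (Pi.single j 1)) (h2.unique h1)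
    simpa [hd2] using h3
  have hh0 : h x ≠ 0 := by
    intro h0
    apply hne
    ext v
    rw [oneForm_apply_eq_sum]
    simp [(hωh _).self_of_nhds, h0]
  have hi := hintx (Pi.single e 1) (Pi.single j 1) (Pi.single k 1)
  simp only [dForm, hder _ _ hjk, hder _ _ (Ne.symm hjk), hder _ _ hje, hder _ _ (Ne.symm hje),
    hder _ _ hke, hder _ _ (Ne.symm hke), (hωh _).self_of_nhds, heax, hex.self_of_nhds] at hi
  have w1 := weight_ne_zero hxS e
  have w2 := weight_ne_zero hxS j
  have w3 := weight_ne_zero hxS k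
  simp only [zero_apply, zero_div] at hi
  have key : h x ^ 2 * (weight S x j * fderiv ℂ (a k) x (Pi.single j 1)
        - weight S x k * fderiv ℂ (a j) x (Pi.single k 1)
        - a j x * (weight S x e * fderiv ℂ (a k) x (Pi.single e 1))
        + a k x * (weight S x e * fderiv ℂ (a j) x (Pi.single e 1))) = 0 := by
    field_simp at hi
    linear_combination hi
  exact (mul_eq_zero.1 key).resolve_left (pow_ne_zero _ hh0)

end CHFol

/-! ### Elimination of superfluous coordinates -/

namespace CHFol

variable {n : ℕ}

theorem eventually_shrink {p : V n → Prop} (K : Finset (Fin n)) (h : ∀ᶠ x in 𝓝 (0 : V n), p x) :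
    ∀ᶠ x in 𝓝 (0 : V n), ∀ s ∈ unitInterval, p (shrink K s x) := by
  obtain ⟨ε, hε, hball⟩ := Metric.eventually_nhds_iff_ball.1 h
  filter_upwards [Metric.ball_mem_nhds 0 hε] with x hx s hs
  refine hball _ ?_
  rw [mem_ball_zero_iff] at hx ⊢
  exact (norm_shrink_le K hs x).trans_lt hx

theorem restrict_shrink (K : Finset (Fin n)) (s : ℝ) (x : V n) :
    restrict K (shrink K s x) = (s : ℂ) • restrict K x := by
  funext i
  by_cases h : i ∈ K <;> simp [restrict_apply, shrink, h]

theorem hasDerivAt_comp_shrink {f : V n → ℂ} {K : Finset (Fin n)} {s : ℝ} {x : V n}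
    (hf : AnalyticAt ℂ f (shrink K s x)) :
    HasDerivAt (fun s : ℝ => f (shrink K s x)) (fderiv ℂ f (shrink K s x) (restrict K x)) s := by
  have h : HasFDerivAt f (fderiv ℂ f (shrink K s x)) (shrink K s x) :=
    hf.differentiableAt.hasFDerivAt
  exact (h.restrictScalars ℝ).comp_hasDerivAt s (hasDerivAt_shrink K s x)

/-- A germ with vanishing radial derivative is constant along the rays. -/
theorem eventually_eq_shrink_of_radial_deriv {f : V n → ℂ} (hf : AnalyticAt ℂ f 0)
    (K : Finset (Fin n)) (h : ∀ᶠ x in 𝓝 (0 : V n), fderiv ℂ f x (restrict K x) = 0) :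
    ∀ᶠ x in 𝓝 (0 : V n), f x = f (shrink K 0 x) := by
  filter_upwards [eventually_shrink K (hf.eventually_analyticAt.and h)] with x hx
  have h1 := intervalIntegral.integral_eq_sub_of_hasDeriv_right_of_le
    (f := fun s : ℝ => f (shrink K s x)) (f' := fun _ => 0) zero_le_one
    (fun s hs => (hasDerivAt_comp_shrink (hx s hs).1).continuousAt.continuousWithinAt)
    (fun s hs => by
      have hs' : s ∈ unitInterval := ⟨hs.1.le, hs.2.le⟩
      have h2 := (hx s hs').2
      rw [restrict_shrink, map_smul, smul_eq_mul] at h2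
      have h3 := (mul_eq_zero.1 h2).resolve_left (by exact_mod_cast hs.1.ne')
      have h4 := hasDerivAt_comp_shrink (hx s hs').1
      rw [h3] at h4
      exact h4.hasDerivWithinAt) (by simp)
  simp only [intervalIntegral.integral_zero, shrink_one] at h1
  exact (sub_eq_zero.1 h1.symm)

/-- Such a germ would be homogeneous of degree `-1` along the rays: `s * f (shrink K s x)` is
constant in `s`, and it is zero at `s = 0`. -/
theorem eventually_eq_zero_of_radial_deriv {f : V n → ℂ} (hf : AnalyticAt ℂ f 0)
    (K : Finset (Fin n)) (h : ∀ᶠ x in 𝓝 (0 : V n), fderiv ℂ f x (restrict K x) = - f x) :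
    ∀ᶠ x in 𝓝 (0 : V n), f x = 0 := by
  filter_upwards [eventually_shrink K (hf.eventually_analyticAt.and h)] with x hx
  have hder : ∀ s ∈ unitInterval,
      HasDerivAt (fun s : ℝ => (s : ℂ) * f (shrink K s x)) 0 s := by
    intro s hs
    have h2 := (hx s hs).2
    rw [restrict_shrink, map_smul, smul_eq_mul] at h2
    have h3 : HasDerivAt (fun s : ℝ => (s : ℂ)) 1 s := Complex.ofRealCLM.hasDerivAt
    convert! h3.mul (hasDerivAt_comp_shrink (hx s hs).1) using 1
    rw [h2]; ring
  have h1 := intervalIntegral.integral_eq_sub_of_hasDeriv_right_of_le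
    (f := fun s : ℝ => (s : ℂ) * f (shrink K s x)) (f' := fun _ => 0) zero_le_one
    (fun s hs => (hder s hs).continuousAt.continuousWithinAt)
    (fun s hs => (hder s ⟨hs.1.le, hs.2.le⟩).hasDerivWithinAt) (by simp)
  simpa [shrink_one] using h1.symm

namespace LocalCoords

def symm (Φ : LocalCoords n) : LocalCoords n :=
  ⟨Φ.invFun, Φ.toFun, Φ.inv_zero, Φ.map_zero, Φ.inv_analytic, Φ.analytic, Φ.right_inv, Φ.left_inv⟩

theorem tendsto (Φ : LocalCoords n) : Tendsto Φ.toFun (𝓝 0) (𝓝 0) := by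
  simpa [Φ.map_zero] using Φ.analytic.continuousAt.tendsto

theorem tendsto_inv (Φ : LocalCoords n) : Tendsto Φ.invFun (𝓝 0) (𝓝 0) := Φ.symm.tendsto

theorem eventually_fderiv_inv_apply (Φ : LocalCoords n) : ∀ᶠ x in 𝓝 (0 : V n), ∀ v,
    fderiv ℂ Φ.invFun (Φ.toFun x) (fderiv ℂ Φ.toFun x v) = v := by
  filter_upwards [Φ.left_inv.eventually_nhds, Φ.analytic.eventually_analyticAt,
    Φ.tendsto.eventually Φ.inv_analytic.eventually_analyticAt] with x h1 h2 h3 v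
  have h4 : HasFDerivAt (Φ.invFun ∘ Φ.toFun) _ x :=
    h3.differentiableAt.hasFDerivAt.comp x h2.differentiableAt.hasFDerivAt
  have h5 : HasFDerivAt (Φ.invFun ∘ Φ.toFun) (ContinuousLinearMap.id ℂ (V n)) x :=
    (hasFDerivAt_id x).congr_of_eventuallyEq h1
  exact congrArg (fun L : V n →L[ℂ] V n => L v) (h4.unique h5)

/-- Pulling back by local coordinates and then by their inverse is the identity. -/
theorem eventually_pullback_inv (Φ : LocalCoords n) (ω : OneForm n) :
    ∀ᶠ x in 𝓝 (0 : V n), pullback Φ.toFun (pullback Φ.invFun ω) x = ω x := by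
  filter_upwards [Φ.eventually_fderiv_inv_apply, Φ.left_inv] with x h1 h2
  ext v
  simp [pullback, h1, h2]

theorem not_eventually_pullback_eq_zero (Φ : LocalCoords n) {ω : OneForm n}
    (h : ¬ ∀ᶠ x in 𝓝 (0 : V n), ω x = 0) :
    ¬ ∀ᶠ x in 𝓝 (0 : V n), pullback Φ.toFun ω x = 0 := by
  intro h0
  apply h
  filter_upwards [Φ.symm.eventually_pullback_inv ω, Φ.tendsto_inv.eventually h0] with x h1 h2
  rw [← h1]
  ext v
  have := congrArg (fun L : V n →L[ℂ] ℂ => L (fderiv ℂ Φ.invFun x v)) h2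
  simpa [pullback, symm] using this

end LocalCoords

theorem analyticAt_weight (S : Finset (Fin n)) (i : Fin n) (x : V n) :
    AnalyticAt ℂ (fun x : V n => weight S x i) x := by
  by_cases hi : i ∈ S
  · simpa only [weight, hi, if_true] using analyticAt_apply i x
  · simpa only [weight, hi, if_false] using analyticAt_const

theorem IsLogEquation.div {S : Finset (Fin n)} {a : Fin n → V n → ℂ} {ω : OneForm n}
    (h : IsLogEquation S a ω) (u : V n → ℂ) :
    IsLogEquation S (fun i x => a i x / u x) ω := by
  filter_upwards [h] with x hx hxS v w
  have : ∀ v, logEval S (fun i x => a i x / u x) x v = logEval S a x v / u x := by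
    intro v
    simp only [logEval, Finset.sum_div]
    exact Finset.sum_congr rfl fun i _ => by ring
  rw [this, this, div_mul_eq_mul_div, hx hxS v w, div_mul_eq_mul_div]

/-- A logarithmic form annihilated by the radial vector field of the coordinates of index outside
`insert e S` only involves the coordinates of index in `insert e S`. -/
theorem eventually_eq_of_radial_annihilation {S K : Finset (Fin n)} {e : Fin n} (heK : e ∉ K)
    (hSK : Disjoint S K)
    {a : Fin n → V n → ℂ} (ha : ∀ i, AnalyticAt ℂ (a i) 0) {ω : OneForm n}
    (hω : AnalyticAt ℂ ω 0) (hω0 : ¬ ∀ᶠ x in 𝓝 (0 : V n), ω x = 0) (hint : Integrable ω)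
    (he : ∀ᶠ x in 𝓝 (0 : V n), a e x = 1) (hlog : IsLogEquation S a ω)
    (hrad : ∀ᶠ x in 𝓝 (0 : V n), ∑ k ∈ K, x k * a k x = 0) :
    (∀ k ∈ K, ∀ᶠ x in 𝓝 (0 : V n), a k x = 0) ∧
      ∀ k ∉ K, ∀ᶠ x in 𝓝 (0 : V n), a k x = a k (shrink K 0 x) := by
  -- The relation `∑ x j * a j = 0`, differentiated in the direction `k`.
  have hsum : ∀ k, ∀ᶠ x in 𝓝 (0 : V n),
      ∑ j ∈ K, x j * fderiv ℂ (a j) x (Pi.single k 1) = - if k ∈ K then a k x else 0 := by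
    intro k
    filter_upwards [hrad.eventually_nhds,
      (Filter.eventually_all.2 fun i => (ha i).eventually_analyticAt)] with x hx hax
    have h1 : HasFDerivAt (fun y : V n => ∑ j ∈ K, y j * a j y) (0 : V n →L[ℂ] ℂ) x :=
      (hasFDerivAt_const (0 : ℂ) x).congr_of_eventuallyEq hx
    have h2 : HasFDerivAt (fun y : V n => ∑ j ∈ K, y j * a j y) _ x :=
      HasFDerivAt.fun_sum fun j _ =>
        (ContinuousLinearMap.proj (R := ℂ) (φ := fun _ : Fin n => ℂ) j).hasFDerivAt.mul
          (hax j).differentiableAt.hasFDerivAt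
    have h3 := congrArg (fun L : V n →L[ℂ] ℂ => L (Pi.single k 1)) (h2.unique h1)
    simp [Finset.sum_add_distrib, Pi.single_apply] at h3
    linear_combination h3
  -- Multiply the integrability relations for `(j, k)` by `x j` and sum over `j ∈ K`, where the
  -- weights are `1`. The terms in `∂/∂x e` drop out, by `hrad` and by `hsum e`; what remains is the
  -- radial derivative of `a k`, together with `a k` itself when `k ∈ K`.
  have hmain : ∀ k, ∀ᶠ x in 𝓝 (0 : V n),
      fderiv ℂ (a k) x (restrict K x) = - if k ∈ K then a k x else 0 := by
    intro k
    have hint' := Filter.eventually_all.2 fun j =>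
      eventually_integrability_log hω hω0 hint ha he hlog j k
    filter_upwards [hint', hsum k, hsum e, hrad] with x h1 h2 h3 h4
    have h5 : ∑ j ∈ K, x j * (fderiv ℂ (a k) x (Pi.single j 1)
        - weight S x k * fderiv ℂ (a j) x (Pi.single k 1)
        - a j x * (weight S x e * fderiv ℂ (a k) x (Pi.single e 1))
        + a k x * (weight S x e * fderiv ℂ (a j) x (Pi.single e 1))) = 0 := by
      refine Finset.sum_eq_zero fun j hj => ?_
      have hjS : j ∉ S := Finset.disjoint_right.1 hSK hj
      have := h1 j
      simp only [weight, hjS, if_false, one_mul] at this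
      simp only [weight, this, mul_zero]
    have h6 : fderiv ℂ (a k) x (restrict K x) = ∑ j ∈ K, x j * fderiv ℂ (a k) x (Pi.single j 1) := by
      rw [oneForm_apply_eq_sum]
      simp [restrict_apply, Finset.sum_ite_mem]
    rw [if_neg heK, neg_zero] at h3
    have h7 : ∑ j ∈ K, x j * fderiv ℂ (a k) x (Pi.single j 1)
        - weight S x k * ∑ j ∈ K, x j * fderiv ℂ (a j) x (Pi.single k 1)
        - (weight S x e * fderiv ℂ (a k) x (Pi.single e 1)) * ∑ j ∈ K, x j * a j x
        + (a k x * weight S x e) * ∑ j ∈ K, x j * fderiv ℂ (a j) x (Pi.single e 1) = 0 := by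
      rw [← h5, Finset.mul_sum, Finset.mul_sum, Finset.mul_sum, ← Finset.sum_sub_distrib,
        ← Finset.sum_sub_distrib, ← Finset.sum_add_distrib]
      exact Finset.sum_congr rfl fun j _ => by ring
    rw [h2, h3, h4] at h7
    rw [h6]
    by_cases hk : k ∈ K
    · have hkS : k ∉ S := Finset.disjoint_right.1 hSK hk
      simp only [weight, hkS, hk, if_false, if_true] at h7 ⊢
      linear_combination h7
    · simp only [hk, if_false] at h7 ⊢
      linear_combination h7
  refine ⟨fun k hk => eventually_eq_zero_of_radial_deriv (ha k) K ?_, fun k hk =>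
    eventually_eq_shrink_of_radial_deriv (ha k) K ?_⟩
  · simpa [hk] using hmain k
  · simpa [hk] using hmain k

/-- The time `h` flow, starting from `t`, of the vector field `t ∂/∂t` or `∂/∂t`. -/
noncomputable def coordFlow (S : Finset (Fin n)) (e : Fin n) (t h : ℂ) : ℂ :=
  if e ∈ S then t * Complex.exp h else t + h

/-- The map that moves the coordinate of index `e` by `coordFlow` during the time `φ x`. -/
noncomputable def shear (S : Finset (Fin n)) (e : Fin n) (φ : V n → ℂ) (x : V n) : V n :=
  fun i => if i = e then coordFlow S e (x e) (φ x) else x i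

theorem weight_shear_ne_zero {S : Finset (Fin n)} {x : V n} (hx : ∀ i ∈ S, x i ≠ 0) (e : Fin n)
    (φ : V n → ℂ) : ∀ i ∈ S, shear S e φ x i ≠ 0 := by
  intro i hi
  by_cases hie : i = e
  · subst hie
    simpa [shear, coordFlow, hi, Complex.exp_ne_zero] using hx i hi
  · simpa [shear, hie] using hx i hi

theorem analyticAt_coordFlow {W : Type*} [NormedAddCommGroup W] [NormedSpace ℂ W]
    (S : Finset (Fin n)) (e : Fin n) {f g : W → ℂ} {p : W}
    (hf : AnalyticAt ℂ f p) (hg : AnalyticAt ℂ g p) :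
    AnalyticAt ℂ (fun q => coordFlow S e (f q) (g q)) p := by
  by_cases he : e ∈ S
  · simp only [coordFlow, he, if_true]
    exact hf.mul hg.cexp
  · simp only [coordFlow, he, if_false]
    exact hf.add hg

theorem analyticAt_shear (S : Finset (Fin n)) (e : Fin n) {φ : V n → ℂ} {x : V n}
    (hφ : AnalyticAt ℂ φ x) : AnalyticAt ℂ (shear S e φ) x := by
  refine analyticAt_pi_iff.2 fun i => ?_
  by_cases hi : i = e
  · simp only [shear, hi, if_true]
    exact analyticAt_coordFlow S e (analyticAt_apply e x) hφ
  · simp only [shear, hi, if_false]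
    exact analyticAt_apply i x

theorem fderiv_shear_of_ne (S : Finset (Fin n)) {e : Fin n} {φ : V n → ℂ} {x : V n}
    (hφ : AnalyticAt ℂ φ x) (v : V n) {i : Fin n} (hi : i ≠ e) :
    fderiv ℂ (shear S e φ) x v i = v i := by
  have h1 := (ContinuousLinearMap.proj (R := ℂ) (φ := fun _ : Fin n => ℂ) i).hasFDerivAt.comp x
    (analyticAt_shear S e hφ).differentiableAt.hasFDerivAt
  have h2 : ((ContinuousLinearMap.proj (R := ℂ) (φ := fun _ : Fin n => ℂ) i) ∘ shear S e φ)
      = ContinuousLinearMap.proj (R := ℂ) (φ := fun _ : Fin n => ℂ) i := by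
    funext y; simp [shear, hi]
  rw [h2] at h1
  exact congrArg (fun L : V n →L[ℂ] ℂ => L v)
    (h1.unique (ContinuousLinearMap.proj (R := ℂ) (φ := fun _ : Fin n => ℂ) i).hasFDerivAt)

theorem fderiv_shear_self (S : Finset (Fin n)) {e : Fin n} {φ : V n → ℂ} {x : V n}
    (hφ : AnalyticAt ℂ φ x) (v : V n) :
    fderiv ℂ (shear S e φ) x v e = if e ∈ S then
      Complex.exp (φ x) * (v e + x e * fderiv ℂ φ x v) else v e + fderiv ℂ φ x v := by
  have h1 := (ContinuousLinearMap.proj (R := ℂ) (φ := fun _ : Fin n => ℂ) e).hasFDerivAt.comp x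
    (analyticAt_shear S e hφ).differentiableAt.hasFDerivAt
  have h2 : ((ContinuousLinearMap.proj (R := ℂ) (φ := fun _ : Fin n => ℂ) e) ∘ shear S e φ)
      = fun y => coordFlow S e (y e) (φ y) := by
    funext y; simp [shear]
  rw [h2] at h1
  have h3 : HasFDerivAt (fun y : V n => y e)
      (ContinuousLinearMap.proj (R := ℂ) (φ := fun _ : Fin n => ℂ) e) x :=
    (ContinuousLinearMap.proj (R := ℂ) (φ := fun _ : Fin n => ℂ) e).hasFDerivAt
  have h4 := hφ.differentiableAt.hasFDerivAt
  by_cases he : e ∈ S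
  · simp only [coordFlow, he, if_true] at h1 ⊢
    have := congrArg (fun L : V n →L[ℂ] ℂ => L v) (h1.unique (h3.mul h4.cexp))
    simp at this
    rw [this]; ring
  · simp only [coordFlow, he, if_false] at h1 ⊢
    have := congrArg (fun L : V n →L[ℂ] ℂ => L v) (h1.unique (h3.add h4))
    simpa using this

/-- Moving by the flow for a time `φ` turns `dx e / weight S x e` into itself plus `dφ`. Since the
coefficient of index `e` is `1`, the form changes exactly by `dφ`, whose logarithmic coefficients
are `weight S x i * ∂φ/∂x i`. -/
theorem logEval_shear {S : Finset (Fin n)} {e : Fin n} {φ : V n → ℂ} {x : V n}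
    (hφ : AnalyticAt ℂ φ x) (hx : ∀ i ∈ S, x i ≠ 0) (a : Fin n → V n → ℂ)
    (he : a e (shear S e φ x) = 1) (v : V n) :
    logEval S a (shear S e φ x) (fderiv ℂ (shear S e φ) x v) =
      logEval S (fun i x => a i (shear S e φ x) + weight S x i * fderiv ℂ φ x (Pi.single i 1))
        x v := by
  have h1 : ∀ i, a i (shear S e φ x) * fderiv ℂ (shear S e φ) x v i / weight S (shear S e φ x) i
      = a i (shear S e φ x) * v i / weight S x i + if i = e then fderiv ℂ φ x v else 0 := by
    intro i
    by_cases hi : i = e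
    · subst hi
      rw [fderiv_shear_self S hφ, he]
      by_cases hiS : i ∈ S
      · have := hx i hiS
        have h2 := Complex.exp_ne_zero (φ x)
        simp only [weight, hiS, if_true, shear, coordFlow]
        field_simp
      · simp [weight, hiS]
    · rw [fderiv_shear_of_ne S hφ v hi, if_neg hi, add_zero]
      simp [weight, shear, hi]
  have h2 : ∀ i, (a i (shear S e φ x) + weight S x i * fderiv ℂ φ x (Pi.single i 1)) * v i
      / weight S x i
      = a i (shear S e φ x) * v i / weight S x i + v i * fderiv ℂ φ x (Pi.single i 1) := by
    intro i
    have := weight_ne_zero hx i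
    field_simp
  simp only [logEval, h1, h2, Finset.sum_add_distrib, Finset.sum_ite_eq', Finset.mem_univ, if_true]
  rw [← oneForm_apply_eq_sum]

/-- A foliation given by a logarithmic form is, in suitable coordinates, given by a logarithmic form
that only involves the coordinates of its poles, and an additional one `e` with `a e 0 ≠ 0`. -/
theorem exists_straightening {S : Finset (Fin n)} {e : Fin n} {a : Fin n → V n → ℂ}
    (ha : ∀ i, AnalyticAt ℂ (a i) 0) (hae : a e 0 ≠ 0) {ω : OneForm n}
    (hω : AnalyticAt ℂ ω 0) (hω0 : ¬ ∀ᶠ x in 𝓝 (0 : V n), ω x = 0) (hint : Integrable ω)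
    (hlog : IsLogEquation S a ω) :
    ∃ (Θ : LocalCoords n) (b : Fin n → V n → ℂ),
      (∀ x i, i ≠ e → Θ.toFun x i = x i) ∧ (e ∈ S → ∀ x, Θ.toFun x e = 0 ↔ x e = 0) ∧
      (∀ i, AnalyticAt ℂ (b i) 0) ∧ (∀ i ∈ S, b i 0 = a i 0 / a e 0) ∧
      (∀ᶠ x in 𝓝 (0 : V n), b e x = 1) ∧
      (∀ i ∉ insert e S, ∀ᶠ x in 𝓝 (0 : V n), b i x = 0) ∧
      (∀ i, ∀ᶠ x in 𝓝 (0 : V n), b i x = b i (shrink (insert e S)ᶜ 0 x)) ∧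
      IsLogEquation S b (pullback Θ.toFun ω) := by
  let K : Finset (Fin n) := (insert e S)ᶜ
  have heK : e ∉ K := by simp [K]
  have hSK : Disjoint S K := by
    rw [Finset.disjoint_left]; intro i hi; simp [K, hi]
  let α : Fin n → V n → ℂ := fun i x => a i x / a e x
  have hα : ∀ i, AnalyticAt ℂ (α i) 0 := fun i => (ha i).div (ha e) hae
  have hαe : ∀ᶠ x in 𝓝 (0 : V n), α e x = 1 := by
    filter_upwards [(ha e).continuousAt.eventually_ne hae] with x hx
    exact div_self hx
  have hαlog : IsLogEquation S α ω := hlog.div _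
  have hT' : AnalyticAt ℂ (fun p : ℂ × V n => (fun i => if i = e then
      coordFlow S e (p.2 e) p.1 else p.2 i : V n)) 0 := by
    refine analyticAt_pi_iff.2 fun i => ?_
    have h1 : ∀ i, AnalyticAt ℂ (fun p : ℂ × V n => p.2 i) 0 := fun i =>
      ((ContinuousLinearMap.proj (R := ℂ) (φ := fun _ : Fin n => ℂ) i).comp
        (ContinuousLinearMap.snd ℂ ℂ (V n))).analyticAt 0
    by_cases hi : i = e
    · simp only [hi, if_true]
      exact analyticAt_coordFlow S e (h1 e) analyticAt_fst
    · simp only [hi, if_false]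
      exact h1 i
  -- The radial field must annihilate the form plus `dφ`, so the radial derivative of `φ` is
  -- prescribed as `-∑ x k * α k`, evaluated at the moved point. That point involves `φ` itself, so
  -- the equation is nonlinear.
  have hg : ∀ k, AnalyticAt ℂ (fun p : ℂ × V n => - α k (fun i => if i = e then
      coordFlow S e (p.2 e) p.1 else p.2 i)) 0 := by
    intro k
    refine (AnalyticAt.comp (g := α k) ?_ hT').neg
    have : (fun i => if i = e then coordFlow S e ((0 : ℂ × V n).2 e) (0 : ℂ × V n).1
        else (0 : ℂ × V n).2 i : V n) = 0 := by
      funext i; simp [coordFlow]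
    rw [this]; exact hα k
  obtain ⟨φ, hφ, hφK, hφd⟩ := exists_radial_solution K _ hg
  have hφ0 : φ 0 = 0 := hφK.self_of_nhds (by simp)
  let T : V n → V n := shear S e φ
  have hT : AnalyticAt ℂ T 0 := analyticAt_shear S e hφ
  have hT0 : T 0 = 0 := by
    funext i; simp [T, shear, coordFlow, hφ0]
  have hTt : Tendsto T (𝓝 0) (𝓝 0) := by simpa [hT0] using hT.continuousAt.tendsto
  -- The axis of `e` lies in `x_K = 0`, where `φ` vanishes. This makes the shear invertible and
  -- gives `A e 0 = 1`.
  have hφe : fderiv ℂ φ 0 (Pi.single e 1) = 0 := by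
    have h1 : HasDerivAt (fun t : ℂ => t • (Pi.single e 1 : V n)) (Pi.single e 1) 0 := by
      simpa using (hasDerivAt_id (0 : ℂ)).smul_const (Pi.single e 1 : V n)
    have h2 : HasFDerivAt φ (fderiv ℂ φ 0) ((0 : ℂ) • (Pi.single e 1 : V n)) := by
      rw [zero_smul]; exact hφ.differentiableAt.hasFDerivAt
    have h3 := h2.comp_hasDerivAt (0 : ℂ) h1
    have h4 : Tendsto (fun t : ℂ => t • (Pi.single e 1 : V n)) (𝓝 0) (𝓝 0) := by
      simpa using h1.continuousAt.tendsto
    have h5 : (φ ∘ fun t : ℂ => t • (Pi.single e 1 : V n)) =ᶠ[𝓝 0] fun _ => 0 := by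
      filter_upwards [h4.eventually hφK] with t ht
      refine ht fun k hk => ?_
      have : k ≠ e := fun h => heK (h ▸ hk)
      simp [this]
    exact h3.unique ((hasDerivAt_const (0 : ℂ) (0 : ℂ)).congr_of_eventuallyEq h5)
  obtain ⟨Θ, hΘ⟩ := exists_localCoords hT hT0 (by
    intro v hv
    have h1 : ∀ i, i ≠ e → v i = 0 := fun i hi => by
      rw [← fderiv_shear_of_ne S hφ v hi]; exact congrFun hv i
    have h2 : fderiv ℂ φ 0 v = 0 := by
      rw [oneForm_apply_eq_sum]
      refine Finset.sum_eq_zero fun i _ => ?_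
      by_cases hi : i = e
      · subst hi; rw [hφe, mul_zero]
      · rw [h1 i hi, zero_mul]
    have h3 := fderiv_shear_self S hφ v (e := e)
    rw [show fderiv ℂ (shear S e φ) 0 v e = 0 from congrFun hv e, h2, hφ0] at h3
    funext i
    by_cases hi : i = e
    · subst hi
      by_cases hiS : i ∈ S <;> simpa [hiS] using h3.symm
    · exact h1 i hi)
  let A : Fin n → V n → ℂ := fun i x => α i (T x) + weight S x i * fderiv ℂ φ x (Pi.single i 1)
  have hA : ∀ i, AnalyticAt ℂ (A i) 0 := by
    intro i
    refine AnalyticAt.add ?_ ((analyticAt_weight S i 0).mul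
      (analyticAt_clm_apply hφ.fderiv analyticAt_const))
    refine AnalyticAt.comp (g := α i) ?_ hT
    rw [hT0]; exact hα i
  have hAe : A e 0 = 1 := by
    simp only [A, hT0, hφe, mul_zero, add_zero]
    exact hαe.self_of_nhds
  let b : Fin n → V n → ℂ := fun i x => A i x / A e x
  have hb : ∀ i, AnalyticAt ℂ (b i) 0 := fun i => (hA i).div (hA e) (by rw [hAe]; exact one_ne_zero)
  have hbe : ∀ᶠ x in 𝓝 (0 : V n), b e x = 1 := by
    filter_upwards [(hA e).continuousAt.eventually_ne (by rw [hAe]; exact one_ne_zero)] with x hx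
    exact div_self hx
  have hAlog : IsLogEquation S A (pullback T ω) := by
    filter_upwards [hTt.eventually hαlog, hTt.eventually hαe, hφ.eventually_analyticAt] with
      x h1 h2 h3 hxS u v
    have h4 := h1 (weight_shear_ne_zero hxS e φ) (fderiv ℂ T x u) (fderiv ℂ T x v)
    rw [logEval_shear h3 hxS α h2, logEval_shear h3 hxS α h2] at h4
    exact h4
  have hblog : IsLogEquation S b (pullback T ω) := hAlog.div _
  have hrad : ∀ᶠ x in 𝓝 (0 : V n), ∑ k ∈ K, x k * b k x = 0 := by
    filter_upwards [hφd] with x hx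
    have h1 : fderiv ℂ φ x (restrict K x) = ∑ k ∈ K, x k * fderiv ℂ φ x (Pi.single k 1) := by
      rw [oneForm_apply_eq_sum]
      simp [restrict_apply, Finset.sum_ite_mem]
    have h2 : ∑ k ∈ K, x k * A k x = 0 := by
      have h3 : ∀ k ∈ K, x k * A k x
          = x k * α k (T x) + x k * fderiv ℂ φ x (Pi.single k 1) := by
        intro k hk
        have : k ∉ S := Finset.disjoint_right.1 hSK hk
        simp only [A, weight, this, if_false]; ring
      rw [Finset.sum_congr rfl h3, Finset.sum_add_distrib, ← h1, hx, ← Finset.sum_add_distrib]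
      refine Finset.sum_eq_zero fun k _ => ?_
      rw [mul_neg]
      exact add_neg_cancel _
    have h3 : ∑ k ∈ K, x k * b k x = (∑ k ∈ K, x k * A k x) / A e x := by
      rw [Finset.sum_div]
      exact Finset.sum_congr rfl fun k _ => by simp only [b]; ring
    rw [h3, h2, zero_div]
  have hω'0 := Θ.not_eventually_pullback_eq_zero hω0
  rw [hΘ] at hω'0
  obtain ⟨hzero, hconst⟩ := eventually_eq_of_radial_annihilation heK hSK hb
    (analyticAt_pullback hT hT0 hω) hω'0 (integrable_pullback hT hT0 hω hint) hbe hblog hrad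
  refine ⟨Θ, b, ?_, ?_, hb, ?_, hbe, fun i hi => hzero i (Finset.mem_compl.2 hi), ?_, ?_⟩
  · intro x i hi
    rw [hΘ]; simp [T, shear, hi]
  · intro he x
    rw [hΘ]; simp [T, shear, coordFlow, he, Complex.exp_ne_zero]
  -- For `i ∈ S` the weight vanishes at the origin, so adding `dφ` does not change the residues.
  · intro i hi
    simp only [b]
    rw [hAe, div_one]
    simp [A, hT0, α, weight, hi]
  · intro i
    by_cases hi : i ∈ K
    · filter_upwards [hzero i hi, (tendsto_shrink_zero K).eventually (hzero i hi)] with x h1 h2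
      rw [h1]; exact h2.symm
    · exact hconst i hi
  · rw [hΘ]; exact hblog

end CHFol

/-! ### Recognizing corners and normal crossings from a logarithmic form -/

namespace CHFol

variable {n : ℕ}

namespace LocalCoords

/-- The standard coordinates. -/
def refl (n : ℕ) : LocalCoords n :=
  ⟨id, id, rfl, rfl, analyticAt_id, analyticAt_id, Eventually.of_forall fun _ => rfl,
    Eventually.of_forall fun _ => rfl⟩

theorem refl_dcoord (i : Fin n) (x v : V n) : (refl n).dcoord i x v = v i := by
  simp [dcoord, refl]

/-- A permutation of local coordinates. -/
def permute (Φ : LocalCoords n) (ρ : Equiv.Perm (Fin n)) : LocalCoords n where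
  toFun y i := Φ.toFun y (ρ i)
  invFun x := Φ.invFun fun i => x (ρ.symm i)
  map_zero := by funext i; simp [Φ.map_zero]
  inv_zero := by
    change Φ.invFun 0 = 0
    exact Φ.inv_zero
  analytic := analyticAt_pi_iff.2 fun i => analyticAt_pi_iff.1 Φ.analytic (ρ i)
  inv_analytic := by
    refine AnalyticAt.comp (g := Φ.invFun) Φ.inv_analytic ?_
    exact analyticAt_pi_iff.2 fun i => analyticAt_apply _ 0
  left_inv := by
    filter_upwards [Φ.left_inv] with x hx
    simpa using hx
  right_inv := by
    have h : Tendsto (fun x : V n => (fun i => x (ρ.symm i) : V n)) (𝓝 0) (𝓝 0) := by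
      have : Continuous (fun x : V n => (fun i => x (ρ.symm i) : V n)) := by fun_prop
      exact this.tendsto 0
    filter_upwards [h.eventually Φ.right_inv] with x hx
    funext i
    rw [hx]; simp

theorem eventually_dcoord (Φ : LocalCoords n) : ∀ᶠ x in 𝓝 (0 : V n), ∀ i,
    fderiv ℂ (fun y => Φ.toFun y i) x = Φ.dcoord i x := by
  filter_upwards [Φ.analytic.eventually_analyticAt] with x hx i
  exact ((ContinuousLinearMap.proj (R := ℂ) (φ := fun _ : Fin n => ℂ) i).hasFDerivAt.comp x
    hx.differentiableAt.hasFDerivAt).fderiv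

theorem eventually_permute_dcoord (Φ : LocalCoords n) (ρ : Equiv.Perm (Fin n)) :
    ∀ᶠ x in 𝓝 (0 : V n), ∀ i, (Φ.permute ρ).dcoord i x = Φ.dcoord (ρ i) x := by
  filter_upwards [Φ.eventually_dcoord, (Φ.permute ρ).eventually_dcoord] with x h1 h2 i
  rw [← h1, ← h2]; rfl

theorem analyticAt_dcoord (Φ : LocalCoords n) (i : Fin n) : AnalyticAt ℂ (Φ.dcoord i) 0 :=
  analyticAt_clm_comp analyticAt_const Φ.analytic.fderiv

theorem analyticAt_first (Φ : LocalCoords n) {k : ℕ} (hk : k ≤ n) :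
    AnalyticAt ℂ (Φ.first hk) 0 :=
  analyticAt_pi_iff.2 fun i => analyticAt_pi_iff.1 Φ.analytic (Fin.castLE hk i)

theorem first_zero (Φ : LocalCoords n) {k : ℕ} (hk : k ≤ n) : Φ.first hk 0 = 0 := by
  funext i; simp [first, Φ.map_zero]

end LocalCoords

namespace FoliationGerm

/-- The foliation read in the local coordinates `Φ`. -/
noncomputable def transport (F : FoliationGerm n) (Φ : LocalCoords n) : FoliationGerm n where
  form := pullback Φ.invFun F.form
  analytic := analyticAt_pullback Φ.inv_analytic Φ.inv_zero F.analytic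
  integrable := integrable_pullback Φ.inv_analytic Φ.inv_zero F.analytic F.integrable
  saturated := by
    intro h α hh hα heq
    have h1 : AnalyticAt ℂ (fun x => h (Φ.toFun x)) 0 := by
      refine AnalyticAt.comp (g := h) ?_ Φ.analytic
      rwa [Φ.map_zero]
    have h2 := F.saturated _ _ h1 (analyticAt_pullback Φ.analytic Φ.map_zero hα) (by
      filter_upwards [Φ.eventually_pullback_inv F.form, Φ.tendsto.eventually heq] with x h3 h4
      rw [← h3]
      ext v
      change pullback Φ.invFun F.form (Φ.toFun x) _ = _
      rw [h4]; rfl)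
    rwa [Φ.map_zero] at h2

end FoliationGerm

/-- Every neighbourhood of the origin in `x_Z = 0` has points off the hyperplanes of `S`, provided
that `S` and `Z` are disjoint; this is used to argue at a generic point of a subspace. -/
theorem not_eventually_generic {S Z : Finset (Fin n)} (hSZ : Disjoint S Z) {p : V n → Prop}
    (h : ∀ᶠ x in 𝓝 (0 : V n), p x)
    (hp : ∀ x, p x → (∀ i ∈ Z, x i = 0) → (∀ i ∈ S, x i ≠ 0) → False) : False := by
  have h1 := eventually_eq_zero_on_subspace (g := fun _ => (1 : ℂ)) hSZ analyticAt_const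
    (h.mono fun x hx h2 h3 => (hp x hx h2 h3).elim)
  exact one_ne_zero (h1.self_of_nhds fun i _ => rfl)

namespace FoliationGerm

variable {F : FoliationGerm n} {S : Finset (Fin n)} {a : Fin n → V n → ℂ}

theorem clearedForm_of_eq_zero {x : V n} {s : Fin n} (hs : s ∈ S) (hx : x s = 0) (v : V n) :
    clearedForm S a x v = a s x * (∏ j ∈ S.erase s, x j) * v s := by
  rw [clearedForm_apply, Finset.sum_eq_single s]
  · intro i _ hi
    rw [Finset.prod_eq_zero (Finset.mem_erase.2 ⟨hi.symm, hs⟩) hx, mul_zero, zero_mul]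
  · simp

/-- The invariant coordinate hyperplanes of a logarithmic form are its poles. -/
theorem invariantAlong_refl_iff (hS : S.Nonempty) (ha : ∀ i, AnalyticAt ℂ (a i) 0)
    (ha0 : ∀ i ∈ S, a i 0 ≠ 0) (hlog : IsLogEquation S a F.form) (m : Fin n) :
    F.InvariantAlong (LocalCoords.refl n) {m} ↔ m ∈ S := by
  obtain ⟨h, hh, hh0, heq⟩ := F.form_eq_smul_clearedForm hS ha ha0 hlog
  constructor
  · intro hinv
    by_contra hm
    obtain ⟨s, hs⟩ := hS
    have hsm : s ≠ m := fun h => hm (h ▸ hs)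
    -- If `m` is not a pole, then at a generic point of `x m = 0` the direction of a pole `s` is
    -- tangent to this hyperplane, and the form does not vanish on it.
    refine not_eventually_generic (S := S) (Z := {m}) (by simpa using hm)
      (((hinv.and heq).and ((ha s).continuousAt.eventually_ne (ha0 s hs))).and
        (hh.continuousAt.eventually_ne hh0)) ?_
    rintro x ⟨⟨⟨h1, h2⟩, h3⟩, h4⟩ hxm hxS
    have h5 := h1 hxm (Pi.single s 1) (by
      intro i hi
      rw [Finset.mem_singleton.1 hi, LocalCoords.refl_dcoord]
      simp [hsm.symm])
    rw [h2, smul_apply, clearedForm_eq_mul_logEval a hxS, logEval_single] at h5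
    have h6 := weight_ne_zero hxS s
    have h7 := Finset.prod_ne_zero_iff.2 hxS
    simp_all
  · intro hm
    filter_upwards [heq] with x hx hxm v hv
    have hxm' : x m = 0 := hxm m (by simp)
    have hvm := hv m (by simp)
    rw [LocalCoords.refl_dcoord] at hvm
    rw [hx, smul_apply, clearedForm_of_eq_zero hm hxm', hvm, mul_zero, smul_zero]

/-- A logarithmic form cannot depend on less coordinates than its number of poles. -/
theorem card_le_of_dependsOn (hS : S.Nonempty) (ha : ∀ i, AnalyticAt ℂ (a i) 0)
    (ha0 : ∀ i ∈ S, a i 0 ≠ 0) (hlog : IsLogEquation S a F.form) {k : ℕ} (hk : F.DependsOn k) :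
    S.card ≤ k := by
  obtain ⟨h, hh, hh0, heq⟩ := F.form_eq_smul_clearedForm hS ha ha0 hlog
  obtain ⟨hkn, Θ, b, hb, hne, hdef⟩ := hk
  have hα : AnalyticAt ℂ (fun x => ∑ i : Fin k, b i (Θ.first hkn x) •
      Θ.dcoord (Fin.castLE hkn i) x) 0 := by
    refine Finset.analyticAt_fun_sum _ fun i _ => ?_
    have h1 : AnalyticAt ℂ (fun x => b i (Θ.first hkn x)) 0 := by
      refine AnalyticAt.comp (g := b i) ?_ (Θ.analyticAt_first hkn)
      rw [Θ.first_zero]; exact hb i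
    exact h1.smul (Θ.analyticAt_dcoord (Fin.castLE hkn i))
  -- Such a `v` is a constant field in the coordinates `Θ`, tangent to the foliation. On the pole `x
  -- s = 0` the form is a generically nonzero multiple of `dx s`, so the `s` component of the field
  -- vanishes there, in particular at the origin.
  have hkill : ∀ v : V n, (∀ i : Fin k, v (Fin.castLE hkn i) = 0) →
      ∀ s ∈ S, fderiv ℂ Θ.invFun 0 v s = 0 := by
    intro v hv s hs
    have hX : AnalyticAt ℂ (fun y => fderiv ℂ Θ.invFun (Θ.toFun y) v) 0 := by
      refine analyticAt_clm_apply (AnalyticAt.comp (g := fderiv ℂ Θ.invFun) ?_ Θ.analytic)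
        analyticAt_const
      rw [Θ.map_zero]; exact Θ.inv_analytic.fderiv
    have h1 := eventually_eq_zero_of_ne_zero hα hne
      (g := fun y => F.form y (fderiv ℂ Θ.invFun (Θ.toFun y) v))
      (analyticAt_clm_apply F.analytic hX) (by
        filter_upwards [hdef, Θ.tendsto.eventually Θ.symm.eventually_fderiv_inv_apply,
          Θ.left_inv] with y h1 h2 h3 h4
        have h5 : (∑ i : Fin k, b i (Θ.first hkn y) • Θ.dcoord (Fin.castLE hkn i) y)
            (fderiv ℂ Θ.invFun (Θ.toFun y) v) = 0 := by
          rw [sum_apply]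
          refine Finset.sum_eq_zero fun i _ => ?_
          have h6 := h2 v
          simp only [LocalCoords.symm, h3] at h6
          rw [smul_apply]
          simp [LocalCoords.dcoord, h6, hv]
        by_contra h7
        apply h4
        ext u
        have h8 := h1 u (fderiv ℂ Θ.invFun (Θ.toFun y) v)
        rw [h5, zero_mul] at h8
        exact (mul_eq_zero.1 h8).resolve_right h7)
    have hXs : AnalyticAt ℂ (fun y => fderiv ℂ Θ.invFun (Θ.toFun y) v s) 0 :=
      analyticAt_pi_iff.1 hX s
    have h2 := eventually_eq_zero_on_subspace (S := S.erase s) (Z := {s}) (by simp) hXs (by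
      filter_upwards [h1, heq, (ha s).continuousAt.eventually_ne (ha0 s hs),
        hh.continuousAt.eventually_ne hh0] with y h3 h4 h5 h6 hZ hy
      rw [h4, smul_apply, clearedForm_of_eq_zero hs (hZ s (by simp)), smul_eq_mul] at h3
      exact (mul_eq_zero.1 ((mul_eq_zero.1 h3).resolve_left h6)).resolve_left
        (mul_ne_zero h5 (Finset.prod_ne_zero_iff.2 hy)))
    have h3 := h2.self_of_nhds (fun _ _ => rfl)
    rwa [Θ.map_zero] at h3
  let extend : (Fin k → ℂ) → V n := fun z j => if h : (j : ℕ) < k then z ⟨j, h⟩ else 0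
  let M : (Fin k → ℂ) →ₗ[ℂ] (S → ℂ) :=
    { toFun := fun z s => fderiv ℂ Θ.invFun 0 (extend z) s
      map_add' := by
        intro z w
        have : extend (z + w) = extend z + extend w := by
          funext j
          by_cases h : (j : ℕ) < k <;> simp [extend, h]
        funext s
        simp [this]
      map_smul' := by
        intro c z
        have : extend (c • z) = c • extend z := by
          funext j
          by_cases h : (j : ℕ) < k <;> simp [extend, h]
        funext s
        simp [this] }
  -- By `hkill`, replacing the last `n - k` coordinates of a vector by zero does not affect its
  -- components in `S`, so `k` coordinates suffice to reach all of `ℂ^S`.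
  have hM : Function.Surjective M := by
    intro t
    let x : V n := fun j => if h : j ∈ S then t ⟨j, h⟩ else 0
    refine ⟨fun i => fderiv ℂ Θ.toFun 0 x (Fin.castLE hkn i), ?_⟩
    funext s
    have h1 := Θ.eventually_fderiv_inv_apply.self_of_nhds x
    rw [Θ.map_zero] at h1
    have h2 := hkill (extend (fun i => fderiv ℂ Θ.toFun 0 x (Fin.castLE hkn i))
      - fderiv ℂ Θ.toFun 0 x) (fun i => by simp [extend]) s s.2
    rw [map_sub, Pi.sub_apply, h1, sub_eq_zero] at h2
    change fderiv ℂ Θ.invFun 0 _ s = _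
    rw [h2]
    simp [x]
  have := LinearMap.finrank_le_finrank_of_surjective hM
  simpa using this

/-- A foliation given by a logarithmic form with nonzero residues along components of the divisor
`E` has a pre-simple complex hyperbolic corner at the origin. -/
theorem isPreSimpleCHCorner_of_isLogEquation (hS : S.Nonempty) (ha : ∀ i, AnalyticAt ℂ (a i) 0)
    (ha0 : ∀ i ∈ S, a i 0 ≠ 0) (hlog : IsLogEquation S a F.form) {E : Set (V n)}
    {A : Finset (Fin n)} (hE : (LocalCoords.refl n).IsDivisor A E) (hSA : S ⊆ A) :
    F.IsPreSimpleCHCorner E := by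
  obtain ⟨e, he⟩ := hS
  obtain ⟨Θ, b, hΘ, hΘe, hb, hb0, hbe, hbz, hbc, hblog⟩ := exists_straightening ha (ha0 e he)
    F.analytic F.not_eventually_form_eq_zero F.integrable hlog
  rw [Finset.insert_eq_of_mem he] at hbz hbc
  have hb0' : ∀ i ∈ S, b i 0 ≠ 0 := fun i hi => by
    rw [hb0 i hi]; exact div_ne_zero (ha0 i hi) (ha0 e he)
  obtain ⟨h, hh, hh0, heq⟩ := (F.transport Θ.symm).form_eq_smul_clearedForm ⟨e, he⟩ hb hb0' hblog
  have hτ : S.card ≤ n := by simpa using S.card_le_univ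
  -- The normal form uses the first `τ` coordinates, so the poles are moved to the first `S.card`
  -- places.
  obtain ⟨ρ, hρ⟩ : ∃ ρ : Equiv.Perm (Fin n), ∀ i : Fin n, (i : ℕ) < S.card ↔ ρ i ∈ S := by
    have hc : Fintype.card {i : Fin n // (i : ℕ) < S.card} = Fintype.card {i : Fin n // i ∈ S} := by
      rw [Fintype.card_coe, Fintype.card_subtype]
      have : (Finset.univ.filter fun i : Fin n => (i : ℕ) < S.card)
          = Finset.univ.map (Fin.castLEEmb hτ) := by
        ext i
        simp only [Finset.mem_filter, Finset.mem_univ, true_and, Finset.mem_map]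
        exact ⟨fun hi => ⟨⟨i, hi⟩, rfl⟩, by rintro ⟨j, rfl⟩; exact j.2⟩
      rw [this]; simp
    let ε := Fintype.equivOfCardEq hc
    refine ⟨ε.extendSubtype, fun i => ⟨fun hi => ε.extendSubtype_mem i hi, fun hi => ?_⟩⟩
    by_contra h
    exact ε.extendSubtype_not_mem i h hi
  let ι : Fin S.card ↪ Fin n := (Fin.castLEEmb hτ).trans ρ.toEmbedding
  have hι : ∀ i, ι i = ρ (Fin.castLE hτ i) := fun _ => rfl
  have hιS : Finset.univ.map ι = S := by
    ext s
    simp only [Finset.mem_map, Finset.mem_univ, true_and]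
    constructor
    · rintro ⟨i, rfl⟩
      exact (hρ _).1 i.2
    · intro hs
      have : ((ρ.symm s : Fin n) : ℕ) < S.card := (hρ _).2 (by simpa using hs)
      exact ⟨⟨_, this⟩, by simp [hι]⟩
  let Ψ : LocalCoords n := Θ.symm.permute ρ
  have hfirst : ∀ y i, Ψ.first hτ y i = Θ.invFun y (ι i) := fun _ _ => rfl
  let ext : V S.card → V n := fun z j =>
    if h : ((ρ.symm j : Fin n) : ℕ) < S.card then z ⟨_, h⟩ else 0
  have hext : AnalyticAt ℂ ext 0 := by
    refine analyticAt_pi_iff.2 fun j => ?_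
    by_cases h : ((ρ.symm j : Fin n) : ℕ) < S.card
    · simp only [h, dif_pos]; exact analyticAt_apply _ 0
    · simp only [h, dif_neg, not_false_eq_true]; exact analyticAt_const
  have hext0 : ext 0 = 0 := by
    funext j; simp [ext]
  have hextf : ∀ y, ext (Ψ.first hτ y) = shrink Sᶜ 0 (Θ.invFun y) := by
    intro y; funext j
    rw [shrink_zero_apply]
    have hj : ((ρ.symm j : Fin n) : ℕ) < S.card ↔ j ∈ S := by
      rw [hρ]; simp
    by_cases h : j ∈ S
    · simp only [ext, hj.2 h, dif_pos, hfirst, hι]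
      simp [h]
    · have : ¬ ((ρ.symm j : Fin n) : ℕ) < S.card := fun h' => h (hj.1 h')
      simp [ext, this, h]
  let c : Fin S.card → ℂ := fun i => b (ι i) 0
  let β : Fin S.card → V S.card → ℂ := fun i z => b (ι i) (ext z) - b (ι i) 0
  have hβ : ∀ i, AnalyticAt ℂ (β i) 0 ∧ β i 0 = 0 := by
    intro i
    refine ⟨AnalyticAt.sub (AnalyticAt.comp (g := b (ι i)) ?_ hext) analyticAt_const, ?_⟩
    · rw [hext0]; exact hb _
    · simp [β, hext0]
  have hιmem : ∀ i, ι i ∈ S := fun i =>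
    (Finset.ext_iff.1 hιS (ι i)).1 (Finset.mem_map_of_mem ι (Finset.mem_univ i))
  have hform : ∀ᶠ y in 𝓝 (0 : V n), F.form y = h (Θ.invFun y) • logForm Ψ hτ c β y := by
    filter_upwards [Θ.symm.eventually_pullback_inv F.form, Θ.tendsto_inv.eventually heq,
      Θ.symm.eventually_permute_dcoord ρ, Θ.tendsto_inv.eventually (Filter.eventually_all.2 hbc),
      Θ.tendsto_inv.eventually ((Filter.eventually_all_finset _).2
        fun i (hi : i ∈ Sᶜ) => hbz i (Finset.mem_compl.1 hi))] with y h1 h2 h3 h4 h5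
    rw [← h1]
    ext v
    change pullback Θ.toFun F.form (Θ.invFun y) (fderiv ℂ Θ.invFun y v) = _
    have h2' : pullback Θ.toFun F.form (Θ.invFun y) = h (Θ.invFun y) • clearedForm S b (Θ.invFun y) :=
      h2
    rw [h2', smul_apply, smul_apply]
    congr 1
    rw [clearedForm_apply, logForm, sum_apply,
      ← Finset.sum_subset (Finset.subset_univ S) (fun i _ hi => by
        rw [h5 i (Finset.mem_compl.2 hi), zero_mul, zero_mul])]
    conv_lhs => rw [← hιS]
    rw [Finset.sum_map]
    refine Finset.sum_congr rfl fun i _ => ?_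
    rw [smul_apply, smul_eq_mul, h3, ← hι]
    have h6 : c i + β i (Ψ.first hτ y) = b (ι i) (Θ.invFun y) := by
      simp only [c, β, hextf, ← h4 (ι i)]; ring
    have h7 : ∏ j ∈ S.erase (ι i), Θ.invFun y j
        = ∏ j ∈ Finset.univ.erase i, Ψ.first hτ y j := by
      have h8 : S.erase (ι i) = (Finset.univ.erase i).map ι := by rw [Finset.map_erase, hιS]
      rw [h8, Finset.prod_map]
      rfl
    rw [h6, hιS, h7]
    rfl
  have hdef : F.DefinedBy (logForm Ψ hτ c β) := by
    constructor
    · intro h0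
      apply F.not_eventually_form_eq_zero
      filter_upwards [hform, h0] with y h1 h2
      rw [h1, h2]
      ext v
      exact mul_zero _
    · filter_upwards [hform] with y h1 u v
      rw [h1, smul_apply, smul_apply, smul_eq_mul, smul_eq_mul]
      ring
  refine ⟨S.card, hτ, Ψ, c, β, ⟨?_, ?_⟩, ?_, hβ, fun i => hb0' _ (hιmem i), hdef⟩
  · refine ⟨hτ, Ψ, fun i z => (c i + β i z) * ∏ j ∈ Finset.univ.erase i, z j, fun i => ?_, hdef⟩
    exact (analyticAt_const.add (hβ i).1).mul (analyticAt_prod_coord _ 0)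
  · intro k hk
    exact card_le_of_dependsOn ⟨e, he⟩ ha ha0 hlog hk
  · refine ⟨LocalCoords.refl n, A, hE, ?_⟩
    filter_upwards [Θ.right_inv] with y hy
    have hinv := invariantAlong_refl_iff (F := F) ⟨e, he⟩ ha ha0 hlog
    -- The straightening preserves each pole, so the new hyperplanes are the old invariant
    -- components of `E`.
    have hzero : ∀ s ∈ S, Θ.invFun y s = 0 ↔ y s = 0 := by
      intro s hs
      by_cases hse : s = e
      · subst hse
        rw [← hΘe hs, hy]
      · rw [← hΘ (Θ.invFun y) s hse, hy]
    simp only [hinv, hfirst]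
    constructor
    · rintro ⟨i, hi⟩
      exact ⟨ι i, hSA (hιmem i), hιmem i, (hzero _ (hιmem i)).1 hi⟩
    · rintro ⟨m, _, hmS, hm⟩
      obtain ⟨i, _, rfl⟩ := Finset.mem_map.1 (hιS.symm ▸ hmS)
      exact ⟨i, (hzero _ hmS).2 hm⟩

/-- A foliation given by a form which is not zero in the direction of a coordinate `e` has normal
crossings with the divisors given by the other coordinates. -/
theorem normalCrossings_of_isLogEquation_empty (ha : ∀ i, AnalyticAt ℂ (a i) 0) {e : Fin n}
    (hae : a e 0 ≠ 0) (hlog : IsLogEquation ∅ a F.form) {E : Set (V n)} {A : Finset (Fin n)}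
    (hE : (LocalCoords.refl n).IsDivisor A E) (heA : e ∉ A) : F.NormalCrossings E := by
  obtain ⟨Θ, b, hΘ, -, hb, -, hbe, hbz, -, hblog⟩ := exists_straightening ha hae
    F.analytic F.not_eventually_form_eq_zero F.integrable hlog
  refine ⟨?_, Θ.symm, e, ?_, Θ.symm, insert e A, ?_⟩
  · have hq : AnalyticAt ℂ (fun x => F.form x (Pi.single e 1) / a e x) 0 :=
      (analyticAt_clm_apply F.analytic analyticAt_const).div (ha e) hae
    have h1 := F.saturated _ _ hq (analyticAt_clearedForm ∅ ha) (by
      filter_upwards [hlog, (ha e).continuousAt.eventually_ne hae] with x h1 h2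
      ext v
      have h3 := h1 (by simp) (Pi.single e 1) v
      rw [logEval_single] at h3
      rw [smul_apply, clearedForm_eq_mul_logEval a (by simp)]
      simp only [weight, Finset.notMem_empty, if_false, mul_one, div_one, Finset.prod_empty,
        one_mul, smul_eq_mul] at h3 ⊢
      field_simp
      linear_combination h3)
    intro h0
    apply h1
    simp [h0]
  · have hbz' : ∀ᶠ x in 𝓝 (0 : V n), ∀ i, i ≠ e → b i x = 0 := by
      refine Filter.eventually_all.2 fun i => ?_
      by_cases hi : i = e
      · exact Eventually.of_forall fun _ h => (h hi).elim
      · filter_upwards [hbz i (by simpa using hi)] with x hx _ using hx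
    filter_upwards [Θ.symm.eventually_pullback_inv F.form, Θ.tendsto_inv.eventually hblog,
      Θ.tendsto_inv.eventually hbz', Θ.tendsto_inv.eventually hbe] with y h1 h2 h3 h4 h5 v hv
    have hve : fderiv ℂ Θ.invFun y v e = 0 := hv e (by simp)
    have hlogv : ∀ u, logEval ∅ b (Θ.invFun y) u = u e := by
      intro u
      rw [logEval, Finset.sum_eq_single e]
      · simp [h4, weight]
      · intro i _ hi; simp [h3 i hi]
      · simp
    rw [← h1]
    change pullback Θ.toFun F.form (Θ.invFun y) (fderiv ℂ Θ.invFun y v) = 0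
    have h6 := h2 (by simp) (Pi.single e 1) (fderiv ℂ Θ.invFun y v)
    rw [hlogv, hlogv, hve, zero_mul] at h6
    simpa using h6
  -- The coordinates `Θ.symm` differ from the original ones only at `e`, where the new coordinate
  -- defines the leaf. As `e ∉ A`, the divisor keeps its equations.
  · filter_upwards [hE, Θ.right_inv] with y h1 h2
    have h3 : ∀ i ∈ A, Θ.invFun y i = y i := by
      intro i hi
      have hie : i ≠ e := fun h => heA (h ▸ hi)
      rw [← hΘ (Θ.invFun y) i hie, h2]
    simp only [Set.mem_union, Set.mem_ofPred_eq, h1, Finset.mem_insert, LocalCoords.symm,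
      LocalCoords.refl, id]
    constructor
    · rintro (h | ⟨i, hi, hi0⟩)
      · exact ⟨e, Or.inl rfl, h⟩
      · exact ⟨i, Or.inr hi, (h3 i hi).trans hi0⟩
    · rintro ⟨i, rfl | hi, h⟩
      · exact Or.inl h
      · exact Or.inr ⟨i, hi, (h3 i hi).symm.trans h⟩

end FoliationGerm

end CHFol

/-! ### From a corner to a logarithmic form in adapted coordinates -/

namespace CHFol

variable {n : ℕ}

namespace LocalCoords

/-- A coordinate hyperplane contained in a union of coordinate hyperplanes of another system of
coordinates is one of them. -/
theorem exists_eq_unit_mul_coord (Φ Ψ : LocalCoords n) {A : Finset (Fin n)} {k : Fin n}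
    (h : ∀ᶠ x in 𝓝 (0 : V n), Ψ.toFun x k = 0 → ∃ j ∈ A, Φ.toFun x j = 0) :
    ∃ j ∈ A, ∃ u : V n → ℂ, AnalyticAt ℂ u 0 ∧ u 0 ≠ 0 ∧
      ∀ᶠ z in 𝓝 (0 : V n), Ψ.toFun (Φ.invFun z) k = u z * z j := by
  have hcomp : AnalyticAt ℂ (fun w => Φ.toFun (Ψ.invFun w)) 0 := by
    refine AnalyticAt.comp (g := Φ.toFun) ?_ Ψ.inv_analytic
    rw [Ψ.inv_zero]; exact Φ.analytic
  have hcomp' : AnalyticAt ℂ (fun w => Φ.toFun (Ψ.invFun (shrink {k} 0 w))) 0 := by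
    refine AnalyticAt.comp (g := fun w => Φ.toFun (Ψ.invFun w)) ?_ (analyticAt_shrink_zero {k} 0)
    rw [shrink_map_zero]; exact hcomp
  -- The product of the `Φ` coordinates in `A` vanishes on the irreducible hyperplane `Ψ_k = 0`, so
  -- one of them does.
  obtain ⟨j, hj, hjz⟩ := exists_eventually_eq_zero_of_prod A
    (fun j w => Φ.toFun (Ψ.invFun (shrink {k} 0 w)) j)
    (fun j _ => analyticAt_pi_iff.1 hcomp' j) (by
      have ht : Tendsto (fun w => Ψ.invFun (shrink {k} 0 w)) (𝓝 0) (𝓝 0) :=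
        Ψ.tendsto_inv.comp (tendsto_shrink_zero {k})
      filter_upwards [ht.eventually h, (tendsto_shrink_zero {k}).eventually Ψ.right_inv] with
        w h1 h2
      obtain ⟨j, hj, hj0⟩ := h1 (by rw [h2]; simp [shrink])
      exact Finset.prod_eq_zero hj hj0)
  obtain ⟨g, hg, hgeq⟩ := exists_eq_coord_mul (analyticAt_pi_iff.1 hcomp j) k (by
    filter_upwards [hjz] with w h1 h2
    rwa [shrink_zero_of_eq_zero (by simpa using h2)] at h1)
  -- Otherwise the product would have zero differential at the origin, whereas a coordinate function
  -- does not.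
  have hg0 : g 0 ≠ 0 := by
    intro h0
    have h1 : HasFDerivAt (fun w : V n => w k * g w) _ 0 :=
      (ContinuousLinearMap.proj (R := ℂ) (φ := fun _ : Fin n => ℂ) k).hasFDerivAt.mul
        hg.differentiableAt.hasFDerivAt
    have h2 := h1.congr_of_eventuallyEq hgeq
    have h3 : HasFDerivAt Φ.toFun (fderiv ℂ Φ.toFun 0) (Ψ.invFun 0) := by
      rw [Ψ.inv_zero]; exact Φ.analytic.differentiableAt.hasFDerivAt
    have h4 := (ContinuousLinearMap.proj (R := ℂ) (φ := fun _ : Fin n => ℂ) j).hasFDerivAt.comp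
      (0 : V n) (h3.comp (0 : V n) Ψ.inv_analytic.differentiableAt.hasFDerivAt)
    have h5 := congrArg (fun L : V n →L[ℂ] ℂ => L (fderiv ℂ Ψ.toFun 0
      (fderiv ℂ Φ.invFun 0 (Pi.single j 1)))) (h4.unique h2)
    have h6 := Ψ.eventually_fderiv_inv_apply.self_of_nhds (fderiv ℂ Φ.invFun 0 (Pi.single j 1))
    have h7 := Φ.symm.eventually_fderiv_inv_apply.self_of_nhds (Pi.single j 1)
    rw [Ψ.map_zero] at h6
    simp only [symm, Φ.inv_zero] at h7
    simp [h6, h7, h0] at h5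
  have hgc : AnalyticAt ℂ (fun z => g (Ψ.toFun (Φ.invFun z))) 0 := by
    refine AnalyticAt.comp (g := g) ?_ (AnalyticAt.comp (g := Ψ.toFun) ?_ Φ.inv_analytic)
    · rw [Φ.inv_zero, Ψ.map_zero]; exact hg
    · rw [Φ.inv_zero]; exact Ψ.analytic
  have hgc0 : g (Ψ.toFun (Φ.invFun 0)) ≠ 0 := by rwa [Φ.inv_zero, Ψ.map_zero]
  refine ⟨j, hj, fun z => (g (Ψ.toFun (Φ.invFun z)))⁻¹, hgc.inv hgc0, inv_ne_zero hgc0, ?_⟩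
  have ht := Ψ.tendsto.comp Φ.tendsto_inv
  filter_upwards [ht.eventually hgeq, Φ.tendsto_inv.eventually Ψ.left_inv, Φ.right_inv,
    hgc.continuousAt.eventually_ne hgc0] with z h1 h2 h3 h4
  simp only [Function.comp_apply, h2, h3] at h1
  rw [h1]
  field_simp

end LocalCoords

namespace FoliationGerm

variable {F : FoliationGerm n}

/-- At a pre-simple corner for `F` and `E`, in coordinates adapted to `E`, the foliation is given
by a logarithmic form with nonzero residues along some components of `E`. -/
theorem IsPreSimpleCHCorner.exists_isLogEquation {E : Set (V n)} (hF : F.IsPreSimpleCHCorner E)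
    {Φ : LocalCoords n} {A : Finset (Fin n)} (hE : Φ.IsDivisor A E) :
    ∃ (S : Finset (Fin n)) (a : Fin n → V n → ℂ), S ⊆ A ∧ S.Nonempty ∧
      (∀ i, AnalyticAt ℂ (a i) 0) ∧ (∀ i ∈ S, a i 0 ≠ 0) ∧
      IsLogEquation S a (F.transport Φ).form := by
  obtain ⟨τ, hτ, Ψ, c, b, -, ⟨Φ₀, A₀, hE₀, hD⟩, hb, hc, hdef⟩ := hF
  have hcoord : ∀ i : Fin τ, ∃ j ∈ A, ∃ u : V n → ℂ, AnalyticAt ℂ u 0 ∧ u 0 ≠ 0 ∧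
      ∀ᶠ z in 𝓝 (0 : V n), Ψ.toFun (Φ.invFun z) (Fin.castLE hτ i) = u z * z j := by
    intro i
    refine Φ.exists_eq_unit_mul_coord Ψ ?_
    filter_upwards [hE, hE₀, hD] with x h1 h2 h3 h4
    obtain ⟨m, hm, -, hm0⟩ := h3.1 ⟨i, h4⟩
    exact h1.1 (h2.2 ⟨m, hm, hm0⟩)
  choose σ hσA u hu hu0 hσu using hcoord
  -- Two corner coordinates attached to the same `z j` would have proportional differentials at the
  -- origin.
  have hσ : Function.Injective σ := by
    intro i i' hii'
    by_contra hne
    have hder : ∀ i, ∀ v : V n,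
        fderiv ℂ Ψ.toFun 0 (fderiv ℂ Φ.invFun 0 v) (Fin.castLE hτ i) = u i 0 * v (σ i) := by
      intro i v
      have h1 : HasFDerivAt (fun w : V n => u i w * w (σ i)) _ 0 :=
        (hu i).differentiableAt.hasFDerivAt.mul
        (ContinuousLinearMap.proj (R := ℂ) (φ := fun _ : Fin n => ℂ) (σ i)).hasFDerivAt
      have h2 := h1.congr_of_eventuallyEq (hσu i)
      have h3 : HasFDerivAt Ψ.toFun (fderiv ℂ Ψ.toFun 0) (Φ.invFun 0) := by
        rw [Φ.inv_zero]; exact Ψ.analytic.differentiableAt.hasFDerivAt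
      have h4 := (ContinuousLinearMap.proj (R := ℂ) (φ := fun _ : Fin n => ℂ)
        (Fin.castLE hτ i)).hasFDerivAt.comp
        (0 : V n) (h3.comp (0 : V n) Φ.inv_analytic.differentiableAt.hasFDerivAt)
      have h5 := congrArg (fun L : V n →L[ℂ] ℂ => L v) (h4.unique h2)
      simpa using h5
    let v : V n := fderiv ℂ Φ.toFun 0 (fderiv ℂ Ψ.invFun 0 (Pi.single (Fin.castLE hτ i) 1))
    have hv : fderiv ℂ Ψ.toFun 0 (fderiv ℂ Φ.invFun 0 v) = Pi.single (Fin.castLE hτ i) 1 := by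
      have h6 := Φ.eventually_fderiv_inv_apply.self_of_nhds
        (fderiv ℂ Ψ.invFun 0 (Pi.single (Fin.castLE hτ i) 1))
      have h7 := Ψ.symm.eventually_fderiv_inv_apply.self_of_nhds
        (Pi.single (Fin.castLE hτ i) 1)
      rw [Φ.map_zero] at h6
      simp only [LocalCoords.symm, Ψ.inv_zero] at h7
      simp only [v, h6, h7]
    have h1 := hder i v
    have h2 := hder i' v
    rw [hv, Pi.single_eq_same] at h1
    rw [hv, ← hii', Pi.single_eq_of_ne (by
      intro h; exact hne (Fin.castLE_injective hτ h.symm))] at h2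
    have h3 := (mul_eq_zero.1 h2.symm).resolve_left (hu0 i')
    rw [h3, mul_zero] at h1
    exact one_ne_zero h1
  let S : Finset (Fin n) := Finset.univ.image σ
  have hσS : ∀ i, σ i ∈ S := fun i => Finset.mem_image_of_mem σ (Finset.mem_univ i)
  let C : Fin τ → V n → ℂ := fun i z => c i + b i (Ψ.first hτ (Φ.invFun z))
  have hC : ∀ i, AnalyticAt ℂ (C i) 0 := by
    intro i
    refine analyticAt_const.add (AnalyticAt.comp (g := b i) ?_
      (AnalyticAt.comp (g := Ψ.first hτ) ?_ Φ.inv_analytic))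
    · rw [Φ.inv_zero, Ψ.first_zero]; exact (hb i).1
    · rw [Φ.inv_zero]; exact Ψ.analyticAt_first hτ
  have hC0 : ∀ i, C i 0 = c i := fun i => by simp [C, Φ.inv_zero, Ψ.first_zero, (hb i).2]
  -- The corner coordinate of index `i` is `u i * z (σ i)`, and its logarithmic differential is
  -- `dz/z + du/u`. The second sum collects the polar parts; the first collects the regular terms `C
  -- i * du/u`, multiplied by the weight because `logEval` divides by it.
  let a : Fin n → V n → ℂ := fun m z =>
    weight S z m * ∑ i, C i z * fderiv ℂ (u i) z (Pi.single m 1) / u i z +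
      ∑ i, if σ i = m then C i z else 0
  refine ⟨S, a, ?_, ?_, ?_, ?_, ?_⟩
  · intro s hs
    obtain ⟨i, _, rfl⟩ := Finset.mem_image.1 hs
    exact hσA i
  · by_contra hS
    have hτ0 : IsEmpty (Fin τ) := ⟨fun i => hS ⟨_, hσS i⟩⟩
    apply hdef.1
    refine Eventually.of_forall fun x => ?_
    simp [logForm]
  · intro m
    refine ((analyticAt_weight S m 0).mul (Finset.analyticAt_fun_sum _ fun i _ =>
      ((hC i).mul (analyticAt_clm_apply (hu i).fderiv analyticAt_const)).div (hu i) (hu0 i))).add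
      (Finset.analyticAt_fun_sum _ fun i _ => ?_)
    by_cases h : σ i = m
    · simpa only [h, if_true] using hC i
    · simpa only [h, if_false] using analyticAt_const
  · intro s hs
    obtain ⟨i, _, rfl⟩ := Finset.mem_image.1 hs
    simp only [a, weight, hσS, if_true, Pi.zero_apply, zero_mul, zero_add]
    rw [Finset.sum_eq_single i]
    · simp [hC0, hc]
    · intro i' _ hi'
      rw [if_neg fun h => hi' (hσ h)]
    · simp
  · have hu_ne : ∀ᶠ z in 𝓝 (0 : V n), ∀ i, u i z ≠ 0 :=
      Filter.eventually_all.2 fun i => (hu i).continuousAt.eventually_ne (hu0 i)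
    have hua : ∀ᶠ z in 𝓝 (0 : V n), ∀ i, AnalyticAt ℂ (u i) z :=
      Filter.eventually_all.2 fun i => (hu i).eventually_analyticAt
    have hσu' : ∀ᶠ z in 𝓝 (0 : V n), ∀ i, ∀ᶠ z in 𝓝 z,
        Ψ.toFun (Φ.invFun z) (Fin.castLE hτ i) = u i z * z (σ i) :=
      Filter.eventually_all.2 fun i => (hσu i).eventually_nhds
    filter_upwards [hu_ne, hua, hσu', Φ.tendsto_inv.eventually hdef.2,
      Φ.inv_analytic.eventually_analyticAt,
      Φ.tendsto_inv.eventually Ψ.analytic.eventually_analyticAt] with z h1 h2 h3 h4 h5 h6 hzS v w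
    have hz : ∀ i, z (σ i) ≠ 0 := fun i => hzS _ (hσS i)
    have hp : ∀ i, Ψ.first hτ (Φ.invFun z) i = u i z * z (σ i) := fun i => (h3 i).self_of_nhds
    have hdp : ∀ i v, Ψ.dcoord (Fin.castLE hτ i) (Φ.invFun z) (fderiv ℂ Φ.invFun z v)
        = u i z * v (σ i) + z (σ i) * fderiv ℂ (u i) z v := by
      intro i v
      have e1 : HasFDerivAt (fun w : V n => u i w * w (σ i)) _ z :=
        (h2 i).differentiableAt.hasFDerivAt.mul
        (ContinuousLinearMap.proj (R := ℂ) (φ := fun _ : Fin n => ℂ) (σ i)).hasFDerivAt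
      have e2 := e1.congr_of_eventuallyEq (h3 i)
      have e4 := (ContinuousLinearMap.proj (R := ℂ) (φ := fun _ : Fin n => ℂ)
        (Fin.castLE hτ i)).hasFDerivAt.comp
        z (h6.differentiableAt.hasFDerivAt.comp z h5.differentiableAt.hasFDerivAt)
      have e5 := congrArg (fun L : V n →L[ℂ] ℂ => L v) (e4.unique e2)
      simpa [LocalCoords.dcoord] using e5
    have hlog : ∀ v, logForm Ψ hτ c b (Φ.invFun z) (fderiv ℂ Φ.invFun z v)
        = (∏ i, u i z * z (σ i)) * logEval S a z v := by
      intro v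
      have e1 : logEval S a z v
          = ∑ i, C i z * (v (σ i) / z (σ i) + fderiv ℂ (u i) z v / u i z) := by
        have e2 : ∀ m, a m z * v m / weight S z m
            = ∑ i, (C i z / u i z * (v m * fderiv ℂ (u i) z (Pi.single m 1))
              + if σ i = m then C i z * v m / weight S z m else 0) := by
          intro m
          have := weight_ne_zero hzS m
          rw [Finset.sum_add_distrib]
          simp only [a]
          rw [add_mul, add_div]
          congr 1
          · field_simp
            rw [Finset.sum_mul]
            exact Finset.sum_congr rfl fun i _ => by ring
          · rw [Finset.sum_mul, Finset.sum_div]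
            refine Finset.sum_congr rfl fun i _ => ?_
            by_cases h : σ i = m <;> simp [h]
        simp only [logEval, e2]
        rw [Finset.sum_comm]
        refine Finset.sum_congr rfl fun i _ => ?_
        rw [Finset.sum_add_distrib, ← Finset.mul_sum, ← oneForm_apply_eq_sum]
        simp [weight, hσS]
        ring
      rw [e1, Finset.mul_sum, logForm, sum_apply]
      refine Finset.sum_congr rfl fun i _ => ?_
      rw [smul_apply, smul_eq_mul, hdp, ← Finset.mul_prod_erase Finset.univ _ (Finset.mem_univ i)]
      have e3 : ∏ j ∈ Finset.univ.erase i, Ψ.first hτ (Φ.invFun z) j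
          = ∏ j ∈ Finset.univ.erase i, u j z * z (σ j) :=
        Finset.prod_congr rfl fun j _ => hp j
      rw [e3]
      have := hz i
      have := h1 i
      simp only [C]
      field_simp
    have h7 := h4 (fderiv ℂ Φ.invFun z v) (fderiv ℂ Φ.invFun z w)
    rw [hlog, hlog, mul_assoc, mul_assoc] at h7
    exact mul_left_cancel₀ (Finset.prod_ne_zero_iff.2 fun i _ => mul_ne_zero (h1 i) (hz i)) h7

/-- A coordinate subspace invariant by the foliation is contained in a pole. -/
theorem exists_mem_of_invariantAlong {Φ : LocalCoords n} {B S : Finset (Fin n)}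
    {a : Fin n → V n → ℂ} (hinv : F.InvariantAlong Φ B) (hS : S.Nonempty)
    (ha : ∀ i, AnalyticAt ℂ (a i) 0) (ha0 : ∀ i ∈ S, a i 0 ≠ 0)
    (hlog : IsLogEquation S a (F.transport Φ).form) : ∃ s ∈ S, s ∈ B := by
  by_contra! hSB
  obtain ⟨h, hh, hh0, heq⟩ := (F.transport Φ).form_eq_smul_clearedForm hS ha ha0 hlog
  obtain ⟨s, hs⟩ := hS
  -- If no pole contained the center, the direction of a pole would be tangent to the center, and at
  -- a generic point of the center the form would not vanish on it.
  refine not_eventually_generic (S := S) (Z := B) (Finset.disjoint_left.2 hSB)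
    ((((Φ.tendsto_inv.eventually hinv).and heq).and
      (((ha s).continuousAt.eventually_ne (ha0 s hs)).and
      (hh.continuousAt.eventually_ne hh0))).and
      (Φ.right_inv.and Φ.symm.eventually_fderiv_inv_apply)) ?_
  rintro z ⟨⟨⟨h1, h2⟩, h3, h4⟩, h5, h6⟩ hzB hzS
  have h7 := h1 (by rwa [h5]) (fderiv ℂ Φ.invFun z (Pi.single s 1)) (by
    intro i hi
    have h8 := congrFun (h6 (Pi.single s 1)) i
    have hsi : i ≠ s := fun h => hSB s hs (h ▸ hi)
    simpa [LocalCoords.symm, LocalCoords.dcoord, hsi] using h8)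
  have h8 : (F.transport Φ).form z (Pi.single s 1) = 0 := h7
  rw [h2, smul_apply, clearedForm_eq_mul_logEval a hzS, logEval_single] at h8
  have h9 := weight_ne_zero hzS s
  have h10 := Finset.prod_ne_zero_iff.2 hzS
  simp_all

end FoliationGerm

/-- The ratio of two coefficients of an integrable logarithmic form is constant along the
intersection of the corresponding poles. -/
theorem eventually_eq_const_on_inter_poles {S : Finset (Fin n)} {a : Fin n → V n → ℂ}
    (ha : ∀ i, AnalyticAt ℂ (a i) 0) {e : Fin n} (heS : e ∈ S)
    (he : ∀ᶠ x in 𝓝 (0 : V n), a e x = 1) {ω : OneForm n} (hω : AnalyticAt ℂ ω 0)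
    (hω0 : ¬ ∀ᶠ x in 𝓝 (0 : V n), ω x = 0) (hint : Integrable ω) (hlog : IsLogEquation S a ω)
    {j : Fin n} (hj : j ∈ S) :
    ∀ᶠ x in 𝓝 (0 : V n), x e = 0 → x j = 0 → a j x = a j 0 := by
  let Z : Finset (Fin n) := {e, j}
  -- On `x e = x j = 0` the weights of `e` and `j` vanish, and the integrability relation for `(m,
  -- j)` reduces to `weight S x m * ∂(a j)/∂x m = 0`.
  have hd : ∀ m ∉ Z, ∀ᶠ x in 𝓝 (0 : V n), (∀ i ∈ Z, x i = 0) →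
      fderiv ℂ (a j) x (Pi.single m 1) = 0 := by
    intro m hm
    refine eventually_eq_zero_on_subspace (S := {m}) (by simpa using hm)
      (analyticAt_clm_apply (ha j).fderiv analyticAt_const) ?_
    filter_upwards [eventually_integrability_log hω hω0 hint ha he hlog m j] with x hx hZ hxm
    have h1 : weight S x e = 0 := by simp [weight, heS, hZ e (by simp [Z])]
    have h2 : weight S x j = 0 := by simp [weight, hj, hZ j (by simp [Z])]
    rw [h1, h2] at hx
    have h3 : weight S x m ≠ 0 := by
      by_cases hmS : m ∈ S
      · simpa [weight, hmS] using hxm m (by simp)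
      · simp [weight, hmS]
    simpa [h3] using hx
  let L : V n →L[ℂ] V n := ContinuousLinearMap.id ℂ (V n) - restrict Z
  have hL : ∀ x, L x = shrink Z 0 x := fun x => by rw [shrink_zero]; rfl
  have hf : AnalyticAt ℂ (fun x => a j (L x)) 0 := by
    refine AnalyticAt.comp (g := a j) ?_ (L.analyticAt 0)
    rw [map_zero]; exact ha j
  have hLt : Tendsto L (𝓝 0) (𝓝 0) := by simpa using L.continuous.tendsto 0
  have h1 := eventually_eq_shrink_of_radial_deriv hf Finset.univ (by
    filter_upwards [hLt.eventually ((Filter.eventually_all_finset Zᶜ).2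
      fun m hm => hd m (Finset.mem_compl.1 hm)), hLt.eventually (ha j).eventually_analyticAt]
      with x h1 h2
    have h3 : HasFDerivAt (fun x => a j (L x)) _ x :=
      h2.differentiableAt.hasFDerivAt.comp x L.hasFDerivAt
    have h4 : restrict Finset.univ x = x := by funext i; simp [restrict_apply]
    rw [h3.fderiv, h4, ContinuousLinearMap.comp_apply, oneForm_apply_eq_sum]
    refine Finset.sum_eq_zero fun m _ => ?_
    by_cases hm : m ∈ Z
    · rw [hL, shrink_zero_apply, if_pos hm, zero_mul]
    · rw [h1 m (Finset.mem_compl.2 hm) (fun i hi => by rw [hL, shrink_zero_apply, if_pos hi]),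
        mul_zero])
  filter_upwards [h1] with x hx hxe hxj
  have h2 : L x = x := by
    rw [hL]
    exact shrink_zero_of_eq_zero (by simp [Z, hxe, hxj])
  have h3 : shrink Finset.univ 0 x = 0 := by funext i; simp [shrink]
  rw [h2, h3, map_zero] at hx
  exact hx

end CHFol

/-! ### Blowing up a logarithmic form -/

namespace CHFol

variable {n : ℕ}

/-- It is enough to check the equation of a foliation at generic points. -/
theorem isLogEquation_of_generic {W : Type*} [NormedAddCommGroup W] [NormedSpace ℂ W]
    [CompleteSpace W] {S : Finset (Fin n)} {a : Fin n → V n → ℂ} {ω : OneForm n}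
    (ha : ∀ i, AnalyticAt ℂ (a i) 0) (hω : AnalyticAt ℂ ω 0) {p : V n → W}
    (hp : AnalyticAt ℂ p 0) (hp0 : ¬ ∀ᶠ x in 𝓝 (0 : V n), p x = 0)
    (h : ∀ᶠ x in 𝓝 (0 : V n), p x ≠ 0 → (∀ i ∈ S, x i ≠ 0) → ∀ u v : V n,
      logEval S a x u * ω x v = logEval S a x v * ω x u) : IsLogEquation S a ω := by
  have h1 : ∀ i j, ∀ᶠ x in 𝓝 (0 : V n),
      clearedForm S a x (Pi.single i 1) * ω x (Pi.single j 1)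
        - clearedForm S a x (Pi.single j 1) * ω x (Pi.single i 1) = 0 := by
    intro i j
    have hc : ∀ i, AnalyticAt ℂ (fun x => clearedForm S a x (Pi.single i 1)) 0 := fun i =>
      analyticAt_clm_apply (analyticAt_clearedForm S ha) analyticAt_const
    have hω' : ∀ i, AnalyticAt ℂ (fun x => ω x (Pi.single i 1)) 0 := fun i =>
      analyticAt_clm_apply hω analyticAt_const
    have han := ((hc i).mul (hω' j)).sub ((hc j).mul (hω' i))
    refine eventually_eq_zero_of_coord_ne_zero S han ?_
    have h2 := eventually_eq_zero_of_ne_zero hp hp0 (g := fun x => (∏ i ∈ S, x i) *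
      (clearedForm S a x (Pi.single i 1) * ω x (Pi.single j 1)
        - clearedForm S a x (Pi.single j 1) * ω x (Pi.single i 1)))
      ((analyticAt_prod_coord S 0).mul han) (by
        filter_upwards [h] with x hx hpx
        by_cases hxS : ∀ i ∈ S, x i ≠ 0
        · have h3 := hx hpx hxS (Pi.single i 1) (Pi.single j 1)
          rw [clearedForm_eq_mul_logEval a hxS, clearedForm_eq_mul_logEval a hxS]
          linear_combination (∏ i ∈ S, x i) ^ 2 * h3
        · push Not at hxS
          obtain ⟨i, hi, hi0⟩ := hxS
          rw [Finset.prod_eq_zero hi hi0, zero_mul])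
    filter_upwards [h2] with x hx hxS
    exact (mul_eq_zero.1 hx).resolve_left (Finset.prod_ne_zero_iff.2 hxS)
  filter_upwards [Filter.eventually_all.2 fun i => Filter.eventually_all.2 (h1 i)] with x hx hxS u v
  have h2 : clearedForm S a x u * ω x v = clearedForm S a x v * ω x u := by
    rw [oneForm_apply_eq_sum (clearedForm S a x) u, oneForm_apply_eq_sum (ω x) v,
      oneForm_apply_eq_sum (clearedForm S a x) v, oneForm_apply_eq_sum (ω x) u,
      Finset.sum_mul_sum, Finset.sum_mul_sum, Finset.sum_comm]
    refine Finset.sum_congr rfl fun j _ => Finset.sum_congr rfl fun i _ => ?_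
    linear_combination u i * v j * hx i j
  rw [clearedForm_eq_mul_logEval a hxS, clearedForm_eq_mul_logEval a hxS, mul_assoc,
    mul_assoc] at h2
  exact mul_left_cancel₀ (Finset.prod_ne_zero_iff.2 hxS) h2

/-- The slopes `z i / z i₀` of the blow-up, in the chart centered at the line of slopes `ν`. -/
noncomputable def slope (i₀ : Fin n) (ν : Fin n → ℂ) (y : V n) (i : Fin n) : ℂ :=
  if i = i₀ then 1 else y i + ν i

/-- The chart of the blow-up with center `z_B = 0` centered at the line of slopes `ν`. -/
noncomputable def blowChart (B : Finset (Fin n)) (i₀ : Fin n) (ν : Fin n → ℂ) (y : V n) : V n :=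
  fun i => if i ∈ B then y i₀ * slope i₀ ν y i else y i

section BlowChart

variable {B : Finset (Fin n)} {i₀ : Fin n} {ν : Fin n → ℂ}

theorem analyticAt_slope (i : Fin n) (x : V n) : AnalyticAt ℂ (fun y : V n => slope i₀ ν y i) x := by
  by_cases hi : i = i₀
  · simpa only [slope, hi, if_true] using analyticAt_const
  · simp only [slope, hi, if_false]
    exact (analyticAt_apply i x).add analyticAt_const

theorem analyticAt_blowChart (x : V n) : AnalyticAt ℂ (blowChart B i₀ ν) x := by
  refine analyticAt_pi_iff.2 fun i => ?_
  by_cases hi : i ∈ B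
  · simp only [blowChart, hi, if_true]
    exact (analyticAt_apply i₀ x).mul (analyticAt_slope i x)
  · simp only [blowChart, hi, if_false]
    exact analyticAt_apply i x

theorem blowChart_zero : blowChart B i₀ ν 0 = 0 := by
  funext i; simp [blowChart]

theorem tendsto_blowChart : Tendsto (blowChart B i₀ ν) (𝓝 0) (𝓝 0) := by
  simpa [blowChart_zero] using (analyticAt_blowChart (B := B) (i₀ := i₀) (ν := ν)
    0).continuousAt.tendsto

theorem fderiv_blowChart_of_notMem {i : Fin n} (hi : i ∉ B) (y v : V n) :
    fderiv ℂ (blowChart B i₀ ν) y v i = v i := by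
  have h1 := (ContinuousLinearMap.proj (R := ℂ) (φ := fun _ : Fin n => ℂ) i).hasFDerivAt.comp y
    (analyticAt_blowChart (B := B) (i₀ := i₀) (ν := ν) y).differentiableAt.hasFDerivAt
  have h2 : ((ContinuousLinearMap.proj (R := ℂ) (φ := fun _ : Fin n => ℂ) i) ∘ blowChart B i₀ ν)
      = ContinuousLinearMap.proj (R := ℂ) (φ := fun _ : Fin n => ℂ) i := by
    funext y; simp [blowChart, hi]
  rw [h2] at h1
  exact congrArg (fun L : V n →L[ℂ] ℂ => L v)
    (h1.unique (ContinuousLinearMap.proj (R := ℂ) (φ := fun _ : Fin n => ℂ) i).hasFDerivAt)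

theorem fderiv_blowChart_of_mem {i : Fin n} (hi : i ∈ B) (y v : V n) :
    fderiv ℂ (blowChart B i₀ ν) y v i
      = v i₀ * slope i₀ ν y i + if i = i₀ then 0 else y i₀ * v i := by
  have h1 := (ContinuousLinearMap.proj (R := ℂ) (φ := fun _ : Fin n => ℂ) i).hasFDerivAt.comp y
    (analyticAt_blowChart (B := B) (i₀ := i₀) (ν := ν) y).differentiableAt.hasFDerivAt
  have h2 : ((ContinuousLinearMap.proj (R := ℂ) (φ := fun _ : Fin n => ℂ) i) ∘ blowChart B i₀ ν)
      = fun y => y i₀ * slope i₀ ν y i := by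
    funext y; simp [blowChart, hi]
  rw [h2] at h1
  have hp : ∀ i, HasFDerivAt (fun y : V n => y i)
      (ContinuousLinearMap.proj (R := ℂ) (φ := fun _ : Fin n => ℂ) i) y := fun i =>
    (ContinuousLinearMap.proj (R := ℂ) (φ := fun _ : Fin n => ℂ) i).hasFDerivAt
  by_cases hii : i = i₀
  · simp only [slope, hii, if_true, mul_one, add_zero] at h1 ⊢
    exact congrArg (fun L : V n →L[ℂ] ℂ => L v) (h1.unique (hp i₀))
  · simp only [slope, hii, if_false] at h1 ⊢
    have := congrArg (fun L : V n →L[ℂ] ℂ => L v)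
      (h1.unique ((hp i₀).mul ((hp i).add_const (ν i))))
    simp at this
    rw [this]; ring

theorem not_eventually_prod_blowChart_eq_zero :
    ¬ ∀ᶠ y in 𝓝 (0 : V n), ∏ i, (y i * slope i₀ ν y i) = 0 := by
  intro h
  obtain ⟨i, -, hi⟩ := exists_eventually_eq_zero_of_prod Finset.univ
    (fun i y => y i * slope i₀ ν y i)
    (fun i _ => (analyticAt_apply i 0).mul (analyticAt_slope i 0)) h
  rcases eventually_eq_zero_or (analyticAt_apply i 0) (analyticAt_slope i 0) hi with h1 | h1
  · exact not_eventually_coord_eq_zero i h1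
  · by_cases hii : i = i₀
    · simpa [slope, hii] using h1.self_of_nhds
    · simp only [slope, hii, if_false] at h1
      have h2 := h1.self_of_nhds
      rw [Pi.zero_apply, zero_add] at h2
      exact not_eventually_coord_eq_zero i (by simpa [h2] using h1)

/-- The coefficients of the pull-back of a logarithmic form by a chart of the blow-up; the
coefficient `r` of index `i₀` is given separately. -/
noncomputable def blowCoeff (B S : Finset (Fin n)) (i₀ : Fin n) (ν : Fin n → ℂ)
    (a : Fin n → V n → ℂ) (r : V n → ℂ) (i : Fin n) (y : V n) : ℂ :=
  if i = i₀ then r y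
  else if i ∈ B then
    if i ∈ S then
      if ν i = 0 then a i (blowChart B i₀ ν y) else a i (blowChart B i₀ ν y) / (y i + ν i)
    else y i₀ * a i (blowChart B i₀ ν y)
  else a i (blowChart B i₀ ν y)

/-- The part of the coefficient of index `i₀` which comes from the directions transversal to the
poles. -/
noncomputable def blowRest (B S : Finset (Fin n)) (i₀ : Fin n) (ν : Fin n → ℂ)
    (a : Fin n → V n → ℂ) (y : V n) : ℂ :=
  ∑ i ∈ B \ S, a i (blowChart B i₀ ν y) * slope i₀ ν y i

theorem analyticAt_comp_blowChart {f : V n → ℂ} (hf : AnalyticAt ℂ f 0) :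
    AnalyticAt ℂ (fun y => f (blowChart B i₀ ν y)) 0 := by
  refine AnalyticAt.comp (g := f) ?_ (analyticAt_blowChart 0)
  rwa [blowChart_zero]

theorem analyticAt_blowCoeff {S : Finset (Fin n)} {a : Fin n → V n → ℂ} {r : V n → ℂ}
    (ha : ∀ i, AnalyticAt ℂ (a i) 0) (hr : AnalyticAt ℂ r 0) (i : Fin n) :
    AnalyticAt ℂ (blowCoeff B S i₀ ν a r i) 0 := by
  have hai := analyticAt_comp_blowChart (B := B) (i₀ := i₀) (ν := ν) (ha i)
  unfold blowCoeff
  by_cases h1 : i = i₀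
  · simpa only [h1, if_true] using hr
  by_cases h2 : i ∈ B
  · by_cases h3 : i ∈ S
    · by_cases h4 : ν i = 0
      · simpa only [h1, h2, h3, h4, if_true, if_false] using hai
      · simp only [h1, h2, h3, h4, if_true, if_false]
        exact hai.div ((analyticAt_apply i 0).add analyticAt_const) (by simpa using h4)
    · simp only [h1, h2, h3, if_true, if_false]
      exact (analyticAt_apply i₀ 0).mul hai
  · simpa only [h1, h2, if_true, if_false] using hai

/-- For `i ∈ B ∩ S`, `i ≠ i₀`, one has `dz i / z i = dy i₀ / y i₀ + dy i / (y i + ν i)`, which keeps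
a pole only when `ν i = 0`. For `i ∈ B \ S`, `i ≠ i₀`, one has `dz i = y i₀ dy i + (y i + ν i) dy
i₀`. All contributions to `dy i₀` are gathered in `r`. -/
theorem logEval_blowChart (hB : i₀ ∈ B) {S S' : Finset (Fin n)}
    (hS' : ∀ i, i ≠ i₀ → (i ∈ S' ↔ i ∈ S ∧ (i ∈ B → ν i = 0))) (a : Fin n → V n → ℂ)
    (r : V n → ℂ) {y : V n} (hy : ∀ i, y i ≠ 0) (hy' : ∀ i, slope i₀ ν y i ≠ 0)
    (hr : r y / weight S' y i₀ = (∑ i ∈ S ∩ B, a i (blowChart B i₀ ν y)) / y i₀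
      + blowRest B S i₀ ν a y) (v : V n) :
    logEval S a (blowChart B i₀ ν y) (fderiv ℂ (blowChart B i₀ ν) y v)
      = logEval S' (blowCoeff B S i₀ ν a r) y v := by
  -- The contribution of the index `i` to the coefficient of `dy i₀`.
  let ε : Fin n → ℂ := fun i => (if i ∈ S ∩ B then a i (blowChart B i₀ ν y) / y i₀ else 0)
    + if i ∈ B \ S then a i (blowChart B i₀ ν y) * slope i₀ ν y i else 0
  have hε : ∑ i, ε i = r y / weight S' y i₀ := by
    rw [hr, blowRest, Finset.sum_div, Finset.sum_add_distrib, Finset.sum_ite_mem,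
      Finset.sum_ite_mem, Finset.univ_inter, Finset.univ_inter]
  have hy0 := hy i₀
  have hterm : ∀ i, a i (blowChart B i₀ ν y) * fderiv ℂ (blowChart B i₀ ν) y v i
      / weight S (blowChart B i₀ ν y) i
      = (if i = i₀ then 0 else blowCoeff B S i₀ ν a r i y * v i / weight S' y i)
        + v i₀ * ε i := by
    intro i
    have hyi := hy i
    have hsi := hy' i
    by_cases h2 : i ∈ B
    · rw [fderiv_blowChart_of_mem h2]
      by_cases h3 : i ∈ S
      · by_cases h1 : i = i₀
        · subst h1
          simp only [ε, blowChart, weight, slope, h2, h3, Finset.mem_inter, Finset.mem_sdiff,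
            if_true, if_false, and_self, not_true_eq_false, and_false]
          field_simp
          ring
        · have hs : slope i₀ ν y i = y i + ν i := by simp [slope, h1]
          rw [hs] at hsi
          by_cases h4 : ν i = 0
          · have h5 : i ∈ S' := (hS' i h1).2 ⟨h3, fun _ => h4⟩
            have h6 : slope i₀ ν y i = y i := by simp [hs, h4]
            simp only [ε, blowCoeff, h1, h2, h3, h4, h5, weight, Finset.mem_inter,
              Finset.mem_sdiff, if_true, if_false, and_self, not_true_eq_false, and_false]
            have h7 : blowChart B i₀ ν y i = y i₀ * y i := by simp [blowChart, h2, h6]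
            rw [h7, h6]
            field_simp
            ring
          · have h5 : i ∉ S' := fun h => h4 (((hS' i h1).1 h).2 h2)
            simp only [ε, blowCoeff, h1, h2, h3, h4, h5, weight, Finset.mem_inter,
              Finset.mem_sdiff, if_true, if_false, and_self, not_true_eq_false, and_false]
            have h7 : blowChart B i₀ ν y i = y i₀ * (y i + ν i) := by simp [blowChart, h2, hs]
            rw [h7, hs]
            field_simp
            ring
      · by_cases h1 : i = i₀
        · simp [ε, weight, h1, h1 ▸ h2, h1 ▸ h3]
          ring
        · have h5 : i ∉ S' := fun h => h3 ((hS' i h1).1 h).1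
          simp [ε, weight, blowCoeff, h1, h2, h3, h5]
          ring
    · rw [fderiv_blowChart_of_notMem h2]
      have h1 : i ≠ i₀ := fun h => h2 (h ▸ hB)
      have h5 : i ∈ S' ↔ i ∈ S := by simp [hS' i h1, h2]
      have h7 : blowChart B i₀ ν y i = y i := by simp [blowChart, h2]
      simp [ε, weight, blowCoeff, h1, h2, h5, h7]
  simp only [logEval, hterm, Finset.sum_add_distrib, ← Finset.mul_sum, hε]
  rw [← Finset.add_sum_erase Finset.univ (fun i => blowCoeff B S i₀ ν a r i y * v i / weight S' y i)
    (Finset.mem_univ i₀), ← Finset.add_sum_erase Finset.univ (fun i => if i = i₀ then (0 : ℂ) else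
      blowCoeff B S i₀ ν a r i y * v i / weight S' y i) (Finset.mem_univ i₀), if_pos rfl, zero_add,
    add_comm]
  congr 1
  · simp [blowCoeff]; ring
  · refine Finset.sum_congr rfl fun i hi => ?_
    rw [if_neg (Finset.ne_of_mem_erase hi)]

end BlowChart

namespace FoliationGerm

/-- The transform of a foliation given by a logarithmic form, by a blow-up whose center is
contained in a pole, is given by a logarithmic form whose poles are the strict transforms of the
poles and, when the sum of the residues of the poles that contain the center is not zero, the
exceptional divisor. -/
theorem exists_isLogEquation_blowChart {G F' : FoliationGerm n} {S B : Finset (Fin n)}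
    {i₀ : Fin n} (hi₀ : i₀ ∈ B) {ν : Fin n → ℂ} {a : Fin n → V n → ℂ}
    (ha : ∀ i, AnalyticAt ℂ (a i) 0) (ha0 : ∀ i ∈ S, a i 0 ≠ 0) (hlog : IsLogEquation S a G.form)
    (hSB : ∃ s ∈ S, s ∈ B) (hF' : F'.DefinedBy (pullback (blowChart B i₀ ν) G.form)) :
    ∃ (S' : Finset (Fin n)) (b : Fin n → V n → ℂ),
      (∀ i ∈ S', i ≠ i₀ → i ∈ S ∧ (i ∈ B → ν i = 0)) ∧ (∀ i, AnalyticAt ℂ (b i) 0) ∧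
      (∀ i ∈ S', b i 0 ≠ 0) ∧ IsLogEquation S' b F'.form ∧
      (S' = ∅ → ∃ e ∈ B, e ≠ i₀ ∧ ν e ≠ 0 ∧ b e 0 ≠ 0) := by
  obtain ⟨e, heS, heB⟩ := hSB
  let α : Fin n → V n → ℂ := fun i x => a i x / a e x
  have hα : ∀ i, AnalyticAt ℂ (α i) 0 := fun i => (ha i).div (ha e) (ha0 e heS)
  have hα0 : ∀ i ∈ S, α i 0 ≠ 0 := fun i hi => div_ne_zero (ha0 i hi) (ha0 e heS)
  have hαe : ∀ᶠ x in 𝓝 (0 : V n), α e x = 1 := by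
    filter_upwards [(ha e).continuousAt.eventually_ne (ha0 e heS)] with x hx
    exact div_self hx
  have hαlog : IsLogEquation S α G.form := hlog.div _
  let lam : ℂ := ∑ j ∈ S ∩ B, α j 0
  let res : V n → ℂ := fun y => ∑ j ∈ S ∩ B, α j (blowChart B i₀ ν y)
  have hres : AnalyticAt ℂ res 0 :=
    Finset.analyticAt_fun_sum _ fun j _ => analyticAt_comp_blowChart (hα j)
  have hres0 : res 0 = lam := by simp [res, lam, blowChart_zero]
  have hrest : AnalyticAt ℂ (blowRest B S i₀ ν α) 0 :=
    Finset.analyticAt_fun_sum _ fun j _ =>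
      (analyticAt_comp_blowChart (hα j)).mul (analyticAt_slope j 0)
  -- The exceptional divisor maps into the center, which lies in the pole `e` and in every pole of
  -- `S ∩ B`; there the normalized coefficients are constant.
  have hresE : ∀ᶠ y in 𝓝 (0 : V n), y i₀ = 0 → res y = lam := by
    have h1 : ∀ j ∈ S ∩ B, ∀ᶠ x in 𝓝 (0 : V n), x e = 0 → x j = 0 → α j x = α j 0 :=
      fun j hj => eventually_eq_const_on_inter_poles hα heS hαe G.analytic
        G.not_eventually_form_eq_zero G.integrable hαlog (Finset.mem_inter.1 hj).1
    filter_upwards [tendsto_blowChart.eventually ((Filter.eventually_all_finset _).2 h1)] with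
      y hy hy0
    refine Finset.sum_congr rfl fun j hj => ?_
    have hz : ∀ i ∈ B, blowChart B i₀ ν y i = 0 := fun i hi => by simp [blowChart, hi, hy0]
    exact hy j hj (hz e heB) (hz j (Finset.mem_inter.1 hj).2)
  let T : Finset (Fin n) := Finset.univ.filter fun i => i ≠ i₀ ∧ i ∈ S ∧ (i ∈ B → ν i = 0)
  have hT0 : i₀ ∉ T := by simp [T]
  -- the equation of the transform, once the coefficient of index `i₀` is known
  have key : ∀ (S' : Finset (Fin n)) (r : V n → ℂ),
      (∀ i, i ≠ i₀ → (i ∈ S' ↔ i ∈ S ∧ (i ∈ B → ν i = 0))) → AnalyticAt ℂ r 0 →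
      (∀ᶠ y in 𝓝 (0 : V n), y i₀ ≠ 0 →
        r y / weight S' y i₀ = res y / y i₀ + blowRest B S i₀ ν α y) →
      IsLogEquation S' (blowCoeff B S i₀ ν α r) F'.form := by
    intro S' r hS' hr hry
    have hpull : AnalyticAt ℂ (pullback (blowChart B i₀ ν) G.form) 0 :=
      analyticAt_pullback (analyticAt_blowChart 0) blowChart_zero G.analytic
    have hprod : AnalyticAt ℂ (fun y : V n => ∏ i, (y i * slope i₀ ν y i)) 0 :=
      Finset.analyticAt_fun_prod _ fun i _ =>
        (analyticAt_apply i 0).mul (analyticAt_slope i 0)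
    refine isLogEquation_of_generic (analyticAt_blowCoeff hα hr) F'.analytic
      (p := fun y => (∏ i, (y i * slope i₀ ν y i)) • pullback (blowChart B i₀ ν) G.form y)
      (hprod.smul hpull) ?_ ?_
    · intro h
      rcases eventually_eq_zero_or hprod hpull h with h | h
      · exact not_eventually_prod_blowChart_eq_zero h
      · exact hF'.1 h
    · filter_upwards [tendsto_blowChart.eventually hαlog, hF'.2, hry] with y h1 h2 h3 hp _ u v
      have hp1 : ∏ i, (y i * slope i₀ ν y i) ≠ 0 := by
        contrapose! hp
        simp only [hp]
        ext w
        exact zero_mul _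
      have hp2 : pullback (blowChart B i₀ ν) G.form y ≠ 0 := by
        contrapose! hp
        simp only [hp]
        ext w
        exact mul_zero _
      have hp1' := Finset.prod_ne_zero_iff.1 hp1
      have hy : ∀ i, y i ≠ 0 := fun i => left_ne_zero_of_mul (hp1' i (Finset.mem_univ i))
      have hy' : ∀ i, slope i₀ ν y i ≠ 0 := fun i =>
        right_ne_zero_of_mul (hp1' i (Finset.mem_univ i))
      have h4 : ∀ i ∈ S, blowChart B i₀ ν y i ≠ 0 := by
        intro i _
        by_cases hi : i ∈ B
        · simp only [blowChart, hi, if_true]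
          exact mul_ne_zero (hy i₀) (hy' i)
        · simpa only [blowChart, hi, if_false] using hy i
      have h5 : ∀ u v, logEval S' (blowCoeff B S i₀ ν α r) y u
          * pullback (blowChart B i₀ ν) G.form y v
          = logEval S' (blowCoeff B S i₀ ν α r) y v * pullback (blowChart B i₀ ν) G.form y u := by
        intro u v
        rw [← logEval_blowChart hi₀ hS' α r hy hy' (h3 (hy i₀)),
          ← logEval_blowChart hi₀ hS' α r hy hy' (h3 (hy i₀))]
        exact h1 h4 _ _
      obtain ⟨w, hw⟩ : ∃ w, pullback (blowChart B i₀ ν) G.form y w ≠ 0 := by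
        by_contra! hcon
        exact hp2 (ContinuousLinearMap.ext hcon)
      -- Both forms are proportional to the pull-back. Since the pull-back is nonzero on `w`, they
      -- are proportional to each other.
      refine mul_left_cancel₀ (pow_ne_zero 2 hw) ?_
      have e1 := h5 u w
      have e2 := h5 v w
      have e3 := h2 u w
      have e4 := h2 v w
      generalize pullback (blowChart B i₀ ν) G.form y w = pw at *
      generalize pullback (blowChart B i₀ ν) G.form y u = pu at *
      generalize pullback (blowChart B i₀ ν) G.form y v = pv at *
      linear_combination (pw * F'.form y v) * e1 - (pw * F'.form y u) * e2
        - (logEval S' (blowCoeff B S i₀ ν α r) y w * pu) * e4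
        + (logEval S' (blowCoeff B S i₀ ν α r) y w * pv) * e3
  have hcoeff : ∀ r : V n → ℂ, ∀ i ∈ T, blowCoeff B S i₀ ν α r i 0 ≠ 0 := by
    intro r i hi
    obtain ⟨-, h1, h2, h3⟩ := Finset.mem_filter.1 hi
    by_cases h4 : i ∈ B
    · simpa [blowCoeff, h1, h2, h4, h3 h4, blowChart_zero] using hα0 i h2
    · simpa [blowCoeff, h1, h4, blowChart_zero] using hα0 i h2
  by_cases hlam : lam = 0
  · obtain ⟨g, hg, hgeq⟩ := exists_eq_coord_mul hres i₀ (by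
      filter_upwards [hresE] with y hy hy0
      rw [hy hy0, hlam])
    refine ⟨T, blowCoeff B S i₀ ν α (fun y => g y + blowRest B S i₀ ν α y), ?_,
      analyticAt_blowCoeff hα (hg.add hrest), hcoeff _, key T _ ?_ (hg.add hrest) ?_, ?_⟩
    · intro i hi _
      exact (Finset.mem_filter.1 hi).2.2
    · intro i hi
      simp [T, hi]
    · filter_upwards [hgeq] with y hy hy0
      rw [hy]
      simp only [weight, hT0, if_false]
      field_simp
    · intro hTe
      -- Nonzero residues with zero sum are at least two, so one has index other than `i₀`. As no
      -- pole remains, its strict transform misses the point, and its coefficient becomes `α j / (y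
      -- j + ν j)`, nonzero at the origin.
      obtain ⟨j, hj, hji⟩ : ∃ j ∈ S ∩ B, j ≠ i₀ := by
        by_contra! hcon
        have h1 : S ∩ B = {e} := by
          refine Finset.eq_singleton_iff_unique_mem.2 ⟨Finset.mem_inter.2 ⟨heS, heB⟩, fun j hj => ?_⟩
          rw [hcon j hj, hcon e (Finset.mem_inter.2 ⟨heS, heB⟩)]
        simp only [lam, h1, Finset.sum_singleton] at hlam
        exact hα0 e heS hlam
      obtain ⟨hjS, hjB⟩ := Finset.mem_inter.1 hj
      have hν : ν j ≠ 0 := by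
        intro h
        have : j ∈ T := Finset.mem_filter.2 ⟨Finset.mem_univ j, hji, hjS, fun _ => h⟩
        rw [hTe] at this
        simp at this
      refine ⟨j, hjB, hji, hν, ?_⟩
      simp only [blowCoeff, hji, hjB, hjS, hν, if_true, if_false, blowChart_zero, Pi.zero_apply,
        zero_add]
      exact div_ne_zero (hα0 j hjS) hν
  -- The exceptional divisor is a pole with residue `lam`.
  · have hr : AnalyticAt ℂ (fun y => res y + y i₀ * blowRest B S i₀ ν α y) 0 :=
      hres.add ((analyticAt_apply i₀ 0).mul hrest)
    refine ⟨insert i₀ T, blowCoeff B S i₀ ν α (fun y => res y + y i₀ * blowRest B S i₀ ν α y), ?_,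
      analyticAt_blowCoeff hα hr, ?_, key (insert i₀ T) _ ?_ hr ?_, ?_⟩
    · intro i hi hne
      exact (Finset.mem_filter.1 ((Finset.mem_insert.1 hi).resolve_left hne)).2.2
    · intro i hi
      rcases Finset.mem_insert.1 hi with rfl | hi
      · simpa [blowCoeff, hres0] using hlam
      · exact hcoeff _ i hi
    · intro i hi
      simp [T, hi]
    · refine Eventually.of_forall fun y hy0 => ?_
      simp only [weight, Finset.mem_insert_self, if_true]
      field_simp
    · intro h
      exact absurd h (Finset.insert_ne_empty _ _)

end FoliationGerm

/-- The chart `BlowUp.chart`, in terms of the slopes of its center. -/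
theorem BlowUp.proj_chart_eq {B : Finset (Fin n)} (ℓ : Projectivization ℂ (B → ℂ)) (i₀ : B)
    (y : V n) : (BlowUp.chart ℓ i₀ y).proj
      = blowChart B i₀ (fun i => if h : i ∈ B then ℓ.rep ⟨i, h⟩ / ℓ.rep i₀ else 0) y := by
  funext i
  by_cases hi : i ∈ B
  · by_cases hii : i = (i₀ : Fin n)
    · subst hii
      simp [BlowUp.proj, BlowUp.chart, BlowUp.direction, blowChart, slope]
    · have : (⟨i, hi⟩ : B) ≠ i₀ := fun h => hii (congrArg Subtype.val h)
      simp [BlowUp.proj, BlowUp.chart, BlowUp.direction, blowChart, slope, hi, hii, this]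
  · simp [BlowUp.proj, BlowUp.chart, blowChart, hi]

/-- The total transform of a normal crossings divisor and the center of a blow-up is a normal
crossings divisor. -/
theorem isDivisor_blowDownAt {E Y : Set (V n)} {Φ : LocalCoords n} {A B : Finset (Fin n)}
    (hE : Φ.IsDivisor A E) (hY : Φ.IsSubspace B Y) {i₀ : Fin n} (hi₀ : i₀ ∈ B) (ν : Fin n → ℂ) :
    (LocalCoords.refl n).IsDivisor
      (insert i₀ (A.filter fun i => i ≠ i₀ ∧ (i ∈ B → ν i = 0)))
      ((fun y => Φ.invFun (blowChart B i₀ ν y)) ⁻¹' (E ∪ Y)) := by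
  have hν : ∀ᶠ y in 𝓝 (0 : V n), ∀ i, ν i ≠ 0 → y i + ν i ≠ 0 := by
    refine Filter.eventually_all.2 fun i => ?_
    by_cases h : ν i = 0
    · exact Eventually.of_forall fun _ h' => (h' h).elim
    · filter_upwards [((analyticAt_apply i (0 : V n)).add
        (analyticAt_const (v := ν i))).continuousAt.eventually_ne (by simpa using h)] with y hy _
      exact hy
  have ht : Tendsto (fun y => Φ.invFun (blowChart B i₀ ν y)) (𝓝 0) (𝓝 0) :=
    Φ.tendsto_inv.comp tendsto_blowChart
  filter_upwards [hν, ht.eventually hE, ht.eventually hY,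
    tendsto_blowChart.eventually Φ.right_inv] with y h1 h2 h3 h4
  rw [Set.mem_preimage, Set.mem_union, h2, h3, h4]
  change _ ↔ ∃ i ∈ _, y i = 0
  constructor
  · rintro (⟨i, hiA, hi⟩ | h)
    · by_cases hiB : i ∈ B
      · simp only [blowChart, hiB, if_true] at hi
        rcases mul_eq_zero.1 hi with h | h
        · exact ⟨i₀, Finset.mem_insert_self _ _, h⟩
        · by_cases hii : i = i₀
          · simp [slope, hii] at h
          · simp only [slope, hii, if_false] at h
            have hνi : ν i = 0 := by
              by_contra hne
              exact h1 i hne h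
            refine ⟨i, Finset.mem_insert_of_mem (Finset.mem_filter.2 ⟨hiA, hii, fun _ => hνi⟩), ?_⟩
            simpa [hνi] using h
      · simp only [blowChart, hiB, if_false] at hi
        have hii : i ≠ i₀ := fun h => hiB (h ▸ hi₀)
        exact ⟨i, Finset.mem_insert_of_mem (Finset.mem_filter.2 ⟨hiA, hii, fun h => (hiB h).elim⟩),
          hi⟩
    · have := h i₀ hi₀
      refine ⟨i₀, Finset.mem_insert_self _ _, ?_⟩
      simpa [blowChart, hi₀, slope] using this
  · rintro ⟨i, hi, hy⟩
    rcases Finset.mem_insert.1 hi with rfl | hi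
    · exact Or.inr fun j hj => by simp [blowChart, hj, hy]
    · obtain ⟨hiA, hii, hiν⟩ := Finset.mem_filter.1 hi
      refine Or.inl ⟨i, hiA, ?_⟩
      by_cases hiB : i ∈ B
      · simp [blowChart, hiB, slope, hii, hiν hiB, hy]
      · simp [blowChart, hiB, hy]

end CHFol

/-! ### The transform of a corner at a point of the fiber -/

open CHFol in
theorem proposition4 {n : ℕ} (F : FoliationGerm n) (hF : F.IsCH)
    (E Y : Set (V n))
    -- local coordinates in which both `E` and `Y` are given by coordinates: the divisor `E` has
    -- normal crossings, `Y` is nonsingular and has normal crossings with `E`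
    (Φ : LocalCoords n) (A B : Finset (Fin n))
    (hE : Φ.IsDivisor A E) (hY : Φ.IsSubspace B Y)
    (hB : 2 ≤ B.card) (hYinv : F.InvariantAlong Φ B)
    (hcorner : F.IsPreSimpleCHCorner E)
    -- a point of the fiber over the origin, and a chart of the blow-up centered at it
    (ℓ : Projectivization ℂ (B → ℂ)) (i₀ : B) (hi₀ : ℓ.rep i₀ ≠ 0)
    -- the transformed foliation at this point
    (F' : FoliationGerm n) (hF' : FoliationGerm.IsPullback (blowDownAt Φ ℓ i₀) F F')
    (hsing : F'.AdaptedSingular (blowDownAt Φ ℓ i₀ ⁻¹' (E ∪ Y))) :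
    F'.IsPreSimpleCHCorner (blowDownAt Φ ℓ i₀ ⁻¹' (E ∪ Y)) := by
  obtain ⟨ν, hν⟩ : ∃ ν : Fin n → ℂ,
      blowDownAt Φ ℓ i₀ = fun y => Φ.invFun (blowChart B i₀ ν y) :=
    ⟨_, funext fun y => congrArg Φ.invFun (BlowUp.proj_chart_eq ℓ i₀ y)⟩
  rw [hν] at hF' hsing ⊢
  obtain ⟨S, a, hSA, hS, ha, ha0, hlog⟩ := hcorner.exists_isLogEquation hE
  have hSB := FoliationGerm.exists_mem_of_invariantAlong hYinv hS ha ha0 hlog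
  have hpull : ∀ᶠ y in 𝓝 (0 : V n), pullback (fun y => Φ.invFun (blowChart B i₀ ν y)) F.form y
      = pullback (blowChart B i₀ ν) (F.transport Φ).form y := by
    filter_upwards [tendsto_blowChart.eventually Φ.inv_analytic.eventually_analyticAt] with y hy
    have h1 : HasFDerivAt (fun y => Φ.invFun (blowChart B i₀ ν y)) _ y :=
      hy.differentiableAt.hasFDerivAt.comp y
        (analyticAt_blowChart (B := B) (i₀ := (i₀ : Fin n)) (ν := ν) y).differentiableAt.hasFDerivAt
    simp only [pullback, h1.fderiv]
    rfl
  have hdef : F'.DefinedBy (pullback (blowChart B i₀ ν) (F.transport Φ).form) := by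
    constructor
    · intro h
      apply hF'.1
      filter_upwards [h, hpull] with y h1 h2
      rw [h2, h1]
    · filter_upwards [hF'.2, hpull] with y h1 h2
      rwa [h2] at h1
  obtain ⟨S', b, hS', hb, hb0, hlog', hempty⟩ :=
    FoliationGerm.exists_isLogEquation_blowChart i₀.2 ha ha0 hlog hSB hdef
  have hdiv := isDivisor_blowDownAt hE hY i₀.2 ν
  rcases S'.eq_empty_or_nonempty with h | h
  -- Without poles the form is nonzero in the direction `e`. Since `e ≠ i₀` and `ν e ≠ 0`, the
  -- hyperplane `y e = 0` is not a component of the total transform, which contradicts `hsing`.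
  · obtain ⟨e, heB, hei, heν, hbe⟩ := hempty h
    subst h
    refine (hsing (FoliationGerm.normalCrossings_of_isLogEquation_empty hb hbe hlog' hdiv ?_)).elim
    intro he
    rcases Finset.mem_insert.1 he with he | he
    · exact hei he
    · exact heν ((Finset.mem_filter.1 he).2.2 heB)
  · refine FoliationGerm.isPreSimpleCHCorner_of_isLogEquation h hb hb0 hlog' hdiv ?_
    intro i hi
    by_cases hii : i = i₀
    · rw [hii]; exact Finset.mem_insert_self _ _
    · obtain ⟨h1, h2⟩ := hS' i hi hii
      exact Finset.mem_insert_of_mem (Finset.mem_filter.2 ⟨hSA h1, hii, h2⟩)
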